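/- **Conventions.** Manifolds are smooth, finite-dimensional, Hausdorff and without boundary. A Lie groupoid $\Sigma\rightrightarrows P$ has source $\alpha$ and target $\beta$ (surjective submersions $\Sigma\to P$), unit map $1\colon P\to\Sigma$ (an injective immersion) and a smooth multiplication $(h,g)\mapsto hg$, defined when $\alpha(h)=\beta(g)$. Its Lie algebroid $A\Sigma$ has fibres $A_m\Sigma=\ker T(\alpha)\cap T_{1_m}\Sigma$, anchor $a=T(\beta)$, and the bracket $\overrightarrow{[X,Y]}=[\overrightarrow X,\overrightarrow Y]$, where $\overrightarrow X(g)=T(R_g)(X(\beta g))$ and $R_g(h)=hg$. For a symplectic form $\omega$, put $\omega^\flat(\xi)=-\omega(\xi,\cdot)$, let $\phi\mapsto\phi^\sharp$ be the inverse of $\omega^\flat$, and let $\{f_1,f_2\}=\omega((df_1)^\sharp,(df_2)^\sharp)$ be the associated Poisson bracket. For a Poisson structure $\pi$ on $P$, $T^*P$ denotes the Lie algebroid with anchor $\pi^\#$, $\langle df_2,\pi^\#(df_1)\rangle=\{f_1,f_2\}$, and bracket $[\phi,\psi]=L_{\pi^\#\phi}\psi-L_{\pi^\#\psi}\phi-d(\pi(\phi,\psi))$.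 The tangent groupoid $T\Sigma\rightrightarrows TP$ is obtained by applying the tangent functor to $\Sigma\rightrightarrows P$; its multiplication is written $\eta\bullet\xi$. The cotangent groupoid $T^*\Sigma\rightrightarrows A^*\Sigma$ has, for $\Phi\in T^*_g\Sigma$, target $\langle\widetilde\beta(\Phi),Y\rangle=\langle\Phi,T(R_g)Y\rangle$ and source $\langle\widetilde\alpha(\Phi),X\rangle=\langle\Phi,T(L_g)(X-T(1)(aX))\rangle$, where $L_g(h)=gh$; its multiplication is $\langle\Psi\bullet\Phi,\eta\bullet\xi\rangle=\langle\Psi,\eta\rangle+\langle\Phi,\xi\rangle$, and its identities are $\langle\widetilde 1_\phi,T(1)(x)+X\rangle=\langle\phi,X\rangle$ for $x\in T_mP$, $X\in A_m\Sigma$. **Theorem.** Let $\Sigma\rightrightarrows P$ be a symplectic groupoid: a Lie groupoid with a symplectic form $\omega$ on $\Sigma$ such that the graph $\{(hg,h,g)\mid\alpha(h)=\beta(g)\}$ of multiplication is a Lagrangian submanifold of $\overline\Sigma\times\Sigma\times\Sigma$, where $\overline\Sigma$ is $\Sigma$ with the form $-\omega$. Then: 1. The unit submanifold $1_P=\{1_m\mid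 m\in P\}$ is a Lagrangian submanifold of $\Sigma$. 2. Inversion $g\mapsto g^{-1}$ is an antisymplectomorphism, i.e. a diffeomorphism $\iota$ of $\Sigma$ with $\iota^*\omega=-\omega$. 3. There is a unique Poisson structure on $P$ for which $\beta\colon\Sigma\to P$ is a Poisson map. 4. For this Poisson structure, $A\Sigma$ and $T^*P$ are Lie algebroids and $\omega^\flat$ restricts to an isomorphism of Lie algebroids $r\colon A\Sigma\to T^*P$ over $P$: for $X\in A_m\Sigma$, $\langle r(X),y\rangle=\langle\omega^\flat(X),T(1)(y)\rangle$ for $y\in T_mP$, and $\omega^\flat(X)=r(X)\circ T_{1_m}(\beta)$. 5. $T\Sigma\rightrightarrows TP$ and $T^*\Sigma\rightrightarrows A^*\Sigma$ are groupoids, and $\omega^\flat\colon T\Sigma\to T^*\Sigma$ is a smooth morphism of groupoids over the smooth map $w\colon TP\to A^*\Sigma$, $w(x)=-\omega(T(1)(x),\cdot)|_{A\Sigma}$. -/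

import Mathlib

open scoped Manifold ContDiff Topology
open Manifold Bundle

/-! ## Groupoids and Lie groupoids -/

/-- The structure maps of a groupoid with arrows `G` and objects `M`.  The multiplication
`mul h g = hg` is meaningful only for composable pairs, `src h = tgt g`; its values on all other
pairs are irrelevant and are never used. -/
structure GroupoidData (G M : Type*) where
  src : G → M
  tgt : G → M
  one : M → G
  mul : G → G → G

namespace GroupoidData

variable {G M G' M' : Type*}

/-- The set of composable pairs, the fibre product `G ×_M G`. -/
def composable (D : GroupoidData G M) : Set (G × G) := {p | D.src p.1 = D.tgt p.2}

/-- The graph of multiplication, `{(hg, h, g) | src h = tgt g}`. -/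
def graph (D : GroupoidData G M) : Set (G × G × G) :=
  {p | D.src p.2.1 = D.tgt p.2.2 ∧ p.1 = D.mul p.2.1 p.2.2}

/-- The groupoid axioms. -/
structure IsGroupoid (D : GroupoidData G M) : Prop where
  src_one : ∀ m, D.src (D.one m) = m
  tgt_one : ∀ m, D.tgt (D.one m) = m
  src_mul : ∀ h g, D.src h = D.tgt g → D.src (D.mul h g) = D.src g
  tgt_mul : ∀ h g, D.src h = D.tgt g → D.tgt (D.mul h g) = D.tgt h
  assoc : ∀ h g f, D.src h = D.tgt g → D.src g = D.tgt f →
    D.mul h (D.mul g f) = D.mul (D.mul h g) f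
  one_mul : ∀ g, D.mul (D.one (D.tgt g)) g = g
  mul_one : ∀ g, D.mul g (D.one (D.src g)) = g
  exists_inv : ∀ g, ∃ g', D.src g' = D.tgt g ∧ D.tgt g' = D.src g ∧
    D.mul g' g = D.one (D.src g) ∧ D.mul g g' = D.one (D.tgt g)

/-- `F` on arrows and `f` on objects form a morphism of groupoids. -/
structure IsMorphism (D : GroupoidData G M) (D' : GroupoidData G' M')
    (F : G → G') (f : M → M') : Prop where
  src_map : ∀ g, D'.src (F g) = f (D.src g)
  tgt_map : ∀ g, D'.tgt (F g) = f (D.tgt g)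
  map_one : ∀ m, F (D.one m) = D'.one (f m)
  map_mul : ∀ h g, D.src h = D.tgt g → F (D.mul h g) = D'.mul (F h) (F g)

end GroupoidData

/-- A Lie groupoid `S ⇉ P`; the manifolds `S` and `P` are modelled on `E` and `F`.  Smoothness of
inversion is not part of the definition.  (`ContMDiffOn` on the embedded submanifold of composable
pairs is smoothness on that submanifold.) -/
structure LieGroupoid (E F S P : Type*) [NormedAddCommGroup E] [NormedSpace ℝ E]
    [NormedAddCommGroup F] [NormedSpace ℝ F] [TopologicalSpace S] [ChartedSpace E S]
    [TopologicalSpace P] [ChartedSpace F P] extends GroupoidData S P where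
  isGroupoid : toGroupoidData.IsGroupoid
  src_surjective : Function.Surjective src
  tgt_surjective : Function.Surjective tgt
  src_submersion : IsSubmersion 𝓘(ℝ, E) 𝓘(ℝ, F) ∞ src
  tgt_submersion : IsSubmersion 𝓘(ℝ, E) 𝓘(ℝ, F) ∞ tgt
  one_injective : Function.Injective one
  one_immersion : IsImmersion 𝓘(ℝ, F) 𝓘(ℝ, E) ∞ one
  mul_smooth : ContMDiffOn (𝓘(ℝ, E).prod 𝓘(ℝ, E)) 𝓘(ℝ, E) ∞ (fun p : S × S => mul p.1 p.2)
    toGroupoidData.composable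

/-! ## Symplectic forms and Lagrangian submanifolds -/

section Forms

variable {E H M : Type*} [NormedAddCommGroup E] [NormedSpace ℝ E] [TopologicalSpace H]
  (I : ModelWithCorners ℝ E H) [TopologicalSpace M] [ChartedSpace H M]

/-- `X` is a smooth vector field. -/
def IsSmoothVectorField [IsManifold I ∞ M] (X : ∀ x : M, TangentSpace I x) : Prop :=
  ContMDiff I I.tangent ∞ (fun x => (⟨x, X x⟩ : TangentBundle I M))

/-- `φ` is a smooth 1-form. -/
def IsSmoothOneForm [IsManifold I ∞ M] (φ : ∀ x : M, TangentSpace I x →L[ℝ] ℝ) : Prop :=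
  ContMDiff I (I.prod 𝓘(ℝ, E →L[ℝ] ℝ)) ∞
    (fun x => TotalSpace.mk' (E →L[ℝ] ℝ) (E := fun x : M => TangentSpace I x →L[ℝ] ℝ) x (φ x))

/-- The differential of a real-valued function, as a covector at `x`. -/
noncomputable def dfun (f : M → ℝ) (x : M) : TangentSpace I x →L[ℝ] ℝ := mfderiv I 𝓘(ℝ, ℝ) f x

/-- `L` is a Lagrangian submanifold for the field `σ` of bilinear forms: near each of its points
`L` is, in a smooth chart `e`, a (translate of a) linear subspace `W` of half the dimension, and
`σ` vanishes on the tangent space `(T_p e)⁻¹(W)` of `L` at `p`. -/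
def IsLagrangian (σ : ∀ x : M, TangentSpace I x → TangentSpace I x → ℝ) (L : Set M) : Prop :=
  ∀ p ∈ L, ∃ e ∈ IsManifold.maximalAtlas I ∞ M, p ∈ e.source ∧ ∃ W : Submodule ℝ E,
    (∀ q ∈ e.source, q ∈ L ↔ e.extend I q - e.extend I p ∈ W) ∧
    2 * Module.finrank ℝ W = Module.finrank ℝ E ∧
    ∀ v w : TangentSpace I p,
      (mfderiv I 𝓘(ℝ, E) (e.extend I) p v : E) ∈ W →
      (mfderiv I 𝓘(ℝ, E) (e.extend I) p w : E) ∈ W → σ p v w = 0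

end Forms

/-- A symplectic form: a smooth, closed, nondegenerate 2-form.  Closedness is `dΩ = 0`, with
`dΩ` given by the usual formula on vector fields. -/
structure SymplecticForm {E H : Type*} [NormedAddCommGroup E] [NormedSpace ℝ E]
    [TopologicalSpace H] (I : ModelWithCorners ℝ E H) (M : Type*) [TopologicalSpace M]
    [ChartedSpace H M] [IsManifold I ∞ M] where
  form : ∀ x : M, TangentSpace I x →L[ℝ] TangentSpace I x →L[ℝ] ℝ
  alternating : ∀ x v, form x v v = 0
  nondegenerate : ∀ x v, (∀ w, form x v w = 0) → v = 0
  smooth : ContMDiff I (I.prod 𝓘(ℝ, E →L[ℝ] E →L[ℝ] ℝ)) ∞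
    (fun x => TotalSpace.mk' (E →L[ℝ] E →L[ℝ] ℝ)
      (E := fun x : M => TangentSpace I x →L[ℝ] TangentSpace I x →L[ℝ] ℝ) x (form x))
  closed : ∀ X Y Z : (∀ x : M, TangentSpace I x), IsSmoothVectorField I X →
    IsSmoothVectorField I Y → IsSmoothVectorField I Z → ∀ x,
      dfun I (fun y => form y (Y y) (Z y)) x (X x)
      - dfun I (fun y => form y (X y) (Z y)) x (Y x)
      + dfun I (fun y => form y (X y) (Y y)) x (Z x)
      - form x (VectorField.mlieBracket I X Y x) (Z x)
      + form x (VectorField.mlieBracket I X Z x) (Y x)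
      - form x (VectorField.mlieBracket I Y Z x) (X x) = 0

namespace SymplecticForm

variable {E H M : Type*} [NormedAddCommGroup E] [NormedSpace ℝ E] [TopologicalSpace H]
  {I : ModelWithCorners ℝ E H} [TopologicalSpace M] [ChartedSpace H M] [IsManifold I ∞ M]

/-- `Ω♭(v) = -Ω(v, ·)`. -/
noncomputable def flat (Ω : SymplecticForm I M) (x : M) :
    TangentSpace I x →ₗ[ℝ] (TangentSpace I x →L[ℝ] ℝ) :=
  -(Ω.form x).toLinearMap

theorem flat_injective (Ω : SymplecticForm I M) (x : M) : Function.Injective (Ω.flat x) := by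
  rw [injective_iff_map_eq_zero]
  intro v hv
  refine Ω.nondegenerate x v fun w => ?_
  have h : Ω.flat x v w = 0 := by rw [hv]; rfl
  have h' : -(Ω.form x v w) = 0 := h
  linarith

theorem flat_bijective [FiniteDimensional ℝ E] (Ω : SymplecticForm I M) (x : M) :
    Function.Bijective (Ω.flat x) := by
  refine ⟨Ω.flat_injective x, ?_⟩
  have : FiniteDimensional ℝ (TangentSpace I x) := inferInstanceAs (FiniteDimensional ℝ E)
  have : T2Space (TangentSpace I x) := inferInstanceAs (T2Space E)
  have e : (TangentSpace I x →ₗ[ℝ] ℝ) ≃ₗ[ℝ] (TangentSpace I x →L[ℝ] ℝ) :=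
    LinearMap.toContinuousLinearMap
  have : FiniteDimensional ℝ (TangentSpace I x →L[ℝ] ℝ) := e.finiteDimensional
  have hd : Module.finrank ℝ (TangentSpace I x)
      = Module.finrank ℝ (TangentSpace I x →L[ℝ] ℝ) := by
    rw [← e.finrank_eq]
    exact Subspace.dual_finrank_eq.symm
  exact (LinearMap.injective_iff_surjective_of_finrank_eq_finrank hd).1 (Ω.flat_injective x)

/-- `φ ↦ φ^♯`, the inverse of `Ω♭`. -/
noncomputable def sharp [FiniteDimensional ℝ E] (Ω : SymplecticForm I M) (x : M) :
    (TangentSpace I x →L[ℝ] ℝ) ≃ₗ[ℝ] TangentSpace I x :=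
  (LinearEquiv.ofBijective (Ω.flat x) (Ω.flat_bijective x)).symm

/-- The bracket `{f₁, f₂} = Ω((df₁)^♯, (df₂)^♯)` of the associated Poisson structure. -/
noncomputable def bracket [FiniteDimensional ℝ E] (Ω : SymplecticForm I M)
    (f₁ f₂ : M → ℝ) (x : M) : ℝ :=
  Ω.form x (Ω.sharp x (dfun I f₁ x)) (Ω.sharp x (dfun I f₂ x))

end SymplecticForm

/-- The map `f : M → M` is an antisymplectomorphism: a diffeomorphism with `f^*Ω = -Ω`. -/
def IsAntisymplectomorphism {E H M : Type*} [NormedAddCommGroup E] [NormedSpace ℝ E]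
    [TopologicalSpace H] {I : ModelWithCorners ℝ E H} [TopologicalSpace M] [ChartedSpace H M]
    [IsManifold I ∞ M] (Ω : SymplecticForm I M) (f : M → M) : Prop :=
  (∃ Φ : Diffeomorph I I M M ∞, ⇑Φ = f) ∧
    ∀ (x : M) (v w : TangentSpace I x),
      Ω.form (f x) (mfderiv I I f x v) (mfderiv I I f x w) = -Ω.form x v w

/-! ## Lie algebroids -/

/-- The data of a Lie algebroid on `M`: a family of real vector spaces, its smooth sections, a
bracket and an anchor.  The bracket is meaningful for smooth sections only. -/
structure LieAlgebroidData {F H : Type*} [NormedAddCommGroup F] [NormedSpace ℝ F]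
    [TopologicalSpace H] (J : ModelWithCorners ℝ F H) (M : Type*) [TopologicalSpace M]
    [ChartedSpace H M] where
  Fiber : M → Type*
  [addCommGroup : ∀ m, AddCommGroup (Fiber m)]
  [module : ∀ m, Module ℝ (Fiber m)]
  IsSmooth : (∀ m, Fiber m) → Prop
  bracket : (∀ m, Fiber m) → (∀ m, Fiber m) → ∀ m, Fiber m
  anchor : ∀ m, Fiber m → TangentSpace J m

attribute [instance] LieAlgebroidData.addCommGroup LieAlgebroidData.module

namespace LieAlgebroidData

variable {F H M : Type*} [NormedAddCommGroup F] [NormedSpace ℝ F] [TopologicalSpace H]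
  {J : ModelWithCorners ℝ F H} [TopologicalSpace M] [ChartedSpace H M]

/-- The smooth sections are those of a smooth vector bundle of finite rank with the given fibres:
they form a module over the smooth functions, being a smooth section is a local condition, and
near each point there is a frame of smooth sections in which the coefficients of every smooth
section are smooth. -/
structure IsVectorBundle (A : LieAlgebroidData J M) : Prop where
  zero : A.IsSmooth (fun _ => 0)
  add : ∀ X Y, A.IsSmooth X → A.IsSmooth Y → A.IsSmooth (fun m => X m + Y m)
  smul : ∀ (f : C^∞⟮J, M; ℝ⟯) X, A.IsSmooth X → A.IsSmooth (fun m => f m • X m)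
  isLocal : ∀ X, (∀ m, ∃ Y, A.IsSmooth Y ∧ ∀ᶠ q in 𝓝 m, X q = Y q) → A.IsSmooth X
  exists_frame : ∀ m₀ : M, ∃ (k : ℕ) (s : Fin k → ∀ m, A.Fiber m) (U : Set M),
    IsOpen U ∧ m₀ ∈ U ∧ (∀ i, A.IsSmooth (s i)) ∧
    (∀ m ∈ U, LinearIndependent ℝ (fun i => s i m) ∧
      Submodule.span ℝ (Set.range fun i => s i m) = ⊤) ∧
    ∀ X, A.IsSmooth X → ∃ c : Fin k → M → ℝ, (∀ i, ContMDiffOn J 𝓘(ℝ, ℝ) ∞ (c i) U) ∧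
      ∀ m ∈ U, X m = ∑ i, c i m • s i m

/-- The data form a Lie algebroid: a smooth vector bundle, a Lie bracket on its sections, and an
anchor, which is a smooth vector bundle map to the tangent bundle, with the Leibniz rule
`[X, fY] = f[X, Y] + a(X)(f)Y` and `a[X, Y] = [aX, aY]`. -/
structure IsLieAlgebroid [IsManifold J ∞ M] (A : LieAlgebroidData J M) : Prop where
  isVectorBundle : A.IsVectorBundle
  anchor_add : ∀ m (x y : A.Fiber m), A.anchor m (x + y) = A.anchor m x + A.anchor m y
  anchor_smul : ∀ m (c : ℝ) (x : A.Fiber m), A.anchor m (c • x) = c • A.anchor m x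
  anchor_smooth : ∀ X, A.IsSmooth X → IsSmoothVectorField J (fun m => A.anchor m (X m))
  bracket_smooth : ∀ X Y, A.IsSmooth X → A.IsSmooth Y → A.IsSmooth (A.bracket X Y)
  bracket_add : ∀ X Y Z, A.IsSmooth X → A.IsSmooth Y → A.IsSmooth Z → ∀ m,
    A.bracket X (fun q => Y q + Z q) m = A.bracket X Y m + A.bracket X Z m
  bracket_smul : ∀ (c : ℝ) X Y, A.IsSmooth X → A.IsSmooth Y → ∀ m,
    A.bracket X (fun q => c • Y q) m = c • A.bracket X Y m
  bracket_skew : ∀ X Y, A.IsSmooth X → A.IsSmooth Y → ∀ m,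
    A.bracket X Y m = -A.bracket Y X m
  jacobi : ∀ X Y Z, A.IsSmooth X → A.IsSmooth Y → A.IsSmooth Z → ∀ m,
    A.bracket X (A.bracket Y Z) m + A.bracket Y (A.bracket Z X) m
      + A.bracket Z (A.bracket X Y) m = 0
  leibniz : ∀ (f : C^∞⟮J, M; ℝ⟯) X Y, A.IsSmooth X → A.IsSmooth Y → ∀ m,
    A.bracket X (fun q => f q • Y q) m
      = f m • A.bracket X Y m + dfun J f m (A.anchor m (X m)) • Y m
  anchor_bracket : ∀ X Y, A.IsSmooth X → A.IsSmooth Y → ∀ m,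
    A.anchor m (A.bracket X Y m)
      = VectorField.mlieBracket J (fun q => A.anchor q (X q)) (fun q => A.anchor q (Y q)) m

/-- `φ` is a (base-preserving) isomorphism of Lie algebroids: a fibrewise linear bijection which,
with its inverse, carries smooth sections to smooth sections (so that it is an isomorphism of
vector bundles) and which preserves anchors and brackets. -/
structure IsIso (A B : LieAlgebroidData J M) (φ : ∀ m, A.Fiber m →ₗ[ℝ] B.Fiber m) :
    Prop where
  bijective : ∀ m, Function.Bijective (φ m)
  smooth_iff : ∀ X, A.IsSmooth X ↔ B.IsSmooth (fun m => φ m (X m))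
  anchor : ∀ m x, B.anchor m (φ m x) = A.anchor m x
  bracket : ∀ X Y, A.IsSmooth X → A.IsSmooth Y → ∀ m,
    φ m (A.bracket X Y m) = B.bracket (fun q => φ q (X q)) (fun q => φ q (Y q)) m

end LieAlgebroidData

/-! ## Poisson structures -/

section Poisson

variable {F H : Type*} [NormedAddCommGroup F] [NormedSpace ℝ F] [TopologicalSpace H]
  (J : ModelWithCorners ℝ F H) (M : Type*) [TopologicalSpace M] [ChartedSpace H M]

/-- A Poisson structure: a real Lie algebra bracket on the smooth functions which is a derivation
in each argument. -/
@[ext]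
structure PoissonStructure where
  bracket : C^∞⟮J, M; ℝ⟯ → C^∞⟮J, M; ℝ⟯ → C^∞⟮J, M; ℝ⟯
  add_right : ∀ f g h, bracket f (g + h) = bracket f g + bracket f h
  smul_right : ∀ (c : ℝ) f g, bracket f (c • g) = c • bracket f g
  skew : ∀ f g, bracket f g = -bracket g f
  jacobi : ∀ f g h, bracket f (bracket g h) + bracket g (bracket h f)
    + bracket h (bracket f g) = 0
  leibniz : ∀ f g h, bracket f (g * h) = g * bracket f h + bracket f g * h

end Poisson

namespace PoissonStructure

variable {F H M : Type*} [NormedAddCommGroup F] [NormedSpace ℝ F] [TopologicalSpace H]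
  {J : ModelWithCorners ℝ F H} [TopologicalSpace M] [ChartedSpace H M]

open Classical in
/-- The Poisson anchor `ϖ^# : T^*M → TM`: for `φ ∈ T^*_m M` it is the tangent vector at `m` with
`⟨df₂, ϖ^#(φ)⟩ = ϖ(φ, df₂) = {f₁, f₂}(m)` whenever `d_m f₁ = φ`. -/
noncomputable def anchor (ϖ : PoissonStructure J M) (m : M) (φ : TangentSpace J m →L[ℝ] ℝ) :
    TangentSpace J m :=
  if h : ∃ v : TangentSpace J m, ∀ f₁ f₂ : C^∞⟮J, M; ℝ⟯, dfun J f₁ m = φ →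
      dfun J f₂ m v = ϖ.bracket f₁ f₂ m
  then h.choose else 0

/-- `⟨L_X ψ, Y⟩ = X⟨ψ, Y⟩ - ⟨ψ, [X, Y]⟩`, the Lie derivative of the 1-form `ψ` along `X`, evaluated
on the vector field `Y` at `m`. -/
noncomputable def lieDerivPairing (J : ModelWithCorners ℝ F H) (X : ∀ m : M, TangentSpace J m)
    (ψ : ∀ m : M, TangentSpace J m →L[ℝ] ℝ) (Y : ∀ m : M, TangentSpace J m) (m : M) : ℝ :=
  dfun J (fun q => ψ q (Y q)) m (X m) - ψ m (VectorField.mlieBracket J X Y m)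

variable [IsManifold J ∞ M]

/-- `θ` is the bracket `[φ, ψ] = L_{φ^#} ψ - L_{ψ^#} φ - d(ϖ(φ, ψ))`. -/
def IsFormBracket (ϖ : PoissonStructure J M) (φ ψ θ : ∀ m : M, TangentSpace J m →L[ℝ] ℝ) :
    Prop :=
  ∀ Y : (∀ m : M, TangentSpace J m), IsSmoothVectorField J Y → ∀ m,
    θ m (Y m) = lieDerivPairing J (fun q => ϖ.anchor q (φ q)) ψ Y m
      - lieDerivPairing J (fun q => ϖ.anchor q (ψ q)) φ Y m
      - dfun J (fun q => ψ q (ϖ.anchor q (φ q))) m (Y m)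

open Classical in
/-- The cotangent Lie algebroid `T^*M` of a Poisson manifold. -/
noncomputable def cotangentAlgebroid (ϖ : PoissonStructure J M) : LieAlgebroidData J M where
  Fiber m := TangentSpace J m →L[ℝ] ℝ
  IsSmooth φ := IsSmoothOneForm J φ
  bracket φ ψ := if h : ∃ θ, ϖ.IsFormBracket φ ψ θ then h.choose else 0
  anchor m φ := ϖ.anchor m φ

/-- The map `μ`, from a symplectic manifold to a Poisson manifold, is a Poisson map. -/
def IsPoissonMap {E H' S : Type*} [NormedAddCommGroup E] [NormedSpace ℝ E]
    [FiniteDimensional ℝ E] [TopologicalSpace H'] {I : ModelWithCorners ℝ E H'}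
    [TopologicalSpace S] [ChartedSpace H' S] [IsManifold I ∞ S]
    (Ω : SymplecticForm I S) (ϖ : PoissonStructure J M) (μ : S → M) : Prop :=
  ∀ (f₁ f₂ : C^∞⟮J, M; ℝ⟯) (x : S), Ω.bracket (f₁ ∘ μ) (f₂ ∘ μ) x = ϖ.bracket f₁ f₂ (μ x)

end PoissonStructure

/-! ## Constructions on Lie groupoids

Tangent spaces at equal points are identified without notice: `TangentSpace I x` unfolds to the
model space, through the preferred chart at `x`. -/

namespace LieGroupoid

variable {E F S P : Type*} [NormedAddCommGroup E] [NormedSpace ℝ E]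
  [NormedAddCommGroup F] [NormedSpace ℝ F] [TopologicalSpace S] [ChartedSpace E S]
  [TopologicalSpace P] [ChartedSpace F P]

/-- Inversion `g ↦ g⁻¹`. -/
noncomputable def inv (G : LieGroupoid E F S P) (g : S) : S := (G.isGroupoid.exists_inv g).choose

/-- The tangent map `T(1)` at `m`. -/
noncomputable def oneDeriv (G : LieGroupoid E F S P) (m : P) :
    TangentSpace 𝓘(ℝ, F) m →L[ℝ] TangentSpace 𝓘(ℝ, E) (G.one m) :=
  mfderiv 𝓘(ℝ, F) 𝓘(ℝ, E) G.one m

/-- The tangent map `T(α)` of the source map at the unit `1_m`. -/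
noncomputable def srcDeriv (G : LieGroupoid E F S P) (m : P) :
    TangentSpace 𝓘(ℝ, E) (G.one m) →L[ℝ] TangentSpace 𝓘(ℝ, F) m :=
  mfderiv 𝓘(ℝ, E) 𝓘(ℝ, F) G.src (G.one m)

/-- The tangent map `T(β)` of the target map at the unit `1_m`. -/
noncomputable def tgtDeriv (G : LieGroupoid E F S P) (m : P) :
    TangentSpace 𝓘(ℝ, E) (G.one m) →L[ℝ] TangentSpace 𝓘(ℝ, F) m :=
  mfderiv 𝓘(ℝ, E) 𝓘(ℝ, F) G.tgt (G.one m)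

theorem srcDeriv_oneDeriv (G : LieGroupoid E F S P) (m : P) (x : TangentSpace 𝓘(ℝ, F) m) :
    G.srcDeriv m (G.oneDeriv m x) = x := by
  have hs : MDifferentiableAt 𝓘(ℝ, E) 𝓘(ℝ, F) G.src (G.one m) :=
    (G.src_submersion.contMDiff.contMDiffAt).mdifferentiableAt (by simp)
  have ho : MDifferentiableAt 𝓘(ℝ, F) 𝓘(ℝ, E) G.one m :=
    (G.one_immersion.contMDiff.contMDiffAt).mdifferentiableAt (by simp)
  have hc := mfderiv_comp m hs ho
  have hid : G.src ∘ G.one = id := funext G.isGroupoid.src_one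
  rw [hid, mfderiv_id] at hc
  exact (DFunLike.congr_fun hc x).symm

/-- The fibre `A_m = ker T(α) ∩ T_{1_m} S` of the Lie algebroid. -/
noncomputable def algebroidFiber (G : LieGroupoid E F S P) (m : P) :
    Submodule ℝ (TangentSpace 𝓘(ℝ, E) (G.one m)) :=
  LinearMap.ker (G.srcDeriv m).toLinearMap

/-- `T(R_g)` at `1_{β g}`, where `R_g : α⁻¹(β g) → α⁻¹(α g)`, `h ↦ hg`.  Only its values on vectors
tangent to the source fibre are meaningful. -/
noncomputable def rightDeriv (G : LieGroupoid E F S P) (g : S) :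
    TangentSpace 𝓘(ℝ, E) (G.one (G.tgt g)) →L[ℝ] TangentSpace 𝓘(ℝ, E) g :=
  mfderivWithin 𝓘(ℝ, E) 𝓘(ℝ, E) (fun h => G.mul h g) {h | G.src h = G.tgt g} (G.one (G.tgt g))

/-- `T(L_g)` at `1_{α g}`, where `L_g : β⁻¹(α g) → β⁻¹(β g)`, `h ↦ gh`.  Only its values on vectors
tangent to the target fibre are meaningful. -/
noncomputable def leftDeriv (G : LieGroupoid E F S P) (g : S) :
    TangentSpace 𝓘(ℝ, E) (G.one (G.src g)) →L[ℝ] TangentSpace 𝓘(ℝ, E) g :=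
  mfderivWithin 𝓘(ℝ, E) 𝓘(ℝ, E) (fun h => G.mul g h) {h | G.tgt h = G.src g} (G.one (G.src g))

/-- The right-invariant vector field `g ↦ T(R_g)(X(β g))` of a section `X`. -/
noncomputable def rightInvariant (G : LieGroupoid E F S P) (X : ∀ m, G.algebroidFiber m) (g : S) :
    TangentSpace 𝓘(ℝ, E) g :=
  G.rightDeriv g (X (G.tgt g))

variable [IsManifold 𝓘(ℝ, E) ∞ S] [IsManifold 𝓘(ℝ, F) ∞ P]

/-- `X` is a smooth section of the Lie algebroid: it is smooth as a map `P → TS`. -/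
def IsSmoothSection (G : LieGroupoid E F S P) (X : ∀ m, G.algebroidFiber m) : Prop :=
  ContMDiff 𝓘(ℝ, F) 𝓘(ℝ, E).tangent ∞
    (fun m => (⟨G.one m, (X m : TangentSpace 𝓘(ℝ, E) (G.one m))⟩ : TangentBundle 𝓘(ℝ, E) S))

open Classical in
/-- The Lie algebroid of a Lie groupoid.  The bracket `[X, Y]` is the section whose right-invariant
vector field is the Lie bracket of those of `X` and `Y`; the anchor is `T(β)`. -/
noncomputable def algebroid (G : LieGroupoid E F S P) : LieAlgebroidData 𝓘(ℝ, F) P where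
  Fiber m := G.algebroidFiber m
  IsSmooth X := G.IsSmoothSection X
  bracket X Y :=
    if h : ∃ Z : (∀ m, G.algebroidFiber m), ∀ g, G.rightInvariant Z g
        = VectorField.mlieBracket 𝓘(ℝ, E) (G.rightInvariant X) (G.rightInvariant Y) g
    then h.choose else 0
  anchor m X := G.tgtDeriv m X

/-- The tangent groupoid `TS ⇉ TP`, obtained by applying the tangent functor. -/
noncomputable def tangentGroupoid (G : LieGroupoid E F S P) :
    GroupoidData (TangentBundle 𝓘(ℝ, E) S) (TangentBundle 𝓘(ℝ, F) P) where
  src := tangentMap 𝓘(ℝ, E) 𝓘(ℝ, F) G.src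
  tgt := tangentMap 𝓘(ℝ, E) 𝓘(ℝ, F) G.tgt
  one := tangentMap 𝓘(ℝ, F) 𝓘(ℝ, E) G.one
  mul η ξ := tangentMapWithin (𝓘(ℝ, E).prod 𝓘(ℝ, E)) 𝓘(ℝ, E) (fun p : S × S => G.mul p.1 p.2)
    G.composable ((equivTangentBundleProd 𝓘(ℝ, E) S 𝓘(ℝ, E) S).symm (η, ξ))

/-- The total space of the cotangent bundle `T^*S`. -/
abbrev Cotangent (_G : LieGroupoid E F S P) : Type _ :=
  TotalSpace (E →L[ℝ] ℝ) (fun g : S => TangentSpace 𝓘(ℝ, E) g →L[ℝ] ℝ)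

/-- The total space of the dual `A^*S` of the Lie algebroid. -/
abbrev DualAlgebroid (G : LieGroupoid E F S P) : Type _ :=
  Σ m : P, (G.algebroidFiber m →L[ℝ] ℝ)

/-- The projection `T(1)(x) + X ↦ X` of `T_{1_m} S` onto `A_m`. -/
noncomputable def unitProj (G : LieGroupoid E F S P) (m : P) :
    TangentSpace 𝓘(ℝ, E) (G.one m) →L[ℝ] G.algebroidFiber m :=
  (ContinuousLinearMap.id ℝ (TangentSpace 𝓘(ℝ, E) (G.one m))
    - (G.oneDeriv m).comp (G.srcDeriv m)).codRestrict (G.algebroidFiber m) (by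
      intro v
      change G.srcDeriv m (v - G.oneDeriv m (G.srcDeriv m v)) = 0
      rw [map_sub, srcDeriv_oneDeriv, sub_self])

/-- `Θ ∈ T^*_{hg} S` is the product of `Ψ ∈ T^*_h S` and `Φ ∈ T^*_g S`:
`⟨Θ, η • ξ⟩ = ⟨Ψ, η⟩ + ⟨Φ, ξ⟩` for all composable `η ∈ T_h S`, `ξ ∈ T_g S`. -/
def IsCotangentProduct (G : LieGroupoid E F S P) (Ψ Φ : G.Cotangent)
    (Θ : TangentSpace 𝓘(ℝ, E) (G.mul Ψ.1 Φ.1) →L[ℝ] ℝ) : Prop :=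
  ∀ (η : TangentSpace 𝓘(ℝ, E) Ψ.1) (ξ : TangentSpace 𝓘(ℝ, E) Φ.1),
    G.tangentGroupoid.src ⟨Ψ.1, η⟩ = G.tangentGroupoid.tgt ⟨Φ.1, ξ⟩ →
    Θ (G.tangentGroupoid.mul ⟨Ψ.1, η⟩ ⟨Φ.1, ξ⟩).2 = Ψ.2 η + Φ.2 ξ

open Classical in
/-- The cotangent groupoid `T^*S ⇉ A^*S`. -/
noncomputable def cotangentGroupoid (G : LieGroupoid E F S P) :
    GroupoidData G.Cotangent G.DualAlgebroid where
  src Φ := ⟨G.src Φ.1, (Φ.2.comp (G.leftDeriv Φ.1)).comp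
    ((G.algebroidFiber (G.src Φ.1)).subtypeL - (G.oneDeriv (G.src Φ.1)).comp
      ((G.tgtDeriv (G.src Φ.1)).comp (G.algebroidFiber (G.src Φ.1)).subtypeL))⟩
  tgt Φ := ⟨G.tgt Φ.1, (Φ.2.comp (G.rightDeriv Φ.1)).comp
    (G.algebroidFiber (G.tgt Φ.1)).subtypeL⟩
  one φ := ⟨G.one φ.1, φ.2.comp (G.unitProj φ.1)⟩
  mul Ψ Φ := ⟨G.mul Ψ.1 Φ.1, if h : ∃ Θ, G.IsCotangentProduct Ψ Φ Θ then h.choose else 0⟩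

variable (G : LieGroupoid E F S P) (Ω : SymplecticForm 𝓘(ℝ, E) S)

/-- The form `(-Ω) ⊕ Ω ⊕ Ω` of the symplectic manifold `S̄ × S × S`. -/
noncomputable def graphForm (Ω : SymplecticForm 𝓘(ℝ, E) S) (p : S × S × S)
    (v w : TangentSpace (𝓘(ℝ, E).prod (𝓘(ℝ, E).prod 𝓘(ℝ, E))) p) : ℝ :=
  let v' : E × E × E := v
  let w' : E × E × E := w
  let form₁ : E →L[ℝ] E →L[ℝ] ℝ := Ω.form p.1
  let form₂ : E →L[ℝ] E →L[ℝ] ℝ := Ω.form p.2.1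
  let form₃ : E →L[ℝ] E →L[ℝ] ℝ := Ω.form p.2.2
  form₂ v'.2.1 w'.2.1 + form₃ v'.2.2 w'.2.2 - form₁ v'.1 w'.1

/-- `(G, Ω)` is a symplectic groupoid: the graph of multiplication is Lagrangian in
`S̄ × S × S`. -/
def IsSymplectic : Prop :=
  IsLagrangian (𝓘(ℝ, E).prod (𝓘(ℝ, E).prod 𝓘(ℝ, E))) (graphForm Ω) G.graph

/-- The map `Ω♭ : TS → T^*S`. -/
noncomputable def flatMap (v : TangentBundle 𝓘(ℝ, E) S) : G.Cotangent := ⟨v.1, Ω.flat v.1 v.2⟩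

/-- The map `w : TP → A^*S`, `w(x) = Ω♭(T(1)(x))` restricted to `A S`. -/
noncomputable def baseMap (x : TangentBundle 𝓘(ℝ, F) P) : G.DualAlgebroid :=
  ⟨x.1, (Ω.flat (G.one x.1) (G.oneDeriv x.1 x.2)).comp (G.algebroidFiber x.1).subtypeL⟩

/-- The map `r : A S → T^*P`, `⟨r(X), y⟩ = ⟨Ω♭(X), T(1)(y)⟩`. -/
noncomputable def algebroidMap (m : P) :
    G.algebroidFiber m →ₗ[ℝ] (TangentSpace 𝓘(ℝ, F) m →L[ℝ] ℝ) where
  toFun X := (Ω.flat (G.one m) X).comp (G.oneDeriv m)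
  map_add' X Y := by ext y; simp
  map_smul' c X := by ext y; simp

/-- Smoothness of a map `TP → A^*S` over the identity of `P`: the pairing with every smooth section
of `A S` is a smooth function on `TP`. -/
def IsSmoothToDual (f : TangentBundle 𝓘(ℝ, F) P → G.DualAlgebroid) : Prop :=
  ∀ X : (∀ m, G.algebroidFiber m), G.IsSmoothSection X →
    ContMDiff 𝓘(ℝ, F).tangent 𝓘(ℝ, ℝ) ∞ (fun x => (f x).2 (X (f x).1))

end LieGroupoid

/-!
Write `α`, `β` for the source and target maps, `ω` for the symplectic form, `ξ • η` for the product
in the tangent groupoid.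

Everything rests on one identity, `pair_mul`: the form is multiplicative,
`ω(η • ξ, η' • ξ') = ω(η, η') + ω(ξ, ξ')`. It says that the graph of multiplication is isotropic;
that the graph has half the dimension of its ambient manifold adds only `dim S = 2 dim P`
(`finrank_eq_two_mul`). Tangent vectors are handled throughout as velocities of curves
(`HasVelocity`): the laws of a groupoid hold along curves of arrows, hence for the tangent maps, and
submersions let a curve be completed to a curve of composable pairs.

*Units and inversion.* Since `1_x • 1_x = 1_x`, the form vanishes on the units, which have half the
dimension of `S`. Since `ξ⁻¹ • ξ` is a unit, `ω(ξ⁻¹, η⁻¹) = -ω(ξ, η)`. Inversion is smooth by the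
inverse function theorem (`contMDiffAt_inv`).

*Tangent and cotangent groupoids.* Multiplicativity is the statement that `ω♭` is compatible with
the products; the source and target maps of `T^*S` are matched by `form_leftDeriv` and
`form_rightDeriv`. As `ω♭` and its base map `w` are bijective, the laws of a groupoid pass from `TS`
to `T^*S` (`GroupoidData.IsGroupoid.transfer`).

*The Lie algebroid and the Poisson structure.* The source and target fibres are orthogonal
(`form_eq_zero_of_src_of_tgt`), so `ω♭` maps `A_m S` into the annihilator of the target fibre, which
is `T^*_m P`; comparing dimensions, `r : AS → T^*P` is an isomorphism. The right-invariant field of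
a section `X` is the field `V_φ = (β^* φ)^♯` of the 1-form `φ = r(X)`
(`rightInvariant_eq_pullbackField`). From `dω = 0`, the commutator of `V_φ` and `V_ψ` is again such
a field `V_θ`, where `θ` is the bracket of `φ` and `ψ` in the cotangent algebroid
(`exists_mlieBracket_pullbackField_eq`). So the brackets of both algebroids are the commutator of
vector fields on `S`, from which they inherit the identities of a Lie algebroid. For exact forms
this is the Jacobi identity of the bracket `{f, h} = ⟨dh, a(df)⟩` on `P`, with `a` the anchor
carried over along `r`; it is the only bracket for which the surjective map `β` is Poisson.
-/

/-! ### Velocities of curves -/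

section Velocity

variable {E H M : Type*} [NormedAddCommGroup E] [NormedSpace ℝ E] [TopologicalSpace H]
  {I : ModelWithCorners ℝ E H} [TopologicalSpace M] [ChartedSpace H M]
  {E' H' M' : Type*} [NormedAddCommGroup E'] [NormedSpace ℝ E'] [TopologicalSpace H']
  {I' : ModelWithCorners ℝ E' H'} [TopologicalSpace M'] [ChartedSpace H' M']

theorem Filter.EventuallyEq.tangentMap_eq {f g : M → M'} {v : TangentBundle I M}
    (h : f =ᶠ[𝓝 v.1] g) : tangentMap I I' f v = tangentMap I I' g v := by
  simp only [tangentMap, h.mfderiv_eq]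
  rw [h.self_of_nhds]

/-- The curve `c` is differentiable at time `0`, with velocity `v` there.  The base point of `v` is
part of the condition, so that velocities at points which are only propositionally equal can be
compared. -/
def HasVelocity (I : ModelWithCorners ℝ E H) (c : ℝ → M) (v : TangentBundle I M) : Prop :=
  MDifferentiableAt 𝓘(ℝ, ℝ) I c 0 ∧ tangentMap 𝓘(ℝ, ℝ) I c ⟨0, (1 : ℝ)⟩ = v

namespace HasVelocity

theorem unique {c : ℝ → M} {v w : TangentBundle I M} (hv : HasVelocity I c v)
    (hw : HasVelocity I c w) : v = w :=
  hv.2.symm.trans hw.2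

theorem base {c : ℝ → M} {v : TangentBundle I M} (hv : HasVelocity I c v) : c 0 = v.1 := by
  rw [← hv.2]; rfl

theorem congr {c d : ℝ → M} {v : TangentBundle I M} (hv : HasVelocity I c v)
    (h : ∀ᶠ t in 𝓝 0, d t = c t) : HasVelocity I d v := by
  have h' : d =ᶠ[𝓝 0] c := h
  refine ⟨hv.1.congr_of_eventuallyEq h', ?_⟩
  rw [← hv.2]
  exact h'.tangentMap_eq

theorem tendsto {c : ℝ → M} {v : TangentBundle I M} (hv : HasVelocity I c v) :
    Filter.Tendsto c (𝓝 0) (𝓝 v.1) := by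
  have := hv.1.continuousAt
  rwa [ContinuousAt, hv.base] at this

theorem comp_within {c : ℝ → M} {v : TangentBundle I M} (hv : HasVelocity I c v) {f : M → M'}
    {s : Set M} (hf : MDifferentiableWithinAt I I' f s v.1) (hs : ∀ᶠ t in 𝓝 0, c t ∈ s) :
    HasVelocity I' (fun t => f (c t)) (tangentMapWithin I I' f s v) := by
  obtain ⟨hc, rfl⟩ := hv
  have h1 : HasMFDerivWithinAt I I' f s (c 0) (mfderivWithin I I' f s (c 0)) :=
    hf.hasMFDerivWithinAt
  have h2 : HasMFDerivWithinAt 𝓘(ℝ, ℝ) I c (c ⁻¹' s) 0 (mfderiv 𝓘(ℝ, ℝ) I c 0) :=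
    hc.hasMFDerivAt.hasMFDerivWithinAt
  have h3 := (h1.comp (0 : ℝ) h2 (Set.Subset.refl _)).hasMFDerivAt hs
  refine ⟨h3.mdifferentiableAt, ?_⟩
  change (⟨f (c 0), mfderiv 𝓘(ℝ, ℝ) I' (f ∘ c) 0 (1 : ℝ)⟩ : TangentBundle I' M') = _
  rw [h3.mfderiv]
  rfl

theorem comp {c : ℝ → M} {v : TangentBundle I M} (hv : HasVelocity I c v) {f : M → M'}
    (hf : MDifferentiableAt I I' f v.1) :
    HasVelocity I' (fun t => f (c t)) (tangentMap I I' f v) := by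
  rw [← tangentMapWithin_univ]
  exact hv.comp_within hf.mdifferentiableWithinAt (by simp)

theorem prodMk {c : ℝ → M} {d : ℝ → M'} {v : TangentBundle I M} {w : TangentBundle I' M'}
    (hv : HasVelocity I c v) (hw : HasVelocity I' d w) :
    HasVelocity (I.prod I') (fun t => (c t, d t))
      ((equivTangentBundleProd I M I' M').symm (v, w)) := by
  obtain ⟨hc, rfl⟩ := hv
  obtain ⟨hd, rfl⟩ := hw
  refine ⟨hc.prodMk hd, ?_⟩
  change (⟨(c 0, d 0), mfderiv 𝓘(ℝ, ℝ) (I.prod I') (fun t => (c t, d t)) 0 (1 : ℝ)⟩ :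
    TangentBundle (I.prod I') (M × M')) = _
  rw [mfderiv_prodMk hc hd]
  rfl

theorem const (x : M) : HasVelocity I (fun _ : ℝ => x) ⟨x, 0⟩ := by
  refine ⟨mdifferentiableAt_const, ?_⟩
  change (⟨x, mfderiv 𝓘(ℝ, ℝ) I (fun _ => x) 0 (1 : ℝ)⟩ : TangentBundle I M) = _
  rw [mfderiv_const]
  rfl

theorem iff_hasDerivAt {c : ℝ → E} {v : TangentBundle 𝓘(ℝ, E) E} :
    HasVelocity 𝓘(ℝ, E) c v ↔ c 0 = v.1 ∧ HasDerivAt c v.2 0 := by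
  constructor
  · rintro ⟨hc, rfl⟩
    refine ⟨rfl, ?_⟩
    have h := hc.differentiableAt.hasDerivAt
    have : (tangentMap 𝓘(ℝ, ℝ) 𝓘(ℝ, E) c ⟨0, (1 : ℝ)⟩).2 = deriv c 0 := by
      change mfderiv 𝓘(ℝ, ℝ) 𝓘(ℝ, E) c 0 (1 : ℝ) = _
      rw [mfderiv_eq_fderiv]; rfl
    rw [this]; exact h
  · obtain ⟨x, v⟩ := v
    rintro ⟨rfl, h⟩
    refine ⟨h.differentiableAt.mdifferentiableAt, ?_⟩
    change (⟨c 0, mfderiv 𝓘(ℝ, ℝ) 𝓘(ℝ, E) c 0 (1 : ℝ)⟩ : TangentBundle 𝓘(ℝ, E) E) = _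
    rw [mfderiv_eq_fderiv]
    congr 1
    exact h.deriv

end HasVelocity

end Velocity

/-! ### Local splittings of submersions -/

section Splitting

variable {E M : Type*} [NormedAddCommGroup E] [NormedSpace ℝ E]
  [TopologicalSpace M] [ChartedSpace E M]
  {F P : Type*} [NormedAddCommGroup F] [NormedSpace ℝ F]
  [TopologicalSpace P] [ChartedSpace F P]
  {K : Type*} [NormedAddCommGroup K] [NormedSpace ℝ K]

/-- A local splitting of the map `f : M → P` at `x`: the map `pr` to the vector space `K` is such
that `(f, pr)` is a local diffeomorphism at `x`, with local inverse `sec`. -/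
structure IsLocalSplitting (f : M → P) (x : M) (pr : M → K) (sec : P × K → M) : Prop where
  eventually_contMDiffAt_pr : ∀ᶠ z in 𝓝 x, ContMDiffAt 𝓘(ℝ, E) 𝓘(ℝ, K) ∞ pr z
  eventually_contMDiffAt_sec : ∀ᶠ p in 𝓝 (f x, pr x),
    ContMDiffAt (𝓘(ℝ, F).prod 𝓘(ℝ, K)) 𝓘(ℝ, E) ∞ sec p
  contMDiffAt : ContMDiffAt 𝓘(ℝ, E) 𝓘(ℝ, F) ∞ f x
  sec_eq : ∀ᶠ z in 𝓝 x, sec (f z, pr z) = z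
  map_sec : ∀ᶠ p in 𝓝 (f x, pr x), f (sec p) = p.1 ∧ pr (sec p) = p.2

theorem IsLocalSplitting.contMDiffAt_pr {f : M → P} {x : M} {pr : M → K} {sec : P × K → M}
    (h : IsLocalSplitting (E := E) (F := F) f x pr sec) :
    ContMDiffAt 𝓘(ℝ, E) 𝓘(ℝ, K) ∞ pr x :=
  h.eventually_contMDiffAt_pr.self_of_nhds

theorem IsLocalSplitting.contMDiffAt_sec {f : M → P} {x : M} {pr : M → K} {sec : P × K → M}
    (h : IsLocalSplitting (E := E) (F := F) f x pr sec) :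
    ContMDiffAt (𝓘(ℝ, F).prod 𝓘(ℝ, K)) 𝓘(ℝ, E) ∞ sec (f x, pr x) :=
  h.eventually_contMDiffAt_sec.self_of_nhds

theorem Manifold.IsSubmersionAtOfComplement.exists_isLocalSplitting {f : M → P} {x : M}
    (h : IsSubmersionAtOfComplement K 𝓘(ℝ, E) 𝓘(ℝ, F) ∞ f x) :
    ∃ (pr : M → K) (sec : P × K → M), IsLocalSplitting (E := E) (F := F) f x pr sec := by
  let e := h.domChart
  let e' := h.codChart
  let L := h.equiv
  have hx : x ∈ e.source := h.mem_domChart_source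
  have hfx : f x ∈ e'.source := h.mem_codChart_source
  have hf : ∀ z ∈ e.source, e' (f z) = (L (e z)).1 := by
    intro z hz
    have := h.writtenInCharts ((h.domChart.extend 𝓘(ℝ, E)).map_source (x := z) (by simpa using hz))
    simpa [h.domChart.left_inv hz, e, e', L] using this
  have hcf : ContMDiffAt 𝓘(ℝ, E) 𝓘(ℝ, F) ∞ f x := h.contMDiffAt
  have hLs : ContMDiff 𝓘(ℝ, F × K) 𝓘(ℝ, E) ∞ L.symm := L.symm.contDiff.contMDiff
  have hL : ContMDiff 𝓘(ℝ, E) 𝓘(ℝ, K) ∞ (fun z => (L z).2) :=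
    (contDiff_snd.comp L.contDiff).contMDiff
  let a : P × K → E := fun p => L.symm (e' p.1, p.2)
  have hpt : a (f x, (L (e x)).2) = e x := by
    simp only [a]
    rw [hf x hx]; simp
  have hca : ∀ p : P × K, p.1 ∈ e'.source →
      ContMDiffAt (𝓘(ℝ, F).prod 𝓘(ℝ, K)) 𝓘(ℝ, E) ∞ a p := by
    intro p hp
    have h1 : ContMDiffAt (𝓘(ℝ, F).prod 𝓘(ℝ, K)) 𝓘(ℝ, F) ∞ (fun p : P × K => e' p.1) p :=
      ContMDiffAt.comp (g := e') _
        (contMDiffAt_of_mem_maximalAtlas h.codChart_mem_maximalAtlas hp) contMDiffAt_fst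
    exact hLs.contMDiffAt.comp _ (h1.prodMk_space contMDiffAt_snd)
  have h1 : ∀ᶠ p in 𝓝 (f x, (L (e x)).2), a p ∈ e.target := by
    refine (hca _ hfx).continuousAt.eventually ?_
    rw [hpt]
    exact e.open_target.mem_nhds (e.map_source hx)
  have h2 : ∀ᶠ p : P × K in 𝓝 (f x, (L (e x)).2), p.1 ∈ e'.source :=
    continuousAt_fst.eventually (e'.open_source.mem_nhds hfx)
  refine ⟨fun z => (L (e z)).2, fun p => e.symm (a p), ?_, ?_, hcf, ?_, ?_⟩
  · filter_upwards [e.open_source.mem_nhds hx] with z hz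
    exact hL.contMDiffAt.comp z
      (contMDiffAt_of_mem_maximalAtlas h.domChart_mem_maximalAtlas hz)
  · filter_upwards [h1, h2] with p hp1 hp2
    exact ContMDiffAt.comp (g := e.symm) _
      (contMDiffAt_symm_of_mem_maximalAtlas h.domChart_mem_maximalAtlas hp1) (hca p hp2)
  · filter_upwards [e.open_source.mem_nhds hx] with z hz
    have : a (f z, (L (e z)).2) = e z := by simp only [a]; rw [hf z hz]; simp
    rw [this, e.left_inv hz]
  · filter_upwards [h1, h2] with p hp1 hp2
    have h3 := hf _ (e.map_target hp1)
    rw [e.right_inv hp1] at h3 ⊢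
    simp only [a, ContinuousLinearEquiv.apply_symm_apply] at h3 ⊢
    refine ⟨e'.injOn ?_ hp2 h3, trivial⟩
    exact h.source_subset_preimage_source (e.map_target hp1)

theorem exists_hasVelocity [IsManifold 𝓘(ℝ, E) ∞ M] (v : TangentBundle 𝓘(ℝ, E) M) :
    ∃ c, HasVelocity 𝓘(ℝ, E) c v := by
  have h1 : IsManifold 𝓘(ℝ, E) 1 M := .of_le (n := ∞) (by simp)
  let e := chartAt E v.1
  have he : e ∈ IsManifold.maximalAtlas 𝓘(ℝ, E) 1 M := IsManifold.chart_mem_maximalAtlas v.1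
  have hx : v.1 ∈ e.source := mem_chart_source E v.1
  let w : E := (tangentMap 𝓘(ℝ, E) 𝓘(ℝ, E) e v).2
  have hy : HasVelocity 𝓘(ℝ, E) (fun t : ℝ => e v.1 + t • w)
      (tangentMap 𝓘(ℝ, E) 𝓘(ℝ, E) e v) := by
    rw [HasVelocity.iff_hasDerivAt]
    refine ⟨by simp, ?_⟩
    have := ((hasDerivAt_id (0 : ℝ)).smul_const w).const_add (e v.1)
    rw [one_smul] at this
    exact this
  have hes := mdifferentiableAt_symm_of_mem_maximalAtlas he (e.map_source hx)
  have h := hy.comp (f := e.symm) hes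
  have h3 : tangentMap 𝓘(ℝ, E) 𝓘(ℝ, E) e.symm (tangentMap 𝓘(ℝ, E) 𝓘(ℝ, E) e v) = v := by
    have h1 := tangentMap_comp_at v (g := e.symm) (f := e) hes
      (mdifferentiableAt_of_mem_maximalAtlas he hx)
    rw [← h1]
    have h2 : (e.symm ∘ e) =ᶠ[𝓝 v.1] id := e.eventually_left_inverse hx
    rw [h2.tangentMap_eq, tangentMap_id]
    rfl
  rw [h3] at h
  exact ⟨_, h⟩

/-- Curves lift through submersions, with any prescribed velocity that lies over the velocity of the
given curve. -/
theorem IsLocalSplitting.exists_lift [IsManifold 𝓘(ℝ, E) ∞ M] {f : M → P}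
    {v : TangentBundle 𝓘(ℝ, E) M} {pr : M → K} {sec : P × K → M}
    (h : IsLocalSplitting (E := E) (F := F) f v.1 pr sec) {c : ℝ → P}
    (hc : HasVelocity 𝓘(ℝ, F) c (tangentMap 𝓘(ℝ, E) 𝓘(ℝ, F) f v)) :
    ∃ d, HasVelocity 𝓘(ℝ, E) d v ∧ ∀ᶠ t in 𝓝 0, f (d t) = c t := by
  obtain ⟨b, hb⟩ := exists_hasVelocity v
  have hprb := hb.comp (h.contMDiffAt_pr.mdifferentiableAt (by simp))
  have hfb := hb.comp (h.contMDiffAt.mdifferentiableAt (by simp))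
  have h1 := (hc.prodMk hprb).comp (f := sec) (h.contMDiffAt_sec.mdifferentiableAt (by simp))
  have h2 := (hfb.prodMk hprb).comp (f := sec) (h.contMDiffAt_sec.mdifferentiableAt (by simp))
  have h3 : v = _ := hb.unique
    (h2.congr ((hb.tendsto.eventually h.sec_eq).mono fun t ht => ht.symm))
  refine ⟨fun t => sec (c t, pr (b t)), ?_, ?_⟩
  · rw [h3]; exact h1
  · exact ((hc.tendsto.prodMk_nhds hprb.tendsto).eventually h.map_sec).mono fun t ht => ht.1

theorem IsLocalSplitting.exists_tangentMap_eq [IsManifold 𝓘(ℝ, F) ∞ P] {f : M → P} {x : M}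
    {pr : M → K} {sec : P × K → M} (h : IsLocalSplitting (E := E) (F := F) f x pr sec)
    (y : TangentBundle 𝓘(ℝ, F) P) (hy : y.1 = f x) :
    ∃ v : TangentBundle 𝓘(ℝ, E) M, v.1 = x ∧ tangentMap 𝓘(ℝ, E) 𝓘(ℝ, F) f v = y := by
  obtain ⟨c, hc⟩ := exists_hasVelocity y
  have hk := HasVelocity.const (I := 𝓘(ℝ, K)) (pr x)
  have hck := hc.prodMk hk
  have hx : sec (f x, pr x) = x := h.sec_eq.self_of_nhds
  have hd := hck.comp (f := sec) (I' := 𝓘(ℝ, E)) (by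
    change MDifferentiableAt _ _ sec (y.1, pr x)
    rw [hy]
    exact h.contMDiffAt_sec.mdifferentiableAt (by simp))
  set v := tangentMap (𝓘(ℝ, F).prod 𝓘(ℝ, K)) 𝓘(ℝ, E) sec _
  have hvx : v.1 = x := by
    rw [← hd.base, hc.base, hy, hx]
  refine ⟨v, hvx, ?_⟩
  have hf := hd.comp (f := f) (I' := 𝓘(ℝ, F)) (by
    rw [hvx]; exact h.contMDiffAt.mdifferentiableAt (by simp))
  refine hf.unique (hc.congr ?_)
  have ht := hck.tendsto
  have : ∀ᶠ p in 𝓝 (y.1, pr x), f (sec p) = p.1 ∧ pr (sec p) = p.2 := by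
    rw [hy]; exact h.map_sec
  exact (ht.eventually this).mono fun t ht => ht.1

end Splitting

namespace LieGroupoid

variable {E F S P : Type*} [NormedAddCommGroup E] [NormedSpace ℝ E]
  [NormedAddCommGroup F] [NormedSpace ℝ F] [TopologicalSpace S] [ChartedSpace E S]
  [TopologicalSpace P] [ChartedSpace F P] (G : LieGroupoid E F S P)

/-! ### Inverses in the groupoid -/

theorem src_inv (g : S) : G.src (G.inv g) = G.tgt g := (G.isGroupoid.exists_inv g).choose_spec.1
theorem tgt_inv (g : S) : G.tgt (G.inv g) = G.src g := (G.isGroupoid.exists_inv g).choose_spec.2.1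
theorem inv_mul (g : S) : G.mul (G.inv g) g = G.one (G.src g) :=
  (G.isGroupoid.exists_inv g).choose_spec.2.2.1
theorem mul_inv (g : S) : G.mul g (G.inv g) = G.one (G.tgt g) :=
  (G.isGroupoid.exists_inv g).choose_spec.2.2.2

theorem mul_mul_inv {h g : S} (hg : G.src h = G.tgt g) : G.mul (G.mul h g) (G.inv g) = h := by
  rw [← G.isGroupoid.assoc h g _ hg (G.tgt_inv g).symm, mul_inv, ← hg, G.isGroupoid.mul_one]

theorem eq_inv_of_mul_eq_one {h g : S} (hg : G.src h = G.tgt g)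
    (h1 : G.mul h g = G.one (G.src g)) : h = G.inv g := by
  rw [← G.mul_mul_inv hg, h1, ← G.tgt_inv g, G.isGroupoid.one_mul]

theorem inv_inv (g : S) : G.inv (G.inv g) = g :=
  (G.eq_inv_of_mul_eq_one (G.tgt_inv g).symm (by rw [mul_inv, src_inv])).symm

/-! ### Velocities of curves of arrows -/

theorem contMDiff_src : ContMDiff 𝓘(ℝ, E) 𝓘(ℝ, F) ∞ G.src := G.src_submersion.contMDiff
theorem contMDiff_tgt : ContMDiff 𝓘(ℝ, E) 𝓘(ℝ, F) ∞ G.tgt := G.tgt_submersion.contMDiff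
theorem contMDiff_one : ContMDiff 𝓘(ℝ, F) 𝓘(ℝ, E) ∞ G.one := G.one_immersion.contMDiff

theorem mdifferentiableAt_src (g : S) : MDifferentiableAt 𝓘(ℝ, E) 𝓘(ℝ, F) G.src g :=
  G.contMDiff_src.contMDiffAt.mdifferentiableAt (by simp)
theorem mdifferentiableAt_tgt (g : S) : MDifferentiableAt 𝓘(ℝ, E) 𝓘(ℝ, F) G.tgt g :=
  G.contMDiff_tgt.contMDiffAt.mdifferentiableAt (by simp)
theorem mdifferentiableAt_one (m : P) : MDifferentiableAt 𝓘(ℝ, F) 𝓘(ℝ, E) G.one m :=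
  G.contMDiff_one.contMDiffAt.mdifferentiableAt (by simp)

section

variable {G} {c d : ℝ → S} {η ξ : TangentBundle 𝓘(ℝ, E) S}

theorem hasVelocity_src (hc : HasVelocity 𝓘(ℝ, E) c η) :
    HasVelocity 𝓘(ℝ, F) (fun t => G.src (c t)) (G.tangentGroupoid.src η) :=
  hc.comp (G.mdifferentiableAt_src _)

theorem hasVelocity_tgt (hc : HasVelocity 𝓘(ℝ, E) c η) :
    HasVelocity 𝓘(ℝ, F) (fun t => G.tgt (c t)) (G.tangentGroupoid.tgt η) :=
  hc.comp (G.mdifferentiableAt_tgt _)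

theorem hasVelocity_one {c : ℝ → P} {x : TangentBundle 𝓘(ℝ, F) P}
    (hc : HasVelocity 𝓘(ℝ, F) c x) :
    HasVelocity 𝓘(ℝ, E) (fun t => G.one (c t)) (G.tangentGroupoid.one x) :=
  hc.comp (G.mdifferentiableAt_one _)

theorem hasVelocity_mul (hc : HasVelocity 𝓘(ℝ, E) c η) (hd : HasVelocity 𝓘(ℝ, E) d ξ)
    (h : ∀ᶠ t in 𝓝 0, G.src (c t) = G.tgt (d t)) :
    HasVelocity 𝓘(ℝ, E) (fun t => G.mul (c t) (d t)) (G.tangentGroupoid.mul η ξ) := by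
  have h0 : (η.1, ξ.1) ∈ G.composable := by
    have := h.self_of_nhds
    rwa [hc.base, hd.base] at this
  exact (hc.prodMk hd).comp_within
    (f := fun p : S × S => G.mul p.1 p.2) (s := G.composable) (I' := 𝓘(ℝ, E))
    ((G.mul_smooth _ h0).mdifferentiableWithinAt (by simp)) h

/-- A curve of arrows extends to a curve of composable pairs, with any prescribed velocity of the
left factor that is composable with the velocity of the given curve. -/
theorem exists_left_curve [IsManifold 𝓘(ℝ, E) ∞ S] (hd : HasVelocity 𝓘(ℝ, E) d ξ)
    (h : G.tangentGroupoid.src η = G.tangentGroupoid.tgt ξ) :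
    ∃ c, HasVelocity 𝓘(ℝ, E) c η ∧ ∀ᶠ t in 𝓝 0, G.src (c t) = G.tgt (d t) := by
  obtain ⟨K, _, _, hK⟩ := G.src_submersion
  obtain ⟨pr, sec, hs⟩ := (hK η.1).exists_isLocalSplitting
  refine hs.exists_lift (c := fun t => G.tgt (d t)) ?_
  change HasVelocity _ _ (G.tangentGroupoid.src η)
  rw [h]
  exact hasVelocity_tgt hd

end

/-! ### Smoothness of inversion -/

/-- Pairs `(h, g)` of composable arrows have the coordinates `(v, y)`, where `y` is the position of
`g` in a chart and `v` that of `h` in its source fibre. By the inverse function theorem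
`(v', y)` are coordinates as well, with `v'` the position of `h g` in its source fibre: right
translation by `g` is injective on tangent vectors. The inverse of `g` is the `h` for which `h g` is a unit. -/
theorem contMDiffAt_inv [FiniteDimensional ℝ E] [IsManifold 𝓘(ℝ, E) ∞ S] (g₀ : S) :
    ContMDiffAt 𝓘(ℝ, E) 𝓘(ℝ, E) ∞ G.inv g₀ := by
  obtain ⟨K, _, _, hK⟩ := G.src_submersion
  have hfd : FiniteDimensional ℝ K := by
    have e := (hK g₀).equiv
    have : FiniteDimensional ℝ (F × K) := e.toLinearEquiv.finiteDimensional
    exact FiniteDimensional.of_surjective (LinearMap.snd ℝ F K) LinearMap.snd_surjective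
  have : CompleteSpace (K × E) := FiniteDimensional.complete ℝ (K × E)
  set h₀ := G.inv g₀
  set u₀ := G.one (G.src g₀) with hu₀
  have hsu : G.src u₀ = G.src g₀ := G.isGroupoid.src_one _
  have hsh : G.src h₀ = G.tgt g₀ := G.src_inv g₀
  obtain ⟨pr, sec, hs⟩ := (hK h₀).exists_isLocalSplitting
  obtain ⟨pr', sec', hs'⟩ := (hK u₀).exists_isLocalSplitting
  let χ := chartAt E g₀
  have hχ : g₀ ∈ χ.source := mem_chart_source E g₀
  have hχa : χ ∈ IsManifold.maximalAtlas 𝓘(ℝ, E) ∞ S := IsManifold.chart_mem_maximalAtlas g₀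
  have hχs : ContMDiffAt 𝓘(ℝ, E) 𝓘(ℝ, E) ∞ χ.symm (χ g₀) :=
    contMDiffAt_symm_of_mem_maximalAtlas hχa (χ.map_source hχ)
  have hχ0 : χ.symm (χ g₀) = g₀ := χ.left_inv hχ
  let x₀ : K × E := (pr h₀, χ g₀)
  -- `σ (v, y)` is the arrow that can be multiplied with `χ⁻¹ y` and has the coordinate `v` along
  -- the source fibre.
  let γ : K × E → S := fun x => χ.symm x.2
  let σ : K × E → S := fun x => sec (G.tgt (γ x), x.1)
  let m : K × E → S := fun x => G.mul (σ x) (γ x)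
  let Ψ : K × E → K × E := fun x => (pr' (m x), x.2)
  have hγ : ContMDiffAt 𝓘(ℝ, K × E) 𝓘(ℝ, E) ∞ γ x₀ :=
    ContMDiffAt.comp (g := χ.symm) (f := fun x : K × E => x.2) x₀ hχs
      contDiff_snd.contMDiff.contMDiffAt
  have hγ0 : γ x₀ = g₀ := hχ0
  have htγ : ContMDiffAt 𝓘(ℝ, K × E) 𝓘(ℝ, F) ∞ (fun x => G.tgt (γ x)) x₀ :=
    G.contMDiff_tgt.contMDiffAt.comp x₀ hγ
  have hpair : ContMDiffAt 𝓘(ℝ, K × E) (𝓘(ℝ, F).prod 𝓘(ℝ, K)) ∞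
      (fun x : K × E => (G.tgt (γ x), x.1)) x₀ :=
    htγ.prodMk contDiff_fst.contMDiff.contMDiffAt
  have hpair0 : (G.tgt (γ x₀), x₀.1) = (G.src h₀, pr h₀) := by rw [hγ0, hsh]
  have hσ : ContMDiffAt 𝓘(ℝ, K × E) 𝓘(ℝ, E) ∞ σ x₀ := by
    refine ContMDiffAt.comp (g := sec) x₀ ?_ hpair
    rw [hpair0]; exact hs.contMDiffAt_sec
  have hσ0 : σ x₀ = h₀ := by
    change sec (G.tgt (γ x₀), x₀.1) = h₀
    rw [hpair0]; exact hs.sec_eq.self_of_nhds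
  have hσs : ∀ᶠ x in 𝓝 x₀, G.src (σ x) = G.tgt (γ x) ∧ pr (σ x) = x.1 := by
    have h1 : Filter.Tendsto (fun x : K × E => (G.tgt (γ x), x.1)) (𝓝 x₀)
        (𝓝 (G.src h₀, pr h₀)) := by
      rw [← hpair0]; exact hpair.continuousAt
    exact h1.eventually hs.map_sec
  have hm0 : m x₀ = u₀ := by
    change G.mul (σ x₀) (γ x₀) = u₀
    rw [hσ0, hγ0]; exact G.inv_mul g₀
  have hm : ContMDiffAt 𝓘(ℝ, K × E) 𝓘(ℝ, E) ∞ m x₀ := by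
    have h1 : ContMDiffWithinAt (𝓘(ℝ, E).prod 𝓘(ℝ, E)) 𝓘(ℝ, E) ∞
        (fun p : S × S => G.mul p.1 p.2) G.composable (σ x₀, γ x₀) :=
      G.mul_smooth _ hσs.self_of_nhds.1
    have h2 : ContMDiffWithinAt 𝓘(ℝ, K × E) (𝓘(ℝ, E).prod 𝓘(ℝ, E)) ∞
        (fun x => (σ x, γ x)) ((fun x => (σ x, γ x)) ⁻¹' G.composable) x₀ :=
      (hσ.prodMk hγ).contMDiffWithinAt
    exact (h1.comp x₀ h2 (Set.Subset.refl _)).contMDiffAt (hσs.mono fun x hx => hx.1)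
  have hpm : ContMDiffAt 𝓘(ℝ, K × E) 𝓘(ℝ, K) ∞ (fun x => pr' (m x)) x₀ := by
    refine ContMDiffAt.comp (g := pr') x₀ ?_ hm
    rw [hm0]; exact hs'.contMDiffAt_pr
  have hΨ : ContDiffAt ℝ ∞ Ψ x₀ :=
    (hpm.prodMk_space contDiff_snd.contMDiff.contMDiffAt).contDiffAt
  have hms : ∀ᶠ x in 𝓝 x₀, G.src (m x) = G.src (γ x) :=
    hσs.mono fun x hx => G.isGroupoid.src_mul _ _ hx.1
  have hmsec : ∀ᶠ x in 𝓝 x₀, sec' (G.src (m x), pr' (m x)) = m x := by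
    have h1 := hm.continuousAt.tendsto
    rw [hm0] at h1
    exact h1.eventually hs'.sec_eq
  -- A direction killed by the derivative of `Ψ` gives a curve `σ` in the source fibre of `g₀⁻¹` for
  -- which `σ g₀` has velocity zero. Right translation by `g₀⁻¹` shows that `σ` has velocity zero.
  have hinj : Function.Injective (fderiv ℝ Ψ x₀) := by
    rw [injective_iff_map_eq_zero]
    rintro ⟨a, b⟩ hab
    have hd := (hΨ.differentiableAt (by simp)).hasFDerivAt
    have hb : b = 0 := by
      have h1 := (hd.snd (f₂ := Ψ)).unique hasFDerivAt_snd
      have h2 := DFunLike.congr_fun h1 (a, b)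
      simpa [hab] using h2.symm
    subst hb
    let l : ℝ → K × E := fun t => (pr h₀ + t • a, χ g₀)
    have hl : HasVelocity 𝓘(ℝ, K × E) l ⟨x₀, (a, 0)⟩ := by
      rw [HasVelocity.iff_hasDerivAt]
      refine ⟨by simp [l, x₀], ?_⟩
      have h1 := ((hasDerivAt_id (0 : ℝ)).smul_const a).const_add (pr h₀)
      rw [one_smul] at h1
      exact h1.prodMk (hasDerivAt_const (0 : ℝ) (χ g₀))
    have hlt := hl.tendsto
    have hγl : ∀ t, γ (l t) = g₀ := fun t => hχ0
    have hΨl := hl.comp (f := Ψ) (I' := 𝓘(ℝ, K × E))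
      (hΨ.differentiableAt (by simp)).mdifferentiableAt
    have hμl : HasVelocity 𝓘(ℝ, K) (fun t => pr' (m (l t))) ⟨pr' u₀, 0⟩ := by
      have h1 := HasVelocity.iff_hasDerivAt.1 hΨl
      rw [HasVelocity.iff_hasDerivAt]
      refine ⟨by
        have h2 := hl.base
        change pr' (m (l 0)) = pr' u₀
        rw [h2, ← hm0], ?_⟩
      have h2 := h1.2
      have h3 : (tangentMap 𝓘(ℝ, K × E) 𝓘(ℝ, K × E) Ψ ⟨x₀, (a, 0)⟩).2 = (0 : K × E) := by
        change mfderiv 𝓘(ℝ, K × E) 𝓘(ℝ, K × E) Ψ x₀ (a, 0) = _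
        rw [mfderiv_eq_fderiv]; exact hab
      rw [h3] at h2
      exact h2.fst
    have hml : HasVelocity 𝓘(ℝ, E) (fun t => m (l t)) ⟨u₀, 0⟩ := by
      have h1 := ((HasVelocity.const (I := 𝓘(ℝ, F)) (G.src g₀)).prodMk hμl)
      have hp : ((G.src g₀, pr' u₀) : P × K) = (G.src u₀, pr' u₀) := by rw [hsu]
      have h2 : MDifferentiableAt (𝓘(ℝ, F).prod 𝓘(ℝ, K)) 𝓘(ℝ, E) sec' (G.src g₀, pr' u₀) := by
        rw [hp]; exact hs'.contMDiffAt_sec.mdifferentiableAt (by simp)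
      have h3 := h1.comp (f := sec') (I' := 𝓘(ℝ, E)) h2
      have h4 : ∀ᶠ t in 𝓝 (0 : ℝ), m (l t) = sec' (G.src g₀, pr' (m (l t))) := by
        filter_upwards [hlt.eventually hms, hlt.eventually hmsec] with t ht1 ht2
        rw [hγl] at ht1
        rw [← ht1, ht2]
      have h5 := h3.congr h4
      have h6 : sec' (G.src g₀, pr' u₀) = u₀ := by
        rw [hp]; exact hs'.sec_eq.self_of_nhds
      have h7 : (⟨u₀, 0⟩ : TangentBundle 𝓘(ℝ, E) S) = ⟨sec' (G.src g₀, pr' u₀),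
          mfderiv (𝓘(ℝ, F).prod 𝓘(ℝ, K)) 𝓘(ℝ, E) sec' (G.src g₀, pr' u₀) 0⟩ := by
        rw [map_zero, h6]
      rw [h7]
      exact h5
    have hcl : HasVelocity 𝓘(ℝ, E) (fun t => σ (l t)) ⟨h₀, 0⟩ := by
      have h1 : ∀ᶠ t in 𝓝 (0 : ℝ), G.src (m (l t)) = G.tgt (G.inv g₀) := by
        filter_upwards [hlt.eventually hms] with t ht
        rw [ht, hγl, G.tgt_inv]
      have h2 := hasVelocity_mul hml (HasVelocity.const (G.inv g₀)) h1
      have h3 := hasVelocity_mul (HasVelocity.const u₀) (HasVelocity.const (G.inv g₀))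
        (G := G) (by simp [hsu, G.tgt_inv])
      have h4 : G.mul u₀ (G.inv g₀) = h₀ := by
        rw [hu₀, ← G.tgt_inv g₀, G.isGroupoid.one_mul]
      rw [h4] at h3
      rw [(HasVelocity.const h₀).unique h3]
      refine h2.congr ?_
      filter_upwards [hlt.eventually hσs] with t ht
      change _ = G.mul (G.mul (σ (l t)) (γ (l t))) (G.inv g₀)
      rw [hγl]
      rw [hγl] at ht
      rw [G.mul_mul_inv ht.1]
    have hprl := hcl.comp (f := pr) (hs.contMDiffAt_pr.mdifferentiableAt (by simp))
    have h1 : HasVelocity 𝓘(ℝ, K) (fun t => pr (σ (l t))) ⟨pr h₀, a⟩ := by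
      have h1 : HasVelocity 𝓘(ℝ, K) (fun t : ℝ => pr h₀ + t • a) ⟨pr h₀, a⟩ := by
        rw [HasVelocity.iff_hasDerivAt]
        refine ⟨by simp, ?_⟩
        have h1 := ((hasDerivAt_id (0 : ℝ)).smul_const a).const_add (pr h₀)
        rwa [one_smul] at h1
      exact h1.congr ((hlt.eventually hσs).mono fun t ht => ht.2)
    have h2 := (HasVelocity.iff_hasDerivAt.1 h1).2.unique (HasVelocity.iff_hasDerivAt.1 hprl).2
    have h3 : a = 0 := by
      change a = mfderiv 𝓘(ℝ, E) 𝓘(ℝ, K) pr h₀ 0 at h2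
      rwa [map_zero] at h2
    rw [h3]; rfl
  let L : (K × E) ≃L[ℝ] (K × E) :=
    (LinearEquiv.ofInjectiveEndo (fderiv ℝ Ψ x₀).toLinearMap hinj).toContinuousLinearEquiv
  have hL : HasFDerivAt Ψ (L : (K × E) →L[ℝ] (K × E)) x₀ :=
    (hΨ.differentiableAt (by simp)).hasFDerivAt
  have hn : (∞ : WithTop ℕ∞) ≠ 0 := by simp
  let Φ := hΨ.localInverse hL hn
  have hΦ : ContDiffAt ℝ ∞ Φ (Ψ x₀) := hΨ.to_localInverse hL hn
  have hΨ0 : Ψ x₀ = (pr' u₀, χ g₀) := by simp only [Ψ, hm0, x₀]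
  have hst : HasStrictFDerivAt Ψ (L : (K × E) →L[ℝ] (K × E)) x₀ := hΨ.hasStrictFDerivAt' hL hn
  have hΦ0 : Φ (Ψ x₀) = x₀ := hst.localInverse_apply_image
  have hright : ∀ᶠ y in 𝓝 (Ψ x₀), Ψ (Φ y) = y := hst.eventually_right_inverse
  let τ : S → K × E := fun g => (pr' (G.one (G.src g)), χ g)
  have hτ : ContMDiffAt 𝓘(ℝ, E) 𝓘(ℝ, K × E) ∞ τ g₀ := by
    have h1 : ContMDiffAt 𝓘(ℝ, E) 𝓘(ℝ, E) ∞ (fun g => G.one (G.src g)) g₀ :=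
      (G.contMDiff_one.comp G.contMDiff_src).contMDiffAt
    exact (ContMDiffAt.comp (g := pr') g₀ hs'.contMDiffAt_pr h1).prodMk_space
      (contMDiffAt_of_mem_maximalAtlas hχa hχ)
  have hτ0 : τ g₀ = Ψ x₀ := hΨ0.symm
  let s : S → K × E := fun g => Φ (τ g)
  have hs₁ : ContMDiffAt 𝓘(ℝ, E) 𝓘(ℝ, K × E) ∞ s g₀ := by
    refine ContMDiffAt.comp (g := Φ) g₀ ?_ hτ
    rw [hτ0]; exact hΦ.contMDiffAt
  have hs0 : s g₀ = x₀ := by simp only [s, hτ0, hΦ0]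
  have hi : ContMDiffAt 𝓘(ℝ, E) 𝓘(ℝ, E) ∞ (fun g => σ (s g)) g₀ := by
    refine ContMDiffAt.comp (g := σ) g₀ ?_ hs₁
    rw [hs0]; exact hσ
  refine hi.congr_of_eventuallyEq ?_
  have hst := hs₁.continuousAt.tendsto
  rw [hs0] at hst
  have hτt := hτ.continuousAt.tendsto
  rw [hτ0] at hτt
  have hone : ∀ᶠ g in 𝓝 g₀, sec' (G.src (G.one (G.src g)), pr' (G.one (G.src g)))
      = G.one (G.src g) :=
    (G.contMDiff_one.comp G.contMDiff_src).continuous.continuousAt.eventually hs'.sec_eq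
  filter_upwards [hτt.eventually hright, hst.eventually hσs, hst.eventually hms,
    hst.eventually hmsec, hone, χ.open_source.mem_nhds hχ] with g h1 h2 h3 h4 h5 h6
  have h7 : (s g).2 = χ g := congrArg Prod.snd h1
  have h8 : pr' (m (s g)) = pr' (G.one (G.src g)) := congrArg Prod.fst h1
  have h9 : γ (s g) = g := by
    change χ.symm (s g).2 = g
    rw [h7, χ.left_inv h6]
  rw [h9] at h2 h3
  refine (G.eq_inv_of_mul_eq_one h2.1 ?_).symm
  have h10 : m (s g) = G.mul (σ (s g)) g := by
    change G.mul (σ (s g)) (γ (s g)) = _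
    rw [h9]
  rw [G.isGroupoid.src_one] at h5
  rw [← h10, ← h4, h3, h8, h5]

theorem contMDiff_inv [FiniteDimensional ℝ E] [IsManifold 𝓘(ℝ, E) ∞ S] :
    ContMDiff 𝓘(ℝ, E) 𝓘(ℝ, E) ∞ G.inv :=
  fun g => G.contMDiffAt_inv g

end LieGroupoid

namespace LieGroupoid

variable {E F S P : Type*} [NormedAddCommGroup E] [NormedSpace ℝ E]
  [NormedAddCommGroup F] [NormedSpace ℝ F] [TopologicalSpace S] [ChartedSpace E S]
  [TopologicalSpace P] [ChartedSpace F P] (G : LieGroupoid E F S P)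

/-! ### The tangent groupoid -/

variable {G} in
theorem exists_composable_curves [IsManifold 𝓘(ℝ, E) ∞ S] {η ξ : TangentBundle 𝓘(ℝ, E) S}
    (h : G.tangentGroupoid.src η = G.tangentGroupoid.tgt ξ) :
    ∃ c d, HasVelocity 𝓘(ℝ, E) c η ∧ HasVelocity 𝓘(ℝ, E) d ξ ∧
      (∀ᶠ t in 𝓝 0, G.src (c t) = G.tgt (d t)) ∧
      HasVelocity 𝓘(ℝ, E) (fun t => G.mul (c t) (d t)) (G.tangentGroupoid.mul η ξ) := by
  obtain ⟨d, hd⟩ := exists_hasVelocity ξ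
  obtain ⟨c, hc, h'⟩ := exists_left_curve hd h
  exact ⟨c, d, hc, hd, h', hasVelocity_mul hc hd h'⟩

/-- In the tangent groupoid, inversion is the tangent map of inversion. -/
theorem inv_laws_tangent [FiniteDimensional ℝ E] [IsManifold 𝓘(ℝ, E) ∞ S]
    (ξ : TangentBundle 𝓘(ℝ, E) S) :
    G.tangentGroupoid.src (tangentMap 𝓘(ℝ, E) 𝓘(ℝ, E) G.inv ξ) = G.tangentGroupoid.tgt ξ ∧
    G.tangentGroupoid.tgt (tangentMap 𝓘(ℝ, E) 𝓘(ℝ, E) G.inv ξ) = G.tangentGroupoid.src ξ ∧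
    G.tangentGroupoid.mul (tangentMap 𝓘(ℝ, E) 𝓘(ℝ, E) G.inv ξ) ξ
      = G.tangentGroupoid.one (G.tangentGroupoid.src ξ) ∧
    G.tangentGroupoid.mul ξ (tangentMap 𝓘(ℝ, E) 𝓘(ℝ, E) G.inv ξ)
      = G.tangentGroupoid.one (G.tangentGroupoid.tgt ξ) := by
  obtain ⟨d, hd⟩ := exists_hasVelocity ξ
  have hi := hd.comp (f := G.inv) (I' := 𝓘(ℝ, E))
    (G.contMDiff_inv.contMDiffAt.mdifferentiableAt (by simp))
  refine ⟨?_, ?_, ?_, ?_⟩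
  · exact (hasVelocity_src hi).unique ((hasVelocity_tgt hd).congr (by simp [src_inv]))
  · exact (hasVelocity_tgt hi).unique ((hasVelocity_src hd).congr (by simp [tgt_inv]))
  · exact (hasVelocity_mul hi hd (by simp [src_inv])).unique
      ((hasVelocity_one (hasVelocity_src hd)).congr (by simp [inv_mul]))
  · exact (hasVelocity_mul hd hi (by simp [tgt_inv])).unique
      ((hasVelocity_one (hasVelocity_tgt hd)).congr (by simp [mul_inv]))

/-- Each law holds along curves of arrows, hence for their velocities. -/
theorem tangentGroupoid_isGroupoid [FiniteDimensional ℝ E] [IsManifold 𝓘(ℝ, E) ∞ S]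
    [IsManifold 𝓘(ℝ, F) ∞ P] : G.tangentGroupoid.IsGroupoid where
  src_one x := by
    obtain ⟨c, hc⟩ := exists_hasVelocity x
    exact (hasVelocity_src (hasVelocity_one hc)).unique
      (hc.congr (by simp [G.isGroupoid.src_one]))
  tgt_one x := by
    obtain ⟨c, hc⟩ := exists_hasVelocity x
    exact (hasVelocity_tgt (hasVelocity_one hc)).unique
      (hc.congr (by simp [G.isGroupoid.tgt_one]))
  src_mul η ξ h := by
    obtain ⟨c, d, hc, hd, h', hm⟩ := exists_composable_curves h
    exact (hasVelocity_src hm).unique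
      ((hasVelocity_src hd).congr (h'.mono fun t ht => G.isGroupoid.src_mul _ _ ht))
  tgt_mul η ξ h := by
    obtain ⟨c, d, hc, hd, h', hm⟩ := exists_composable_curves h
    exact (hasVelocity_tgt hm).unique
      ((hasVelocity_tgt hc).congr (h'.mono fun t ht => G.isGroupoid.tgt_mul _ _ ht))
  assoc η ξ ζ h₁ h₂ := by
    obtain ⟨d, f, hd, hf, h₂', hdf⟩ := exists_composable_curves h₂
    obtain ⟨c, hc, h₁'⟩ := exists_left_curve hd h₁
    have h := h₁'.and h₂'
    refine (hasVelocity_mul hc hdf (h.mono fun t ht => ?_)).unique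
      ((hasVelocity_mul (hasVelocity_mul hc hd h₁') hf (h.mono fun t ht => ?_)).congr
        (h.mono fun t ht => G.isGroupoid.assoc _ _ _ ht.1 ht.2))
    · rw [ht.1, G.isGroupoid.tgt_mul _ _ ht.2]
    · rw [← ht.2, G.isGroupoid.src_mul _ _ ht.1]
  one_mul ξ := by
    obtain ⟨d, hd⟩ := exists_hasVelocity ξ
    exact (hasVelocity_mul (hasVelocity_one (hasVelocity_tgt hd)) hd
      (by simp [G.isGroupoid.src_one])).unique (hd.congr (by simp [G.isGroupoid.one_mul]))
  mul_one ξ := by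
    obtain ⟨d, hd⟩ := exists_hasVelocity ξ
    exact (hasVelocity_mul hd (hasVelocity_one (hasVelocity_src hd))
      (by simp [G.isGroupoid.tgt_one])).unique (hd.congr (by simp [G.isGroupoid.mul_one]))
  exists_inv ξ := ⟨_, G.inv_laws_tangent ξ⟩

/-! ### Tangent maps of translations -/

section

variable {G}

theorem tangentGroupoid_src_zero (g : S) : G.tangentGroupoid.src ⟨g, 0⟩ = ⟨G.src g, 0⟩ :=
  (hasVelocity_src (.const g)).unique (.const _)

theorem tangentGroupoid_tgt_zero (g : S) : G.tangentGroupoid.tgt ⟨g, 0⟩ = ⟨G.tgt g, 0⟩ :=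
  (hasVelocity_tgt (.const g)).unique (.const _)

theorem tangentGroupoid_one_zero (m : P) : G.tangentGroupoid.one ⟨m, 0⟩ = ⟨G.one m, 0⟩ :=
  (hasVelocity_one (.const m)).unique (.const _)

theorem tangentGroupoid_mul_zero {h g : S} (hg : G.src h = G.tgt g) :
    G.tangentGroupoid.mul ⟨h, 0⟩ ⟨g, 0⟩ = ⟨G.mul h g, 0⟩ :=
  (hasVelocity_mul (.const h) (.const g) (by simp [hg])).unique (.const _)

/-- A vector `v` of the model space, regarded as a tangent vector at either of two equal points. -/
theorem tangentBundle_mk_congr {M : Type*} [TopologicalSpace M] [ChartedSpace E M] {x y : M}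
    (h : x = y) (v : E) :
    (⟨x, v⟩ : TangentBundle 𝓘(ℝ, E) M) = ⟨y, v⟩ := by subst h; rfl

theorem src_algebroidFiber_eq_tgt_zero (g : S) (Y : G.algebroidFiber (G.tgt g)) :
    G.tangentGroupoid.src ⟨G.one (G.tgt g), Y⟩ = G.tangentGroupoid.tgt ⟨g, 0⟩ := by
  rw [tangentGroupoid_tgt_zero]
  change (⟨G.src (G.one (G.tgt g)), G.srcDeriv (G.tgt g) Y⟩ : TangentBundle 𝓘(ℝ, F) P) = _
  have hY : G.srcDeriv (G.tgt g) Y = 0 := Y.2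
  rw [hY]
  exact tangentBundle_mk_congr (G.isGroupoid.src_one _) 0

/-- `T(R_g) Y` is the product of `Y` and the zero vector at `g`. -/
theorem rightDeriv_eq_mul [IsManifold 𝓘(ℝ, E) ∞ S] (g : S) (Y : G.algebroidFiber (G.tgt g)) :
    (⟨g, G.rightDeriv g Y⟩ : TangentBundle 𝓘(ℝ, E) S)
      = G.tangentGroupoid.mul ⟨G.one (G.tgt g), Y⟩ ⟨g, 0⟩ := by
  obtain ⟨c, hc, h⟩ := exists_left_curve (.const g) (src_algebroidFiber_eq_tgt_zero g Y)
  have h1 := hasVelocity_mul hc (.const g) h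
  have hdiff : MDifferentiableWithinAt 𝓘(ℝ, E) 𝓘(ℝ, E) (fun h => G.mul h g)
      {h | G.src h = G.tgt g} (G.one (G.tgt g)) := by
    have h2 := (G.mul_smooth (G.one (G.tgt g), g)
      (G.isGroupoid.src_one _)).mdifferentiableWithinAt (by simp)
    have h3 : MDifferentiableWithinAt 𝓘(ℝ, E) (𝓘(ℝ, E).prod 𝓘(ℝ, E)) (fun h : S => (h, g))
      {h | G.src h = G.tgt g} (G.one (G.tgt g)) :=
        mdifferentiableWithinAt_id.prodMk mdifferentiableWithinAt_const
    exact MDifferentiableWithinAt.comp (g := fun p : S × S => G.mul p.1 p.2) (u := G.composable)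
      (G.one (G.tgt g)) h2 h3 (fun x hx => hx)
  have h2 := hc.comp_within (f := fun h => G.mul h g) (I' := 𝓘(ℝ, E)) hdiff h
  rw [h1.unique h2]
  exact (tangentBundle_mk_congr (E := E) (G.isGroupoid.one_mul g) (G.rightDeriv g Y)).symm

theorem src_zero_eq_tgt_one (g : S) {Y : TangentSpace 𝓘(ℝ, E) (G.one (G.src g))}
    (hY : G.tgtDeriv (G.src g) Y = 0) :
    G.tangentGroupoid.src ⟨g, 0⟩ = G.tangentGroupoid.tgt ⟨G.one (G.src g), Y⟩ := by
  rw [tangentGroupoid_src_zero]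
  change _ = (⟨G.tgt (G.one (G.src g)), G.tgtDeriv (G.src g) Y⟩ : TangentBundle 𝓘(ℝ, F) P)
  rw [hY]
  exact tangentBundle_mk_congr (G.isGroupoid.tgt_one _).symm 0

/-- `T(L_g) Y` is the product of the zero vector at `g` and of `Y`, for `Y` tangent to the target
fibre. -/
theorem leftDeriv_eq_mul [IsManifold 𝓘(ℝ, E) ∞ S] (g : S)
    (Y : TangentSpace 𝓘(ℝ, E) (G.one (G.src g))) (hY : G.tgtDeriv (G.src g) Y = 0) :
    (⟨g, G.leftDeriv g Y⟩ : TangentBundle 𝓘(ℝ, E) S)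
      = G.tangentGroupoid.mul ⟨g, 0⟩ ⟨G.one (G.src g), Y⟩ := by
  have hc : ∃ c, HasVelocity 𝓘(ℝ, E) c (⟨G.one (G.src g), Y⟩ : TangentBundle 𝓘(ℝ, E) S) ∧
      ∀ᶠ t in 𝓝 0, G.tgt (c t) = G.src g := by
    obtain ⟨K, _, _, hK⟩ := G.tgt_submersion
    obtain ⟨pr, sec, hs⟩ := (hK (G.one (G.src g))).exists_isLocalSplitting
    refine hs.exists_lift (v := (⟨G.one (G.src g), Y⟩ : TangentBundle 𝓘(ℝ, E) S))
      (c := fun _ => G.src g) ?_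
    change HasVelocity _ _ (G.tangentGroupoid.tgt ⟨G.one (G.src g), Y⟩)
    rw [← src_zero_eq_tgt_one g hY]
    exact hasVelocity_src (.const g)
  obtain ⟨c, hc, h⟩ := hc
  have h1 := hasVelocity_mul (.const g) hc (h.mono fun t ht => ht.symm)
  have hdiff : MDifferentiableWithinAt 𝓘(ℝ, E) 𝓘(ℝ, E) (fun h => G.mul g h)
      {h | G.tgt h = G.src g} (G.one (G.src g)) := by
    have h2 := (G.mul_smooth (g, G.one (G.src g))
      (G.isGroupoid.tgt_one _).symm).mdifferentiableWithinAt (by simp)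
    have h3 : MDifferentiableWithinAt 𝓘(ℝ, E) (𝓘(ℝ, E).prod 𝓘(ℝ, E)) (fun h : S => (g, h))
      {h | G.tgt h = G.src g} (G.one (G.src g)) :=
        mdifferentiableWithinAt_const.prodMk mdifferentiableWithinAt_id
    exact MDifferentiableWithinAt.comp (g := fun p : S × S => G.mul p.1 p.2) (u := G.composable)
      (G.one (G.src g)) h2 h3 (fun x hx => Eq.symm hx)
  have h2 := hc.comp_within (f := fun h => G.mul g h) (I' := 𝓘(ℝ, E)) hdiff h
  rw [h1.unique h2]
  exact (tangentBundle_mk_congr (E := E) (G.isGroupoid.mul_one g) (G.leftDeriv g Y)).symm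

end

end LieGroupoid

/-! ### Tangent spaces of Lagrangian submanifolds -/

section Lagrangian

section

variable {E H M : Type*} [NormedAddCommGroup E] [NormedSpace ℝ E] [TopologicalSpace H]
  {I : ModelWithCorners ℝ E H} [TopologicalSpace M] [ChartedSpace H M]
  {E' H' M' : Type*} [NormedAddCommGroup E'] [NormedSpace ℝ E'] [TopologicalSpace H']
  {I' : ModelWithCorners ℝ E' H'} [TopologicalSpace M'] [ChartedSpace H' M']

theorem HasVelocity.fst {c : ℝ → M × M'} {p : M × M'} {v : E × E'}
    (hc : HasVelocity (I.prod I') c ⟨p, v⟩) : HasVelocity I (fun t => (c t).1) ⟨p.1, v.1⟩ := by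
  have h := hc.comp (f := Prod.fst) (I' := I) mdifferentiableAt_fst
  rw [tangentMap_prodFst] at h
  exact h

theorem HasVelocity.snd {c : ℝ → M × M'} {p : M × M'} {v : E × E'}
    (hc : HasVelocity (I.prod I') c ⟨p, v⟩) : HasVelocity I' (fun t => (c t).2) ⟨p.2, v.2⟩ := by
  have h := hc.comp (f := Prod.snd) (I' := I') mdifferentiableAt_snd
  rw [tangentMap_prodSnd] at h
  exact h

end

variable {E H M : Type*} [NormedAddCommGroup E] [NormedSpace ℝ E] [FiniteDimensional ℝ E]
  [TopologicalSpace H] {I : ModelWithCorners ℝ E H} [I.Boundaryless] [TopologicalSpace M]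
  [ChartedSpace H M]

/-- A vector is tangent to a submanifold, given in a chart `e` by the linear subspace `W`, precisely
if it is the velocity of a curve in the submanifold. -/
theorem mfderiv_extend_mem_iff {L : Set M} {p : M} {e : OpenPartialHomeomorph M H}
    (he : e ∈ IsManifold.maximalAtlas I ∞ M) (hp : p ∈ e.source) {W : Submodule ℝ E}
    (hW : ∀ q ∈ e.source, q ∈ L ↔ e.extend I q - e.extend I p ∈ W) (v : TangentSpace I p) :
    (mfderiv I 𝓘(ℝ, E) (e.extend I) p v : E) ∈ W ↔
      ∃ c, HasVelocity I c ⟨p, v⟩ ∧ ∀ᶠ t in 𝓝 0, c t ∈ L := by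
  have hs : MDifferentiableAt I 𝓘(ℝ, E) (e.extend I) p :=
    ((e.contMDiffOn_extend he).contMDiffAt (e.open_source.mem_nhds hp)).mdifferentiableAt (by simp)
  have hpt : e.extend I p ∈ (e.extend I).target := (e.extend I).map_source (by simpa using hp)
  have hopen : IsOpen (e.extend I).target := e.isOpen_extend_target
  have hsymm : MDifferentiableAt 𝓘(ℝ, E) I (e.extend I).symm (e.extend I p) :=
    ((contMDiffOn_extend_symm he).contMDiffAt (by
      rw [← e.extend_target']
      exact hopen.mem_nhds hpt)).mdifferentiableAt (by simp)
  have hleft : ∀ᶠ q in 𝓝 p, (e.extend I).symm (e.extend I q) = q := by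
    filter_upwards [e.open_source.mem_nhds hp] with q hq
    exact e.extend_left_inv hq
  constructor
  · intro hv
    set w : E := mfderiv I 𝓘(ℝ, E) (e.extend I) p v
    let l : ℝ → E := fun t => e.extend I p + t • w
    have hl : HasVelocity 𝓘(ℝ, E) l (tangentMap I 𝓘(ℝ, E) (e.extend I) ⟨p, v⟩) := by
      rw [HasVelocity.iff_hasDerivAt]
      refine ⟨by simp [l], ?_⟩
      have h1 := ((hasDerivAt_id (0 : ℝ)).smul_const w).const_add (e.extend I p)
      rw [one_smul] at h1
      exact h1
    have h2 := hl.comp (f := (e.extend I).symm) hsymm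
    have h3 : tangentMap 𝓘(ℝ, E) I (e.extend I).symm (tangentMap I 𝓘(ℝ, E) (e.extend I) ⟨p, v⟩)
        = ⟨p, v⟩ := by
      rw [← tangentMap_comp_at (⟨p, v⟩ : TangentBundle I M) (g := (e.extend I).symm) hsymm hs]
      have h4 : ((e.extend I).symm ∘ (e.extend I)) =ᶠ[𝓝 p] id := hleft
      rw [h4.tangentMap_eq, tangentMap_id]
      rfl
    rw [h3] at h2
    refine ⟨_, h2, ?_⟩
    filter_upwards [hl.tendsto.eventually (hopen.mem_nhds hpt)] with t ht
    have h5 : (e.extend I).symm (l t) ∈ e.source := by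
      simpa using (e.extend I).map_target ht
    rw [hW _ h5, (e.extend I).right_inv ht]
    simpa [l] using W.smul_mem t hv
  · rintro ⟨c, hc, hL⟩
    have h1 := HasVelocity.iff_hasDerivAt.1 (hc.comp (f := e.extend I) hs)
    have hcs := hc.tendsto.eventually (e.open_source.mem_nhds hp)
    have hclosed : IsClosed (W : Set E) := W.closed_of_finiteDimensional
    have h2 := h1.2.tendsto_slope_zero
    refine hclosed.mem_of_tendsto h2 ?_
    filter_upwards [(hcs.and hL).filter_mono nhdsWithin_le_nhds] with t ht
    refine W.smul_mem _ ?_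
    have h3 := (hW _ ht.1).1 ht.2
    rw [zero_add, h1.1]
    exact h3

theorem mfderiv_extend_bijective {p : M} {e : OpenPartialHomeomorph M H}
    (he : e ∈ IsManifold.maximalAtlas I ∞ M) (hp : p ∈ e.source) :
    Function.Bijective (mfderiv I 𝓘(ℝ, E) (e.extend I) p) := by
  have hs : MDifferentiableAt I 𝓘(ℝ, E) (e.extend I) p :=
    ((e.contMDiffOn_extend he).contMDiffAt (e.open_source.mem_nhds hp)).mdifferentiableAt (by simp)
  have hpt : e.extend I p ∈ (e.extend I).target := (e.extend I).map_source (by simpa using hp)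
  have hopen : IsOpen (e.extend I).target := e.isOpen_extend_target
  have hsymm : MDifferentiableAt 𝓘(ℝ, E) I (e.extend I).symm (e.extend I p) :=
    ((contMDiffOn_extend_symm he).contMDiffAt (by
      rw [← e.extend_target']
      exact hopen.mem_nhds hpt)).mdifferentiableAt (by simp)
  have hleft : ((e.extend I).symm ∘ (e.extend I)) =ᶠ[𝓝 p] id := by
    filter_upwards [e.open_source.mem_nhds hp] with q hq
    exact e.extend_left_inv hq
  have hinj : Function.Injective (mfderiv I 𝓘(ℝ, E) (e.extend I) p) := by
    have h1 := mfderiv_comp p (g := (e.extend I).symm) hsymm hs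
    rw [hleft.mfderiv_eq, mfderiv_id] at h1
    intro v w hvw
    have h2 := DFunLike.congr_fun h1 v
    have h3 := DFunLike.congr_fun h1 w
    change v = mfderiv 𝓘(ℝ, E) I (e.extend I).symm (e.extend I p)
      (mfderiv I 𝓘(ℝ, E) (e.extend I) p v) at h2
    change w = mfderiv 𝓘(ℝ, E) I (e.extend I).symm (e.extend I p)
      (mfderiv I 𝓘(ℝ, E) (e.extend I) p w) at h3
    rw [h2, h3, hvw]
  have hinj' : Function.Injective ((mfderiv I 𝓘(ℝ, E) (e.extend I) p : E →L[ℝ] E).toLinearMap) :=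
    hinj
  exact ⟨hinj, (LinearMap.injective_iff_surjective (K := ℝ) (V := E)).1 hinj'⟩

/-- The tangent space of a Lagrangian submanifold, described by velocities of curves. -/
theorem IsLagrangian.exists_tangentSpace [IsManifold I ∞ M]
    {σ : ∀ x : M, TangentSpace I x → TangentSpace I x → ℝ}
    {L : Set M} (hL : IsLagrangian I σ L) {p : M} (hp : p ∈ L) :
    ∃ T : Submodule ℝ E, 2 * Module.finrank ℝ T = Module.finrank ℝ E ∧
      (∀ v : TangentSpace I p, (v : E) ∈ T ↔
        ∃ c, HasVelocity I c ⟨p, v⟩ ∧ ∀ᶠ t in 𝓝 0, c t ∈ L) ∧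
      ∀ v w : TangentSpace I p, (v : E) ∈ T → (w : E) ∈ T → σ p v w = 0 := by
  obtain ⟨e, he, hpe, W, hW, hdim, hσ⟩ := hL p hp
  let D : E →L[ℝ] E := mfderiv I 𝓘(ℝ, E) (e.extend I) p
  have hD : Function.Bijective D := mfderiv_extend_bijective he hpe
  let D' : E ≃ₗ[ℝ] E := LinearEquiv.ofBijective D.toLinearMap hD
  refine ⟨W.comap D.toLinearMap, ?_, fun v => ?_, fun v w hv hw => hσ v w hv hw⟩
  · have h1 : Module.finrank ℝ (W.comap D.toLinearMap) = Module.finrank ℝ W := by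
      have h2 : (W.comap D.toLinearMap).map D.toLinearMap = W :=
        Submodule.map_comap_eq_of_surjective hD.2 W
      rw [← h2]
      have h3 := LinearEquiv.finrank_map_eq D' (W.comap D.toLinearMap)
      have h4 : (W.comap D.toLinearMap).map (D' : E →ₗ[ℝ] E) =
          (W.comap D.toLinearMap).map D.toLinearMap := rfl
      rw [h2, ← h3, h4, h2]
    rw [h1, hdim]
  · exact mfderiv_extend_mem_iff he hpe hW v

end Lagrangian

/-! ### Multiplicativity of the symplectic form -/

theorem tangentBundle_mk_eq_iff {E M : Type*} [NormedAddCommGroup E] [NormedSpace ℝ E]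
    [TopologicalSpace M] [ChartedSpace E M] {x y : M} (h : x = y) (v w : E) :
    ((⟨x, v⟩ : TangentBundle 𝓘(ℝ, E) M) = ⟨y, w⟩) ↔ v = w := by
  subst h
  exact ⟨fun h => TotalSpace.mk_inj.1 h, fun h => by rw [h]⟩

namespace SymplecticForm

variable {E M : Type*} [NormedAddCommGroup E] [NormedSpace ℝ E]
  [TopologicalSpace M] [ChartedSpace E M] [IsManifold 𝓘(ℝ, E) ∞ M]

/-- The value of a symplectic form on two elements of the tangent bundle. It is meaningful if both
lie in the same tangent space, an equality that need not be definitional. -/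
noncomputable def pair (Ω : SymplecticForm 𝓘(ℝ, E) M) (v w : TangentBundle 𝓘(ℝ, E) M) : ℝ :=
  (Ω.form v.1 : E →L[ℝ] E →L[ℝ] ℝ) v.2 w.2

theorem form_swap (Ω : SymplecticForm 𝓘(ℝ, E) M) (x : M) (v w : TangentSpace 𝓘(ℝ, E) x) :
    Ω.form x v w = -Ω.form x w v := by
  have h := Ω.alternating x (v + w)
  simp only [map_add, _root_.add_apply, Ω.alternating, zero_add, add_zero] at h
  linarith

theorem pair_zero_left (Ω : SymplecticForm 𝓘(ℝ, E) M) (x : M) (w : TangentBundle 𝓘(ℝ, E) M) :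
    Ω.pair ⟨x, 0⟩ w = 0 := by
  change (Ω.form x : E →L[ℝ] E →L[ℝ] ℝ) 0 w.2 = 0
  rw [map_zero]
  rfl

theorem pair_zero_right (Ω : SymplecticForm 𝓘(ℝ, E) M) (x : M) (v : TangentBundle 𝓘(ℝ, E) M) :
    Ω.pair v ⟨x, 0⟩ = 0 := by
  change (Ω.form v.1 : E →L[ℝ] E →L[ℝ] ℝ) v.2 0 = 0
  rw [map_zero]

end SymplecticForm

namespace LieGroupoid

variable {E F S P : Type*} [NormedAddCommGroup E] [NormedSpace ℝ E]
  [NormedAddCommGroup F] [NormedSpace ℝ F] [TopologicalSpace S] [ChartedSpace E S]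
  [TopologicalSpace P] [ChartedSpace F P] {G : LieGroupoid E F S P}
  [FiniteDimensional ℝ E] [IsManifold 𝓘(ℝ, E) ∞ S] {Ω : SymplecticForm 𝓘(ℝ, E) S}

/-- The symplectic form of a symplectic groupoid is multiplicative. -/
theorem pair_mul (hG : G.IsSymplectic Ω) {η ξ η' ξ' : TangentBundle 𝓘(ℝ, E) S}
    (h₁ : η.1 = η'.1) (h₂ : ξ.1 = ξ'.1)
    (h : G.tangentGroupoid.src η = G.tangentGroupoid.tgt ξ)
    (h' : G.tangentGroupoid.src η' = G.tangentGroupoid.tgt ξ') :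
    Ω.pair (G.tangentGroupoid.mul η ξ) (G.tangentGroupoid.mul η' ξ')
      = Ω.pair η η' + Ω.pair ξ ξ' := by
  obtain ⟨x, η⟩ := η
  obtain ⟨y, ξ⟩ := ξ
  obtain ⟨x', η'⟩ := η'
  obtain ⟨y', ξ'⟩ := ξ'
  obtain rfl : x = x' := h₁
  obtain rfl : y = y' := h₂
  obtain ⟨c, d, hc, hd, hcd, hm⟩ := exists_composable_curves h
  obtain ⟨c', d', hc', hd', hcd', hm'⟩ := exists_composable_curves h'
  have hxy : G.src x = G.tgt y := congrArg TotalSpace.proj h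
  have hp : (G.mul x y, x, y) ∈ G.graph := ⟨hxy, rfl⟩
  obtain ⟨T, -, hT, hσ⟩ := IsLagrangian.exists_tangentSpace hG hp
  have h1 := (hT ((G.tangentGroupoid.mul ⟨x, η⟩ ⟨y, ξ⟩).2, η, ξ)).2
    ⟨_, hm.prodMk (hc.prodMk hd), hcd.mono fun t ht => ⟨ht, rfl⟩⟩
  have h2 := (hT ((G.tangentGroupoid.mul ⟨x, η'⟩ ⟨y, ξ'⟩).2, η', ξ')).2
    ⟨_, hm'.prodMk (hc'.prodMk hd'), hcd'.mono fun t ht => ⟨ht, rfl⟩⟩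
  have h3 := hσ _ _ h1 h2
  change Ω.pair ⟨x, η⟩ ⟨x, η'⟩ + Ω.pair ⟨y, ξ⟩ ⟨y, ξ'⟩ -
    Ω.pair (G.tangentGroupoid.mul ⟨x, η⟩ ⟨y, ξ⟩) (G.tangentGroupoid.mul ⟨x, η'⟩ ⟨y, ξ'⟩) = 0 at h3
  linarith

/-- The manifold of arrows of a symplectic groupoid has twice the dimension of the manifold of
units: the graph of multiplication has the dimension `2 dim E - dim F` of the manifold of composable
pairs, and half the dimension `3 dim E` of its ambient manifold. The arrow `g` only serves to
exclude the empty groupoid. -/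
theorem finrank_eq_two_mul [FiniteDimensional ℝ F] [IsManifold 𝓘(ℝ, F) ∞ P]
    (hG : G.IsSymplectic Ω) (g : S) :
    Module.finrank ℝ E = 2 * Module.finrank ℝ F := by
  set x := G.one (G.tgt g)
  have hxg : G.src x = G.tgt g := G.isGroupoid.src_one _
  have hp : (G.mul x g, x, g) ∈ G.graph := ⟨hxg, rfl⟩
  obtain ⟨T, hdim, hT, -⟩ := IsLagrangian.exists_tangentSpace hG hp
  let a : E →L[ℝ] F := mfderiv 𝓘(ℝ, E) 𝓘(ℝ, F) G.src x
  let b : E →L[ℝ] F := mfderiv 𝓘(ℝ, E) 𝓘(ℝ, F) G.tgt g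
  have hcomp : ∀ η ξ : E, G.tangentGroupoid.src ⟨x, η⟩ = G.tangentGroupoid.tgt ⟨g, ξ⟩ ↔
      a η = b ξ := fun η ξ => tangentBundle_mk_eq_iff hxg (a η) (b ξ)
  let A : E × E →ₗ[ℝ] F :=
    a.toLinearMap ∘ₗ LinearMap.fst ℝ E E - b.toLinearMap ∘ₗ LinearMap.snd ℝ E E
  have hA : Function.Surjective A := by
    intro y
    obtain ⟨K, _, _, hK⟩ := G.src_submersion
    obtain ⟨pr, sec, hs⟩ := (hK x).exists_isLocalSplitting
    obtain ⟨⟨x', v⟩, hv, hv'⟩ := hs.exists_tangentMap_eq ⟨G.src x, y⟩ rfl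
    obtain rfl : x' = x := hv
    refine ⟨(v, 0), ?_⟩
    have h1 : a v = y := TotalSpace.mk_inj.1 hv'
    simp [A, h1]
  have hker := LinearMap.finrank_range_add_finrank_ker A
  rw [LinearMap.range_eq_top.2 hA, finrank_top, Module.finrank_prod] at hker
  have key : ∀ u η ξ : E, (u, η, ξ) ∈ T ↔
      G.tangentGroupoid.src ⟨x, η⟩ = G.tangentGroupoid.tgt ⟨g, ξ⟩ ∧
        (⟨G.mul x g, u⟩ : TangentBundle 𝓘(ℝ, E) S) = G.tangentGroupoid.mul ⟨x, η⟩ ⟨g, ξ⟩ := by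
    intro u η ξ
    refine (hT (u, η, ξ)).trans ⟨?_, ?_⟩
    · rintro ⟨c, hc, hL⟩
      have hcd := hL.mono fun t ht => ht.1
      refine ⟨(hasVelocity_src hc.snd.fst).unique ((hasVelocity_tgt hc.snd.snd).congr hcd), ?_⟩
      exact hc.fst.unique ((hasVelocity_mul hc.snd.fst hc.snd.snd hcd).congr
        (hL.mono fun t ht => ht.2))
    · rintro ⟨h1, h2⟩
      obtain ⟨c, d, hc, hd, hcd, hm⟩ := exists_composable_curves h1
      rw [← h2] at hm
      exact ⟨_, hm.prodMk (hc.prodMk hd), hcd.mono fun t ht => ⟨ht, rfl⟩⟩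
  let B : T →ₗ[ℝ] E × E := (LinearMap.snd ℝ E (E × E)).domRestrict T
  have hBinj : Function.Injective B := by
    rw [injective_iff_map_eq_zero]
    rintro ⟨⟨u, η, ξ⟩, hu⟩ h0
    have h1 : (η, ξ) = (0 : E × E) := h0
    obtain ⟨rfl, rfl⟩ := Prod.mk_eq_zero.1 h1
    have h2 := ((key u 0 0).1 hu).2
    have h3 := h2.trans (tangentGroupoid_mul_zero hxg)
    have h4 : u = 0 := TotalSpace.mk_inj.1 h3
    subst h4
    rfl
  have hBrange : LinearMap.range B = LinearMap.ker A := by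
    ext ⟨η, ξ⟩
    have hAker : (η, ξ) ∈ LinearMap.ker A ↔ a η = b ξ := by
      simp [A, sub_eq_zero]
    rw [hAker, ← hcomp]
    constructor
    · rintro ⟨⟨⟨u, η', ξ'⟩, hu⟩, h0⟩
      have h1 : (η', ξ') = (η, ξ) := h0
      obtain ⟨rfl, rfl⟩ := Prod.mk_inj.1 h1
      exact ((key _ _ _).1 hu).1
    · intro h
      exact ⟨⟨((G.tangentGroupoid.mul ⟨x, η⟩ ⟨g, ξ⟩).2, η, ξ), (key _ _ _).2 ⟨h, rfl⟩⟩, rfl⟩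
  have h1 := LinearMap.finrank_range_of_inj hBinj
  rw [hBrange] at h1
  simp only [Module.finrank_prod] at hdim
  omega

end LieGroupoid

/-! ### Images of immersions -/

/-- The image of an immersion that has a continuous left inverse `r` is, near each of its points and
in a suitable chart, a linear subspace of the dimension of the domain. The left inverse confines the
image near `f m` to the image of a neighbourhood of `m`. -/
theorem Manifold.IsImmersionAtOfComplement.exists_chart_image {E M F P K : Type*}
    [NormedAddCommGroup E] [NormedSpace ℝ E] [TopologicalSpace M] [ChartedSpace E M]
    [NormedAddCommGroup F] [NormedSpace ℝ F] [TopologicalSpace P] [ChartedSpace F P]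
    [NormedAddCommGroup K] [NormedSpace ℝ K] {f : P → M} {m : P} {r : M → P}
    (h : IsImmersionAtOfComplement K 𝓘(ℝ, F) 𝓘(ℝ, E) ∞ f m) (hr : Continuous r)
    (hrf : ∀ z, r (f z) = z) :
    ∃ e ∈ IsManifold.maximalAtlas 𝓘(ℝ, E) ∞ M, f m ∈ e.source ∧ ∃ W : Submodule ℝ E,
      (∀ q ∈ e.source, q ∈ Set.range f ↔ e q - e (f m) ∈ W) ∧
      Module.finrank ℝ W = Module.finrank ℝ F := by
  let φ := h.domChart
  let ψ := h.codChart
  let L := h.equiv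
  have hm : m ∈ φ.source := h.mem_domChart_source
  have hfm : f m ∈ ψ.source := h.mem_codChart_source
  have hf : ∀ z ∈ φ.source, ψ (f z) = L (φ z, 0) := by
    intro z hz
    have := h.writtenInCharts ((h.domChart.extend 𝓘(ℝ, F)).map_source (x := z) (by simpa using hz))
    simpa [h.domChart.left_inv hz, φ, ψ, L] using this
  let s : Set M := (ψ.source ∩ ψ ⁻¹' ((fun y => (L.symm y).1) ⁻¹' φ.target)) ∩ r ⁻¹' φ.source
  have hs : IsOpen s := by
    refine IsOpen.inter (ψ.isOpen_inter_preimage ?_) (φ.open_source.preimage hr)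
    exact φ.open_target.preimage (continuous_fst.comp L.symm.continuous)
  have hps : f m ∈ s := by
    refine ⟨⟨hfm, ?_⟩, ?_⟩
    · change (L.symm (ψ (f m))).1 ∈ φ.target
      rw [hf m hm]
      simpa using φ.map_source hm
    · change r (f m) ∈ φ.source
      rwa [hrf]
  let W : Submodule ℝ E := LinearMap.range (L.toLinearMap ∘ₗ LinearMap.inl ℝ F K)
  refine ⟨ψ.restr s, restr_mem_maximalAtlas _ h.codChart_mem_maximalAtlas hs, ?_, W, ?_, ?_⟩
  · rw [OpenPartialHomeomorph.restr_source, hs.interior_eq]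
    exact ⟨hfm, hps⟩
  · intro q hq
    rw [OpenPartialHomeomorph.restr_source, hs.interior_eq] at hq
    change q ∈ Set.range f ↔ ψ q - ψ (f m) ∈ W
    rw [hf m hm]
    constructor
    · rintro ⟨z, rfl⟩
      have hz : z ∈ φ.source := by
        have : r (f z) ∈ φ.source := hq.2.2
        rwa [hrf] at this
      refine ⟨φ z - φ m, ?_⟩
      rw [hf z hz, ← map_sub]
      simp
    · rintro ⟨w, hw⟩
      have hw' : L (w, 0) = ψ q - L (φ m, 0) := hw
      have h1 : ψ q = L (φ m + w, 0) := by
        rw [eq_sub_iff_add_eq] at hw'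
        rw [← hw', ← map_add]
        simp [add_comm]
      have h2 : φ m + w ∈ φ.target := by
        have : (L.symm (ψ q)).1 ∈ φ.target := hq.2.1.2
        simpa [h1] using this
      refine ⟨φ.symm (φ m + w), ?_⟩
      refine ψ.injOn (h.source_subset_preimage_source (φ.map_target h2)) hq.1 ?_
      rw [hf _ (φ.map_target h2), φ.right_inv h2, h1]
  · refine LinearMap.finrank_range_of_inj ?_
    intro x y hxy
    have := L.injective hxy
    simpa using this

namespace LieGroupoid

variable {E F S P : Type*} [NormedAddCommGroup E] [NormedSpace ℝ E]
  [NormedAddCommGroup F] [NormedSpace ℝ F] [TopologicalSpace S] [ChartedSpace E S]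
  [TopologicalSpace P] [ChartedSpace F P] {G : LieGroupoid E F S P}
  [FiniteDimensional ℝ E] [IsManifold 𝓘(ℝ, E) ∞ S] [IsManifold 𝓘(ℝ, F) ∞ P]
  {Ω : SymplecticForm 𝓘(ℝ, E) S}

/-! ### Units, inversion and fibres of a symplectic groupoid -/

/-- The form vanishes on the units: as `1_x • 1_x = 1_x`, its value is twice itself. -/
theorem pair_one (hG : G.IsSymplectic Ω) {x y : TangentBundle 𝓘(ℝ, F) P} (h : x.1 = y.1) :
    Ω.pair (G.tangentGroupoid.one x) (G.tangentGroupoid.one y) = 0 := by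
  have hT := G.tangentGroupoid_isGroupoid
  have hm : ∀ z, G.tangentGroupoid.mul (G.tangentGroupoid.one z) (G.tangentGroupoid.one z)
      = G.tangentGroupoid.one z := by
    intro z
    have := hT.one_mul (G.tangentGroupoid.one z)
    rwa [hT.tgt_one] at this
  have hc : ∀ z, G.tangentGroupoid.src (G.tangentGroupoid.one z)
      = G.tangentGroupoid.tgt (G.tangentGroupoid.one z) := by
    intro z
    rw [hT.src_one, hT.tgt_one]
  have h1 : (G.tangentGroupoid.one x).1 = (G.tangentGroupoid.one y).1 := congrArg G.one h
  have := pair_mul hG h1 h1 (hc x) (hc y)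
  rw [hm, hm] at this
  linarith

theorem form_oneDeriv (hG : G.IsSymplectic Ω) (m : P) (x y : TangentSpace 𝓘(ℝ, F) m) :
    Ω.form (G.one m) (G.oneDeriv m x) (G.oneDeriv m y) = 0 :=
  pair_one hG (x := ⟨m, x⟩) (y := ⟨m, y⟩) rfl

theorem isLagrangian_range_one [FiniteDimensional ℝ F] (hG : G.IsSymplectic Ω) :
    IsLagrangian 𝓘(ℝ, E) (fun g v w => Ω.form g v w) (Set.range G.one) := by
  rintro _ ⟨m, rfl⟩
  obtain ⟨K, _, _, hK⟩ := G.one_immersion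
  obtain ⟨e, he, hm, W, hW, hdim⟩ := (hK m).exists_chart_image G.contMDiff_src.continuous
    G.isGroupoid.src_one
  refine ⟨e, he, hm, W, hW, ?_, ?_⟩
  · rw [hdim, finrank_eq_two_mul hG (G.one m)]
  · -- Vectors tangent to the submanifold of units are tangent units.
    have key : ∀ v : TangentSpace 𝓘(ℝ, E) (G.one m),
        (mfderiv 𝓘(ℝ, E) 𝓘(ℝ, E) (e.extend 𝓘(ℝ, E)) (G.one m) v : E) ∈ W →
        G.tangentGroupoid.one (G.tangentGroupoid.src ⟨G.one m, v⟩) = ⟨G.one m, v⟩ := by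
      intro v hv
      obtain ⟨c, hc, hL⟩ := (mfderiv_extend_mem_iff he hm hW v).1 hv
      refine (hasVelocity_one (hasVelocity_src hc)).unique (hc.congr ?_)
      filter_upwards [hL] with t ⟨z, hz⟩
      rw [← hz, G.isGroupoid.src_one]
    intro v w hv hw
    change Ω.pair ⟨G.one m, v⟩ ⟨G.one m, w⟩ = 0
    rw [← key v hv, ← key w hw]
    exact pair_one hG rfl

/-- The form vanishes on the units `ξ⁻¹ • ξ`, so `ω(ξ⁻¹, η⁻¹) + ω(ξ, η) = 0`. -/
theorem isAntisymplectomorphism_inv (hG : G.IsSymplectic Ω) :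
    IsAntisymplectomorphism Ω G.inv := by
  refine ⟨⟨⟨⟨G.inv, G.inv, G.inv_inv, G.inv_inv⟩, G.contMDiff_inv, G.contMDiff_inv⟩, rfl⟩, ?_⟩
  intro x v w
  have hv := G.inv_laws_tangent ⟨x, v⟩
  have hw := G.inv_laws_tangent ⟨x, w⟩
  have h1 := pair_mul hG (η := tangentMap 𝓘(ℝ, E) 𝓘(ℝ, E) G.inv ⟨x, v⟩) (ξ := ⟨x, v⟩)
    (η' := tangentMap 𝓘(ℝ, E) 𝓘(ℝ, E) G.inv ⟨x, w⟩) (ξ' := ⟨x, w⟩) rfl rfl hv.1 hw.1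
  rw [hv.2.2.1, hw.2.2.1, pair_one hG (x := G.tangentGroupoid.src ⟨x, v⟩)
    (y := G.tangentGroupoid.src ⟨x, w⟩) rfl] at h1
  change Ω.pair (tangentMap 𝓘(ℝ, E) 𝓘(ℝ, E) G.inv ⟨x, v⟩)
    (tangentMap 𝓘(ℝ, E) 𝓘(ℝ, E) G.inv ⟨x, w⟩) = -Ω.pair ⟨x, v⟩ ⟨x, w⟩
  linarith

/-- The source and target fibres are orthogonal for the symplectic form: a vector tangent to the
source fibre at `g` is `v = v • 0`, and one tangent to the target fibre is `w = 0 • (0 • w)`, with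
zero vectors at the unit, at `g` and at `g⁻¹`. -/
theorem form_eq_zero_of_src_of_tgt (hG : G.IsSymplectic Ω) (g : S) (v w : TangentSpace 𝓘(ℝ, E) g)
    (hv : mfderiv 𝓘(ℝ, E) 𝓘(ℝ, F) G.src g v = 0) (hw : mfderiv 𝓘(ℝ, E) 𝓘(ℝ, F) G.tgt g w = 0) :
    Ω.form g v w = 0 := by
  have hT := G.tangentGroupoid_isGroupoid
  have hv' : G.tangentGroupoid.src ⟨g, v⟩ = ⟨G.src g, 0⟩ := by
    change (⟨G.src g, mfderiv 𝓘(ℝ, E) 𝓘(ℝ, F) G.src g v⟩ : TangentBundle 𝓘(ℝ, F) P) = _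
    rw [hv]
  have hw' : G.tangentGroupoid.tgt ⟨g, w⟩ = ⟨G.tgt g, 0⟩ := by
    change (⟨G.tgt g, mfderiv 𝓘(ℝ, E) 𝓘(ℝ, F) G.tgt g w⟩ : TangentBundle 𝓘(ℝ, F) P) = _
    rw [hw]
  have h1 : G.tangentGroupoid.mul ⟨g, v⟩ ⟨G.one (G.src g), 0⟩ = ⟨g, v⟩ := by
    have := hT.mul_one ⟨g, v⟩
    rwa [hv', tangentGroupoid_one_zero] at this
  have hc1 : G.tangentGroupoid.src ⟨G.inv g, 0⟩ = G.tangentGroupoid.tgt ⟨g, w⟩ := by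
    rw [hw', tangentGroupoid_src_zero, src_inv]
  have hc2 : G.tangentGroupoid.src ⟨g, 0⟩ = G.tangentGroupoid.tgt ⟨G.inv g, 0⟩ := by
    rw [tangentGroupoid_src_zero, tangentGroupoid_tgt_zero, tgt_inv]
  set ζ := G.tangentGroupoid.mul ⟨G.inv g, 0⟩ ⟨g, w⟩ with hζ
  have h2 : G.tangentGroupoid.mul ⟨g, 0⟩ ζ = ⟨g, w⟩ := by
    rw [hζ, hT.assoc _ _ _ hc2 hc1, tangentGroupoid_mul_zero (G.tgt_inv g).symm, mul_inv,
      ← tangentGroupoid_one_zero, ← hw', hT.one_mul]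
  have hc3 : G.tangentGroupoid.src ⟨g, 0⟩ = G.tangentGroupoid.tgt ζ := by
    rw [hζ, hT.tgt_mul _ _ hc1, hc2]
  have hc4 : G.tangentGroupoid.src ⟨g, v⟩ = G.tangentGroupoid.tgt ⟨G.one (G.src g), 0⟩ := by
    rw [hv', tangentGroupoid_tgt_zero, G.isGroupoid.tgt_one]
  have h3 := pair_mul hG (η := ⟨g, v⟩) (ξ := ⟨G.one (G.src g), 0⟩) (η' := ⟨g, 0⟩) (ξ' := ζ) rfl
    (G.inv_mul g).symm hc4 hc3
  rwa [h1, h2, SymplecticForm.pair_zero_left, SymplecticForm.pair_zero_right, add_zero] at h3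

end LieGroupoid

/-! ### Transfer of groupoid laws -/

/-- The groupoid laws pass to the target of a bijective morphism. -/
theorem GroupoidData.IsGroupoid.transfer {A B A' B' : Type*} {D : GroupoidData A B}
    {D' : GroupoidData A' B'} {Φ : A → A'} {φ : B → B'} (hD : D.IsGroupoid)
    (h : D.IsMorphism D' Φ φ) (hΦ : Function.Bijective Φ) (hφ : Function.Bijective φ) :
    D'.IsGroupoid := by
  have hc : ∀ x y, D'.src (Φ x) = D'.tgt (Φ y) → D.src x = D.tgt y := by
    intro x y hxy
    rw [h.src_map, h.tgt_map] at hxy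
    exact hφ.1 hxy
  constructor
  · intro m
    obtain ⟨m, rfl⟩ := hφ.2 m
    rw [← h.map_one, h.src_map, hD.src_one]
  · intro m
    obtain ⟨m, rfl⟩ := hφ.2 m
    rw [← h.map_one, h.tgt_map, hD.tgt_one]
  · intro x y hxy
    obtain ⟨x, rfl⟩ := hΦ.2 x
    obtain ⟨y, rfl⟩ := hΦ.2 y
    have h' := hc _ _ hxy
    rw [← h.map_mul _ _ h', h.src_map, h.src_map, hD.src_mul _ _ h']
  · intro x y hxy
    obtain ⟨x, rfl⟩ := hΦ.2 x
    obtain ⟨y, rfl⟩ := hΦ.2 y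
    have h' := hc _ _ hxy
    rw [← h.map_mul _ _ h', h.tgt_map, h.tgt_map, hD.tgt_mul _ _ h']
  · intro x y z hxy hyz
    obtain ⟨x, rfl⟩ := hΦ.2 x
    obtain ⟨y, rfl⟩ := hΦ.2 y
    obtain ⟨z, rfl⟩ := hΦ.2 z
    have h₁ := hc _ _ hxy
    have h₂ := hc _ _ hyz
    rw [← h.map_mul _ _ h₂, ← h.map_mul _ _ h₁, ← h.map_mul, ← h.map_mul, hD.assoc _ _ _ h₁ h₂]
    · rw [hD.src_mul _ _ h₁, h₂]
    · rw [hD.tgt_mul _ _ h₂, h₁]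
  · intro x
    obtain ⟨x, rfl⟩ := hΦ.2 x
    rw [h.tgt_map, ← h.map_one, ← h.map_mul _ _ (hD.src_one _), hD.one_mul]
  · intro x
    obtain ⟨x, rfl⟩ := hΦ.2 x
    rw [h.src_map, ← h.map_one, ← h.map_mul _ _ (hD.tgt_one _).symm, hD.mul_one]
  · intro x
    obtain ⟨x, rfl⟩ := hΦ.2 x
    obtain ⟨y, h1, h2, h3, h4⟩ := hD.exists_inv x
    refine ⟨Φ y, ?_, ?_, ?_, ?_⟩
    · rw [h.src_map, h.tgt_map, h1]
    · rw [h.src_map, h.tgt_map, h2]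
    · rw [← h.map_mul _ _ h1, h3, h.map_one, h.src_map]
    · rw [← h.map_mul _ _ h2.symm, h4, h.map_one, h.tgt_map]

/-! ### Smoothness of forms and of `Ω♭` -/

section Smoothness

variable {E H M : Type*} [NormedAddCommGroup E] [NormedSpace ℝ E] [TopologicalSpace H]
  {I : ModelWithCorners ℝ E H} [TopologicalSpace M] [ChartedSpace H M] [IsManifold I ∞ M]
  {E' H' N : Type*} [NormedAddCommGroup E'] [NormedSpace ℝ E'] [TopologicalSpace H']
  {I' : ModelWithCorners ℝ E' H'} [TopologicalSpace N] [ChartedSpace H' N]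

theorem contMDiffAt_oneForm_apply {b : N → M} {φ : ∀ y, TangentSpace I (b y) →L[ℝ] ℝ}
    {v : ∀ y, TangentSpace I (b y)} {y : N}
    (hφ : ContMDiffAt I' (I.prod 𝓘(ℝ, E →L[ℝ] ℝ)) ∞ (fun y => TotalSpace.mk' (E →L[ℝ] ℝ)
      (E := fun x : M => TangentSpace I x →L[ℝ] ℝ) (b y) (φ y)) y)
    (hv : ContMDiffAt I' I.tangent ∞ (fun y => (⟨b y, v y⟩ : TangentBundle I M)) y) :
    ContMDiffAt I' 𝓘(ℝ, ℝ) ∞ (fun y => φ y (v y)) y := by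
  have : ContMDiffAt I' (I.prod 𝓘(ℝ, ℝ)) ∞
      (fun m ↦ TotalSpace.mk' ℝ (E := Bundle.Trivial M ℝ) (b m) (φ m (v m))) y :=
    ContMDiffAt.clm_bundle_apply (F₁ := E) (E₁ := fun x : M => TangentSpace I x)
      (F₂ := ℝ) (E₂ := Bundle.Trivial M ℝ) hφ hv
  simp only [contMDiffAt_totalSpace] at this
  exact this.2

theorem SymplecticForm.contMDiffAt_form_apply (Ω : SymplecticForm I M) {b : N → M}
    {v w : ∀ y, TangentSpace I (b y)} {y : N} (hb : ContMDiffAt I' I ∞ b y)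
    (hv : ContMDiffAt I' I.tangent ∞ (fun y => (⟨b y, v y⟩ : TangentBundle I M)) y)
    (hw : ContMDiffAt I' I.tangent ∞ (fun y => (⟨b y, w y⟩ : TangentBundle I M)) y) :
    ContMDiffAt I' 𝓘(ℝ, ℝ) ∞ (fun y => Ω.form (b y) (v y) (w y)) y := by
  have : ContMDiffAt I' (I.prod 𝓘(ℝ, ℝ)) ∞
      (fun m ↦ TotalSpace.mk' ℝ (E := Bundle.Trivial M ℝ) (b m) (Ω.form (b m) (v m) (w m))) y :=
    ContMDiffAt.clm_bundle_apply₂ (F₁ := E) (E₁ := fun x : M => TangentSpace I x)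
      (F₂ := E) (E₂ := fun x : M => TangentSpace I x)
      (F₃ := ℝ) (E₃ := Bundle.Trivial M ℝ) (Ω.smooth.contMDiffAt.comp y hb) hv hw
  simp only [contMDiffAt_totalSpace] at this
  exact this.2

theorem SymplecticForm.contMDiffAt_flat (Ω : SymplecticForm I M) {b : N → M}
    {v : ∀ y, TangentSpace I (b y)} {y : N} (hb : ContMDiffAt I' I ∞ b y)
    (hv : ContMDiffAt I' I.tangent ∞ (fun y => (⟨b y, v y⟩ : TangentBundle I M)) y) :
    ContMDiffAt I' (I.prod 𝓘(ℝ, E →L[ℝ] ℝ)) ∞ (fun y => TotalSpace.mk' (E →L[ℝ] ℝ)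
      (E := fun x : M => TangentSpace I x →L[ℝ] ℝ) (b y) (Ω.flat (b y) (v y))) y := by
  have hneg : ContMDiff I (I.prod 𝓘(ℝ, E →L[ℝ] E →L[ℝ] ℝ)) ∞
    (fun x => TotalSpace.mk' (E →L[ℝ] E →L[ℝ] ℝ)
      (E := fun x : M => TangentSpace I x →L[ℝ] TangentSpace I x →L[ℝ] ℝ) x (-Ω.form x)) :=
    haveI : ∀ x : M, ContinuousAdd (TangentSpace I x →L[ℝ] ℝ) :=
      fun _ => inferInstanceAs (ContinuousAdd (E →L[ℝ] ℝ))
    Ω.smooth.neg_section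
  exact ContMDiffAt.clm_bundle_apply (F₁ := E) (E₁ := fun x : M => TangentSpace I x)
      (F₂ := E →L[ℝ] ℝ) (E₂ := fun x : M => TangentSpace I x →L[ℝ] ℝ)
      (hneg.contMDiffAt.comp y hb) hv

end Smoothness

namespace LieGroupoid

variable {E F S P : Type*} [NormedAddCommGroup E] [NormedSpace ℝ E]
  [NormedAddCommGroup F] [NormedSpace ℝ F] [TopologicalSpace S] [ChartedSpace E S]
  [TopologicalSpace P] [ChartedSpace F P] {G : LieGroupoid E F S P}

theorem tgtDeriv_oneDeriv (G : LieGroupoid E F S P) (m : P) (x : TangentSpace 𝓘(ℝ, F) m) :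
    G.tgtDeriv m (G.oneDeriv m x) = x := by
  have hc := mfderiv_comp m (G.mdifferentiableAt_tgt (G.one m)) (G.mdifferentiableAt_one m)
  have hid : G.tgt ∘ G.one = id := funext G.isGroupoid.tgt_one
  rw [hid, mfderiv_id] at hc
  exact (DFunLike.congr_fun hc x).symm

variable [IsManifold 𝓘(ℝ, E) ∞ S] {Ω : SymplecticForm 𝓘(ℝ, E) S}

theorem contMDiff_flatMap :
    ContMDiff 𝓘(ℝ, E).tangent (𝓘(ℝ, E).prod 𝓘(ℝ, E →L[ℝ] ℝ)) ∞ (G.flatMap Ω) := fun _ =>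
  Ω.contMDiffAt_flat (b := fun v : TangentBundle 𝓘(ℝ, E) S => v.1) (v := fun v => v.2)
    (Bundle.contMDiff_proj (TangentSpace 𝓘(ℝ, E))).contMDiffAt contMDiffAt_id

theorem isSmoothToDual_baseMap [IsManifold 𝓘(ℝ, F) ∞ P] : G.IsSmoothToDual (G.baseMap Ω) := by
  intro X hX x
  have hp : ContMDiffAt 𝓘(ℝ, F).tangent 𝓘(ℝ, F) ∞ (fun v : TangentBundle 𝓘(ℝ, F) P => v.1) x :=
    (Bundle.contMDiff_proj (TangentSpace 𝓘(ℝ, F))).contMDiffAt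
  have h := Ω.contMDiffAt_form_apply (b := fun v : TangentBundle 𝓘(ℝ, F) P => G.one v.1)
    (v := fun v => G.oneDeriv v.1 v.2) (w := fun v => X v.1) (y := x)
    (G.contMDiff_one.contMDiffAt.comp x hp)
    (G.contMDiff_one.contMDiff_tangentMap (m := ∞) (by simp)).contMDiffAt
    (hX.contMDiffAt.comp x hp)
  exact h.neg

/-- A vector at a unit that is orthogonal to the units and to the source fibre vanishes, as the
tangent space is the sum of both. -/
theorem eq_zero_of_form_unit (m : P) (v : TangentSpace 𝓘(ℝ, E) (G.one m))
    (h1 : ∀ x, Ω.form (G.one m) v (G.oneDeriv m x) = 0)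
    (h2 : ∀ X : G.algebroidFiber m, Ω.form (G.one m) v X = 0) : v = 0 := by
  refine Ω.nondegenerate _ _ fun w => ?_
  have h3 := h2 (G.unitProj m w)
  change Ω.form (G.one m) v (w - G.oneDeriv m (G.srcDeriv m w)) = 0 at h3
  rwa [map_sub, h1, sub_zero] at h3

variable [FiniteDimensional ℝ E]

theorem flatMap_bijective : Function.Bijective (G.flatMap Ω) := by
  constructor
  · rintro ⟨g, ξ⟩ ⟨g', ξ'⟩ h
    obtain rfl : g = g' := congrArg TotalSpace.proj h
    have h' : (⟨g, Ω.flat g ξ⟩ : G.Cotangent) = ⟨g, Ω.flat g ξ'⟩ := h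
    have h1 : Ω.flat g ξ = Ω.flat g ξ' := eq_of_heq (TotalSpace.mk.inj h').2
    rw [Ω.flat_injective g h1]
  · rintro ⟨g, φ⟩
    obtain ⟨ξ, hξ⟩ := (Ω.flat_bijective g).2 φ
    refine ⟨⟨g, ξ⟩, ?_⟩
    change (⟨g, Ω.flat g ξ⟩ : G.Cotangent) = _
    rw [hξ]

variable [IsManifold 𝓘(ℝ, F) ∞ P]

/-! ### The cotangent groupoid -/

/-- Multiplicativity for `ξ = ξ • T(1)(T(α)ξ)` and `T(L_g)Y = 0 • Y`. -/
theorem form_leftDeriv (hG : G.IsSymplectic Ω) (g : S) (ξ : TangentSpace 𝓘(ℝ, E) g)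
    (Y : TangentSpace 𝓘(ℝ, E) (G.one (G.src g))) (hY : G.tgtDeriv (G.src g) Y = 0) :
    Ω.form g ξ (G.leftDeriv g Y) = Ω.form (G.one (G.src g))
      (G.oneDeriv (G.src g) (mfderiv 𝓘(ℝ, E) 𝓘(ℝ, F) G.src g ξ)) Y := by
  have hT := G.tangentGroupoid_isGroupoid
  have hY' := src_zero_eq_tgt_one g hY
  have h := pair_mul hG (η := ⟨g, ξ⟩) (ξ := G.tangentGroupoid.one (G.tangentGroupoid.src ⟨g, ξ⟩))
    (η' := ⟨g, 0⟩) (ξ' := ⟨G.one (G.src g), Y⟩) rfl rfl (hT.tgt_one _).symm hY'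
  rw [hT.mul_one, ← leftDeriv_eq_mul g Y hY, SymplecticForm.pair_zero_right, zero_add] at h
  exact h

/-- Multiplicativity for `ξ = T(1)(T(β)ξ) • ξ` and `T(R_g)Y = Y • 0`. -/
theorem form_rightDeriv (hG : G.IsSymplectic Ω) (g : S) (ξ : TangentSpace 𝓘(ℝ, E) g)
    (Y : G.algebroidFiber (G.tgt g)) :
    Ω.form g ξ (G.rightDeriv g Y) = Ω.form (G.one (G.tgt g))
      (G.oneDeriv (G.tgt g) (mfderiv 𝓘(ℝ, E) 𝓘(ℝ, F) G.tgt g ξ)) Y := by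
  have hT := G.tangentGroupoid_isGroupoid
  have hY' := src_algebroidFiber_eq_tgt_zero g Y
  have h := pair_mul hG (η := G.tangentGroupoid.one (G.tangentGroupoid.tgt ⟨g, ξ⟩)) (ξ := ⟨g, ξ⟩)
    (η' := ⟨G.one (G.tgt g), Y⟩) (ξ' := ⟨g, 0⟩) rfl rfl (hT.src_one _) hY'
  rw [hT.one_mul, ← rightDeriv_eq_mul g Y, SymplecticForm.pair_zero_right, add_zero] at h
  exact h

/-- Every tangent vector `v` at a product is a product of tangent vectors: choose `ξ` with the
source of `v`; then `v = (v • ξ⁻¹) • ξ`. -/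
theorem exists_eq_tangent_mul {h g : S} (hg : G.src h = G.tgt g)
    (v : TangentSpace 𝓘(ℝ, E) (G.mul h g)) :
    ∃ (η : TangentSpace 𝓘(ℝ, E) h) (ξ : TangentSpace 𝓘(ℝ, E) g),
      G.tangentGroupoid.src ⟨h, η⟩ = G.tangentGroupoid.tgt ⟨g, ξ⟩ ∧
      G.tangentGroupoid.mul ⟨h, η⟩ ⟨g, ξ⟩ = ⟨G.mul h g, v⟩ := by
  have hT := G.tangentGroupoid_isGroupoid
  obtain ⟨K, _, _, hK⟩ := G.src_submersion
  obtain ⟨pr, sec, hs⟩ := (hK g).exists_isLocalSplitting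
  obtain ⟨⟨g', ξ⟩, hg', hξ⟩ := hs.exists_tangentMap_eq (G.tangentGroupoid.src ⟨G.mul h g, v⟩)
    (G.isGroupoid.src_mul h g hg)
  obtain rfl : g' = g := hg'
  obtain ⟨i1, i2, i3, i4⟩ := G.inv_laws_tangent ⟨g', ξ⟩
  set ι := tangentMap 𝓘(ℝ, E) 𝓘(ℝ, E) G.inv ⟨g', ξ⟩
  have hξ' : G.tangentGroupoid.src ⟨g', ξ⟩ = G.tangentGroupoid.src ⟨G.mul h g', v⟩ := hξ
  have hc : G.tangentGroupoid.src ⟨G.mul h g', v⟩ = G.tangentGroupoid.tgt ι := by rw [i2, hξ']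
  have hmul : G.tangentGroupoid.mul (G.tangentGroupoid.mul ⟨G.mul h g', v⟩ ι) ⟨g', ξ⟩
      = ⟨G.mul h g', v⟩ := by
    rw [← hT.assoc _ _ _ hc i1, i3, hξ', hT.mul_one]
  have hsrc : G.tangentGroupoid.src (G.tangentGroupoid.mul ⟨G.mul h g', v⟩ ι)
      = G.tangentGroupoid.tgt ⟨g', ξ⟩ := by rw [hT.src_mul _ _ hc, i1]
  have hb : (G.tangentGroupoid.mul ⟨G.mul h g', v⟩ ι).1 = h := G.mul_mul_inv hg
  generalize G.tangentGroupoid.mul ⟨G.mul h g', v⟩ ι = μ at hmul hsrc hb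
  obtain ⟨y, η⟩ := μ
  obtain rfl : y = h := hb
  exact ⟨η, ξ, hsrc, hmul⟩

/-- The product of covectors is determined by its defining property, since every tangent vector at
`h g` is a product. -/
theorem IsCotangentProduct.unique {Ψ Φ : G.Cotangent} (hc : G.src Ψ.1 = G.tgt Φ.1)
    {Θ Θ' : TangentSpace 𝓘(ℝ, E) (G.mul Ψ.1 Φ.1) →L[ℝ] ℝ}
    (h : G.IsCotangentProduct Ψ Φ Θ) (h' : G.IsCotangentProduct Ψ Φ Θ') : Θ = Θ' := by
  ext v
  obtain ⟨η, ξ, h1, h2⟩ := exists_eq_tangent_mul hc v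
  have h3 := h η ξ h1
  have h4 := h' η ξ h1
  have h5 : (G.tangentGroupoid.mul ⟨Ψ.1, η⟩ ⟨Φ.1, ξ⟩).2 = v := TotalSpace.mk_inj.1 h2
  rw [h5] at h3 h4
  rw [h3, h4]

theorem flatMap_isMorphism (hG : G.IsSymplectic Ω) :
    G.tangentGroupoid.IsMorphism G.cotangentGroupoid (G.flatMap Ω) (G.baseMap Ω) where
  src_map := by
    rintro ⟨g, ξ⟩
    refine Sigma.ext rfl (heq_of_eq (ContinuousLinearMap.ext ?_))
    intro (X : G.algebroidFiber (G.src g))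
    have hY : G.tgtDeriv (G.src g) ((X : TangentSpace 𝓘(ℝ, E) (G.one (G.src g))) -
        G.oneDeriv (G.src g) (G.tgtDeriv (G.src g) X)) = 0 := by
      rw [map_sub, tgtDeriv_oneDeriv, sub_self]
    have h1 := form_leftDeriv hG g ξ _ hY
    have h2 : Ω.form (G.one (G.src g))
        (G.oneDeriv (G.src g) (mfderiv 𝓘(ℝ, E) 𝓘(ℝ, F) G.src g ξ))
        ((X : TangentSpace 𝓘(ℝ, E) (G.one (G.src g))) -
          G.oneDeriv (G.src g) (G.tgtDeriv (G.src g) X))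
        = Ω.form (G.one (G.src g))
        (G.oneDeriv (G.src g) (mfderiv 𝓘(ℝ, E) 𝓘(ℝ, F) G.src g ξ)) X := by
      rw [map_sub, form_oneDeriv hG, sub_zero]
    exact congrArg Neg.neg (h1.trans h2)
  tgt_map := by
    rintro ⟨g, ξ⟩
    refine Sigma.ext rfl (heq_of_eq ?_)
    ext Y
    exact congrArg Neg.neg (form_rightDeriv hG g ξ Y)
  map_one := by
    rintro ⟨m, x⟩
    change (⟨G.one m, Ω.flat (G.one m) (G.oneDeriv m x)⟩ : G.Cotangent) = ⟨G.one m, _⟩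
    congr 1
    ext v
    have h1 : Ω.form (G.one m) (G.oneDeriv m x) (v - G.oneDeriv m (G.srcDeriv m v))
        = Ω.form (G.one m) (G.oneDeriv m x) v := by
      rw [map_sub, form_oneDeriv hG, sub_zero]
    exact congrArg Neg.neg h1.symm
  map_mul := by
    rintro ⟨h, η⟩ ⟨g, ξ⟩ hηξ
    have hhg : G.src h = G.tgt g := congrArg TotalSpace.proj hηξ
    have hprod : G.IsCotangentProduct (G.flatMap Ω ⟨h, η⟩) (G.flatMap Ω ⟨g, ξ⟩)
        (Ω.flat (G.mul h g) (G.tangentGroupoid.mul ⟨h, η⟩ ⟨g, ξ⟩).2) := by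
      intro η' ξ' hc
      have h1 := pair_mul hG (η := ⟨h, η⟩) (ξ := ⟨g, ξ⟩) (η' := ⟨h, η'⟩) (ξ' := ⟨g, ξ'⟩)
        rfl rfl hηξ hc
      have h2 := congrArg Neg.neg h1
      rw [neg_add] at h2
      exact h2
    have hex : ∃ Θ, G.IsCotangentProduct (G.flatMap Ω ⟨h, η⟩) (G.flatMap Ω ⟨g, ξ⟩) Θ := ⟨_, hprod⟩
    have h3 : G.cotangentGroupoid.mul (G.flatMap Ω ⟨h, η⟩) (G.flatMap Ω ⟨g, ξ⟩)
        = ⟨G.mul h g, hex.choose⟩ := by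
      exact congrArg (TotalSpace.mk (G.mul h g)) (dif_pos hex)
    rw [h3, IsCotangentProduct.unique hhg hex.choose_spec hprod]
    rfl

variable [FiniteDimensional ℝ F]

theorem finrank_algebroidFiber (hG : G.IsSymplectic Ω) (m : P) :
    Module.finrank ℝ (G.algebroidFiber m) = Module.finrank ℝ F := by
  let A : E →ₗ[ℝ] F := (G.srcDeriv m).toLinearMap
  have hA : Function.Surjective A := fun x => ⟨G.oneDeriv m x, G.srcDeriv_oneDeriv m x⟩
  have h1 := LinearMap.finrank_range_add_finrank_ker A
  rw [LinearMap.range_eq_top.2 hA, finrank_top] at h1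
  have h2 := finrank_eq_two_mul hG (G.one m)
  have h3 : Module.finrank ℝ (G.algebroidFiber m) = Module.finrank ℝ (LinearMap.ker A) := rfl
  omega

theorem baseMap_bijective (hG : G.IsSymplectic Ω) : Function.Bijective (G.baseMap Ω) := by
  have hinj : ∀ (m : P) (x : TangentSpace 𝓘(ℝ, F) m),
      (∀ X : G.algebroidFiber m, Ω.form (G.one m) (G.oneDeriv m x) X = 0) → x = 0 := by
    intro m x hx
    have h := eq_zero_of_form_unit m (G.oneDeriv m x) (form_oneDeriv hG m x) hx
    rw [← G.srcDeriv_oneDeriv m x, h, map_zero]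
  constructor
  · rintro ⟨m, x⟩ ⟨m', x'⟩ h
    obtain rfl : m = m' := congrArg Sigma.fst h
    have h1 : (Ω.flat (G.one m) (G.oneDeriv m x)).comp (G.algebroidFiber m).subtypeL
        = (Ω.flat (G.one m) (G.oneDeriv m x')).comp (G.algebroidFiber m).subtypeL :=
      eq_of_heq (Sigma.mk.inj h).2
    have h2 : x - x' = 0 := by
      refine hinj m _ fun X => ?_
      have h3 : -Ω.form (G.one m) (G.oneDeriv m x) X = -Ω.form (G.one m) (G.oneDeriv m x') X :=
        DFunLike.congr_fun h1 X
      rw [map_sub, map_sub, _root_.sub_apply]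
      linarith
    rw [sub_eq_zero.1 h2]
  · rintro ⟨m, φ⟩
    let w : F →ₗ[ℝ] Module.Dual ℝ (G.algebroidFiber m) :=
      { toFun := fun x => ((Ω.flat (G.one m) (G.oneDeriv m x)).comp
          (G.algebroidFiber m).subtypeL).toLinearMap
        map_add' := fun x y => by
          ext X
          change Ω.flat (G.one m) (G.oneDeriv m (x + y)) X = Ω.flat (G.one m) (G.oneDeriv m x) X
            + Ω.flat (G.one m) (G.oneDeriv m y) X
          have : G.oneDeriv m (x + y) = G.oneDeriv m x + G.oneDeriv m y :=
            map_add (G.oneDeriv m) _ _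
          rw [this, map_add]; rfl
        map_smul' := fun c x => by
          ext X
          change Ω.flat (G.one m) (G.oneDeriv m (c • x)) X = c • Ω.flat (G.one m) (G.oneDeriv m x) X
          have : G.oneDeriv m (c • x) = c • G.oneDeriv m x := map_smul (G.oneDeriv m) _ _
          rw [this, map_smul]; rfl }
    have hw : Function.Injective w := by
      rw [injective_iff_map_eq_zero]
      intro x hx
      refine hinj m x fun X => ?_
      have : -Ω.form (G.one m) (G.oneDeriv m x) X = 0 := DFunLike.congr_fun hx X
      linarith
    have : FiniteDimensional ℝ (TangentSpace 𝓘(ℝ, E) (G.one m)) :=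
      inferInstanceAs (FiniteDimensional ℝ E)
    have hdim : Module.finrank ℝ F = Module.finrank ℝ (Module.Dual ℝ (G.algebroidFiber m)) := by
      rw [Subspace.dual_finrank_eq, finrank_algebroidFiber hG]
    obtain ⟨x, hx⟩ := (LinearMap.injective_iff_surjective_of_finrank_eq_finrank hdim).1 hw
      φ.toLinearMap
    refine ⟨⟨m, x⟩, Sigma.ext rfl (heq_of_eq ?_)⟩
    ext X
    exact DFunLike.congr_fun hx X

theorem cotangentGroupoid_isGroupoid (hG : G.IsSymplectic Ω) :
    G.cotangentGroupoid.IsGroupoid :=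
  G.tangentGroupoid_isGroupoid.transfer (flatMap_isMorphism hG) flatMap_bijective
    (baseMap_bijective hG)

end LieGroupoid

/-! ### Inverting smooth fields of linear maps -/

section BundleInverse

variable {B F₁ F₂ N : Type*}
  {E₁ : B → Type*} [∀ x, AddCommGroup (E₁ x)] [∀ x, Module ℝ (E₁ x)]
  [NormedAddCommGroup F₁] [NormedSpace ℝ F₁]
  [TopologicalSpace (TotalSpace F₁ E₁)] [∀ x, TopologicalSpace (E₁ x)]
  {E₂ : B → Type*} [∀ x, AddCommGroup (E₂ x)] [∀ x, Module ℝ (E₂ x)]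
  [NormedAddCommGroup F₂] [NormedSpace ℝ F₂]
  [TopologicalSpace (TotalSpace F₂ E₂)] [∀ x, TopologicalSpace (E₂ x)]
  {EB HB : Type*} [NormedAddCommGroup EB] [NormedSpace ℝ EB] [TopologicalSpace HB]
  {IB : ModelWithCorners ℝ EB HB} [TopologicalSpace B] [ChartedSpace HB B]
  {EN HN : Type*} [NormedAddCommGroup EN] [NormedSpace ℝ EN] [TopologicalSpace HN]
  {IN : ModelWithCorners ℝ EN HN} [TopologicalSpace N] [ChartedSpace HN N]
  [FiberBundle F₁ E₁] [VectorBundle ℝ F₁ E₁] [FiberBundle F₂ E₂] [VectorBundle ℝ F₂ E₂]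
  [∀ x, IsTopologicalAddGroup (E₂ x)] [∀ x, ContinuousSMul ℝ (E₂ x)]

/-- If `A(v)` is a smooth section, for a smooth field `A` of linear maps between vector bundles of
the same finite rank that is injective at the point considered, then `v` is a smooth section there:
in coordinates, `v = A⁻¹(A(v))`, and inversion of linear maps is smooth. -/
theorem ContMDiffAt.of_clm_bundle_apply [FiniteDimensional ℝ F₁] [FiniteDimensional ℝ F₂]
    (hd : Module.finrank ℝ F₁ = Module.finrank ℝ F₂) {b : N → B}
    {A : ∀ y, E₁ (b y) →L[ℝ] E₂ (b y)} {v : ∀ y, E₁ (b y)} {y₀ : N}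
    (hA : ContMDiffAt IN (IB.prod 𝓘(ℝ, F₁ →L[ℝ] F₂)) ∞ (fun y => TotalSpace.mk' (F₁ →L[ℝ] F₂)
      (E := fun x => E₁ x →L[ℝ] E₂ x) (b y) (A y)) y₀)
    (hp : ContMDiffAt IN (IB.prod 𝓘(ℝ, F₂)) ∞
      (fun y => TotalSpace.mk' F₂ (E := E₂) (b y) (A y (v y))) y₀)
    (hinj : Function.Injective (A y₀)) :
    ContMDiffAt IN (IB.prod 𝓘(ℝ, F₁)) ∞ (fun y => TotalSpace.mk' F₁ (E := E₁) (b y) (v y)) y₀ := by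
  rw [contMDiffAt_hom_bundle] at hA
  rw [contMDiffAt_totalSpace] at hp ⊢
  obtain ⟨hb, hA⟩ := hA
  change ContMDiffAt IN IB ∞ b y₀ at hb
  obtain ⟨-, hp⟩ := hp
  refine ⟨hb, ?_⟩
  set t₁ := trivializationAt F₁ E₁ (b y₀)
  set t₂ := trivializationAt F₂ E₂ (b y₀)
  have hev : ∀ᶠ y in 𝓝 y₀, b y ∈ t₁.baseSet ∧ b y ∈ t₂.baseSet := by
    have hn : ∀ᶠ x in 𝓝 (b y₀), x ∈ t₁.baseSet ∧ x ∈ t₂.baseSet :=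
      Filter.inter_mem (t₁.open_baseSet.mem_nhds (mem_baseSet_trivializationAt F₁ E₁ (b y₀)))
        (t₂.open_baseSet.mem_nhds (mem_baseSet_trivializationAt F₂ E₂ (b y₀)))
    exact hb.continuousAt.eventually hn
  let C : N → F₁ →L[ℝ] F₂ := fun y =>
    ContinuousLinearMap.inCoordinates F₁ E₁ F₂ E₂ (b y₀) (b y) (b y₀) (b y) (A y)
  have hC : ∀ y, C y = (t₂.continuousLinearMapAt ℝ (b y) ∘L A y) ∘L t₁.symmL ℝ (b y) := fun y => rfl
  have hCinj : Function.Injective (C y₀) := by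
    have h1 := mem_baseSet_trivializationAt F₁ E₁ (b y₀)
    have h2 := mem_baseSet_trivializationAt F₂ E₂ (b y₀)
    rw [hC]
    have e1 : Function.Injective (t₁.symmL ℝ (b y₀)) :=
      Function.LeftInverse.injective (t₁.continuousLinearMapAt_symmL h1)
    have e2 : Function.Injective (t₂.continuousLinearMapAt ℝ (b y₀)) :=
      Function.LeftInverse.injective (t₂.symmL_continuousLinearMapAt h2)
    exact e2.comp (hinj.comp e1)
  let Ceq : F₁ ≃L[ℝ] F₂ :=
    (LinearEquiv.ofInjectiveOfFinrankEq (C y₀).toLinearMap hCinj hd).toContinuousLinearEquiv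
  have hCeq : (Ceq : F₁ →L[ℝ] F₂) = C y₀ := by
    ext x; rfl
  have : CompleteSpace F₁ := FiniteDimensional.complete ℝ F₁
  have hinv : ContMDiffAt IN 𝓘(ℝ, F₂ →L[ℝ] F₁) ∞ (fun y => (C y).inverse) y₀ := by
    have h := contDiffAt_map_inverse (𝕜 := ℝ) (n := ∞) Ceq
    rw [hCeq] at h
    exact ContMDiffAt.comp (g := ContinuousLinearMap.inverse) y₀ h.contMDiffAt hA
  refine (hinv.clm_apply hp).congr_of_eventuallyEq ?_
  have hCinv : ∀ᶠ y in 𝓝 y₀, (C y).IsInvertible := by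
    have h := ContinuousLinearEquiv.nhds Ceq
    rw [hCeq] at h
    exact hA.continuousAt.eventually h
  filter_upwards [hev, hCinv] with y ⟨h1, h2⟩ hy
  have h3 : C y (t₁.continuousLinearMapAt ℝ (b y) (v y)) =
      t₂.continuousLinearMapAt ℝ (b y) (A y (v y)) := by
    rw [hC]
    change t₂.continuousLinearMapAt ℝ (b y) (A y (t₁.symmL ℝ (b y)
      (t₁.continuousLinearMapAt ℝ (b y) (v y)))) = _
    rw [t₁.symmL_continuousLinearMapAt h1]
  have e1 : (t₁ (TotalSpace.mk' F₁ (b y) (v y))).2 = t₁.continuousLinearMapAt ℝ (b y) (v y) :=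
    (t₁.continuousLinearMapAt_apply_of_mem ℝ h1 (v y)).symm
  have e2 : (t₂ (TotalSpace.mk' F₂ (b y) (A y (v y)))).2
      = t₂.continuousLinearMapAt ℝ (b y) (A y (v y)) :=
    (t₂.continuousLinearMapAt_apply_of_mem ℝ h2 _).symm
  rw [e1, e2, ← h3]
  obtain ⟨e, he⟩ := hy
  rw [← he]
  simp

end BundleInverse

/-! ### Smooth 1-forms and vector fields -/

section Forms

variable {E M : Type*} [NormedAddCommGroup E] [NormedSpace ℝ E] [TopologicalSpace M]
  [ChartedSpace E M] [IsManifold 𝓘(ℝ, E) ∞ M]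
  {E' N : Type*} [NormedAddCommGroup E'] [NormedSpace ℝ E'] [TopologicalSpace N]
  [ChartedSpace E' N]

theorem SymplecticForm.contMDiffAt_sharp [FiniteDimensional ℝ E] (Ω : SymplecticForm 𝓘(ℝ, E) M)
    {b : N → M} {φ : ∀ y, TangentSpace 𝓘(ℝ, E) (b y) →L[ℝ] ℝ} {y : N}
    (hφ : ContMDiffAt 𝓘(ℝ, E') (𝓘(ℝ, E).prod 𝓘(ℝ, E →L[ℝ] ℝ)) ∞
      (fun y => TotalSpace.mk' (E →L[ℝ] ℝ)
      (E := fun x : M => TangentSpace 𝓘(ℝ, E) x →L[ℝ] ℝ) (b y) (φ y)) y) :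
    ContMDiffAt 𝓘(ℝ, E') 𝓘(ℝ, E).tangent ∞
      (fun y => (⟨b y, Ω.sharp (b y) (φ y)⟩ : TangentBundle 𝓘(ℝ, E) M)) y := by
  have hb : ContMDiffAt 𝓘(ℝ, E') 𝓘(ℝ, E) ∞ b y := (contMDiffAt_totalSpace.1 hφ).1
  have hneg : ContMDiff 𝓘(ℝ, E) (𝓘(ℝ, E).prod 𝓘(ℝ, E →L[ℝ] E →L[ℝ] ℝ)) ∞
    (fun x => TotalSpace.mk' (E →L[ℝ] E →L[ℝ] ℝ)
      (E := fun x : M => TangentSpace 𝓘(ℝ, E) x →L[ℝ] TangentSpace 𝓘(ℝ, E) x →L[ℝ] ℝ) x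
      (-Ω.form x)) :=
    haveI : ∀ x : M, ContinuousAdd (TangentSpace 𝓘(ℝ, E) x →L[ℝ] ℝ) :=
      fun _ => inferInstanceAs (ContinuousAdd (E →L[ℝ] ℝ))
    Ω.smooth.neg_section
  have hflat : ∀ y, Ω.flat (b y) (Ω.sharp (b y) (φ y)) = φ y := fun y =>
    (Ω.sharp (b y)).symm_apply_apply (φ y)
  refine ContMDiffAt.of_clm_bundle_apply (F₁ := E) (E₁ := fun x : M => TangentSpace 𝓘(ℝ, E) x)
    (F₂ := E →L[ℝ] ℝ) (E₂ := fun x : M => TangentSpace 𝓘(ℝ, E) x →L[ℝ] ℝ) ?_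
    (A := fun y => -Ω.form (b y)) (hneg.contMDiffAt.comp y hb) ?_ (Ω.flat_injective (b y))
  · rw [← (LinearMap.toContinuousLinearMap (𝕜 := ℝ) (E := E) (F' := ℝ)).finrank_eq]
    exact Subspace.dual_finrank_eq.symm
  · refine hφ.congr_of_eventuallyEq (.of_forall fun y => ?_)
    exact congrArg (TotalSpace.mk' _ _) (hflat y)


variable [IsManifold 𝓘(ℝ, E') ∞ N]

/-- The pullback of a smooth field of covectors along `f` is a smooth 1-form. -/
theorem contMDiffAt_oneForm_comp_mfderiv {f : N → M}
    {φ : ∀ y, TangentSpace 𝓘(ℝ, E) (f y) →L[ℝ] ℝ} {y₀ : N}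
    (hφ : ContMDiffAt 𝓘(ℝ, E') (𝓘(ℝ, E).prod 𝓘(ℝ, E →L[ℝ] ℝ)) ∞
      (fun y => TotalSpace.mk' (E →L[ℝ] ℝ)
      (E := fun x : M => TangentSpace 𝓘(ℝ, E) x →L[ℝ] ℝ) (f y) (φ y)) y₀) :
    ContMDiffAt 𝓘(ℝ, E') (𝓘(ℝ, E').prod 𝓘(ℝ, E' →L[ℝ] ℝ)) ∞
      (fun y => TotalSpace.mk' (E' →L[ℝ] ℝ)
      (E := fun x : N => TangentSpace 𝓘(ℝ, E') x →L[ℝ] ℝ) y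
      ((φ y).comp (mfderiv 𝓘(ℝ, E') 𝓘(ℝ, E) f y))) y₀ := by
  have h1 : IsManifold 𝓘(ℝ, E) 1 M := .of_le (n := ∞) (by simp)
  have h2 : IsManifold 𝓘(ℝ, E') 1 N := .of_le (n := ∞) (by simp)
  rw [contMDiffAt_hom_bundle] at hφ ⊢
  obtain ⟨hf, hφ⟩ := hφ
  change ContMDiffAt _ _ _ f y₀ at hf
  refine ⟨contMDiffAt_id, ?_⟩
  have hd := hf.mfderiv_const (m := ∞) (by simp)
  refine (hφ.clm_comp hd).congr_of_eventuallyEq ?_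
  set t := trivializationAt E (TangentSpace 𝓘(ℝ, E)) (f y₀)
  filter_upwards [hf.continuousAt.eventually
    (t.open_baseSet.mem_nhds
      (mem_baseSet_trivializationAt E (TangentSpace 𝓘(ℝ, E)) (f y₀)))] with y hy
  ext w
  set t' := trivializationAt E' (TangentSpace 𝓘(ℝ, E')) y₀
  set v := mfderiv 𝓘(ℝ, E') 𝓘(ℝ, E) f y (t'.symmL ℝ y w)
  have h3 : φ y v = φ y (t.symmL ℝ (f y) (t.continuousLinearMapAt ℝ (f y) v)) := by
    rw [t.symmL_continuousLinearMapAt hy]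
  have e1 : ∀ c : ℝ,
      (trivializationAt ℝ (Bundle.Trivial N ℝ) y₀).continuousLinearMapAt ℝ y c = c := by
    simp
  have e2 : ∀ c : ℝ,
      (trivializationAt ℝ (Bundle.Trivial M ℝ) (f y₀)).continuousLinearMapAt ℝ (f y) c = c := by
    simp
  exact (e1 _).trans (h3.trans (e2 _).symm)

theorem isSmoothOneForm_dfun {f : M → ℝ} (hf : ContMDiff 𝓘(ℝ, E) 𝓘(ℝ, ℝ) ∞ f) :
    IsSmoothOneForm 𝓘(ℝ, E) (dfun 𝓘(ℝ, E) f) := by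
  intro x
  have h1 : IsManifold 𝓘(ℝ, E) 1 M := .of_le (n := ∞) (by simp)
  rw [contMDiffAt_hom_bundle]
  refine ⟨contMDiffAt_id, ?_⟩
  have hd := hf.contMDiffAt (x := x) |>.mfderiv_const (m := ∞) (by simp)
  refine hd.congr_of_eventuallyEq (.of_forall fun y => ?_)
  ext w
  simp [inTangentCoordinates, ContinuousLinearMap.inCoordinates, dfun]
  rfl

theorem contMDiff_oneForm_apply {φ : ∀ x : M, TangentSpace 𝓘(ℝ, E) x →L[ℝ] ℝ}
    (hφ : IsSmoothOneForm 𝓘(ℝ, E) φ) {X : ∀ x : M, TangentSpace 𝓘(ℝ, E) x}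
    (hX : IsSmoothVectorField 𝓘(ℝ, E) X) : ContMDiff 𝓘(ℝ, E) 𝓘(ℝ, ℝ) ∞ (fun x => φ x (X x)) :=
  fun x => contMDiffAt_oneForm_apply (b := id) (hφ x) (hX x)

theorem contMDiff_dfun_apply {f : M → ℝ} (hf : ContMDiff 𝓘(ℝ, E) 𝓘(ℝ, ℝ) ∞ f)
    {X : ∀ x : M, TangentSpace 𝓘(ℝ, E) x} (hX : IsSmoothVectorField 𝓘(ℝ, E) X) :
    ContMDiff 𝓘(ℝ, E) 𝓘(ℝ, ℝ) ∞ (fun x => dfun 𝓘(ℝ, E) f x (X x)) :=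
  contMDiff_oneForm_apply (isSmoothOneForm_dfun hf) hX

theorem isManifold_minSmoothness (k : ℕ) : IsManifold 𝓘(ℝ, E) (minSmoothness ℝ k) M :=
  .of_le (n := ∞) (by
    rw [minSmoothness_of_isRCLikeNormedField]
    exact WithTop.coe_le_coe.2 (le_top : (k : ℕ∞) ≤ ⊤))

theorem IsSmoothVectorField.mlieBracket [CompleteSpace E] {X Y : ∀ x : M, TangentSpace 𝓘(ℝ, E) x}
    (hX : IsSmoothVectorField 𝓘(ℝ, E) X) (hY : IsSmoothVectorField 𝓘(ℝ, E) Y) :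
    IsSmoothVectorField 𝓘(ℝ, E) (VectorField.mlieBracket 𝓘(ℝ, E) X Y) := by
  have h1 : IsManifold 𝓘(ℝ, E) (minSmoothness ℝ 2) M := isManifold_minSmoothness 2
  have h2 : IsManifold 𝓘(ℝ, E) ((⊤ : ℕ∞) + 1) M := inferInstanceAs (IsManifold 𝓘(ℝ, E) ∞ M)
  exact ContDiff.mlieBracket_vectorField (m := ⊤) (n := ⊤) hX hY
    (by rw [minSmoothness_of_isRCLikeNormedField]; rfl)

end Forms

/-! ### The Lie bracket as a commutator of derivations -/

section Bracket

variable {E M : Type*} [NormedAddCommGroup E] [NormedSpace ℝ E] [TopologicalSpace M]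
  [ChartedSpace E M]

theorem mdifferentiableAt_of_contMDiff_real {f : M → ℝ} (hf : ContMDiff 𝓘(ℝ, E) 𝓘(ℝ, ℝ) ∞ f)
    (x : M) :
    MDifferentiableAt 𝓘(ℝ, E) 𝓘(ℝ, ℝ) f x :=
  hf.contMDiffAt.mdifferentiableAt (by simp)

variable [IsManifold 𝓘(ℝ, E) ∞ M]

/-- The derivative of a function along a vector field, read in the chart at `x₀`. -/
theorem dfun_apply_eq_fderiv {g : M → ℝ} (V : ∀ x : M, TangentSpace 𝓘(ℝ, E) x) (x₀ : M) {u : E}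
    (hu : u ∈ (extChartAt 𝓘(ℝ, E) x₀).target)
    (hg : MDifferentiableAt 𝓘(ℝ, E) 𝓘(ℝ, ℝ) g ((extChartAt 𝓘(ℝ, E) x₀).symm u)) :
    dfun 𝓘(ℝ, E) g ((extChartAt 𝓘(ℝ, E) x₀).symm u) (V ((extChartAt 𝓘(ℝ, E) x₀).symm u)) =
      fderiv ℝ (g ∘ (extChartAt 𝓘(ℝ, E) x₀).symm) u
        (VectorField.mpullbackWithin 𝓘(ℝ, E) 𝓘(ℝ, E) (extChartAt 𝓘(ℝ, E) x₀).symm V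
          (Set.range 𝓘(ℝ, E)) u) := by
  have h1 : IsManifold 𝓘(ℝ, E) 1 M := .of_le (n := ∞) (by simp)
  set e := extChartAt 𝓘(ℝ, E) x₀ with he
  have hinv := isInvertible_mfderivWithin_extChartAt_symm (I := 𝓘(ℝ, E)) hu
  have hd : MDifferentiableAt 𝓘(ℝ, E) 𝓘(ℝ, E) e.symm u := by
    have := mdifferentiableWithinAt_extChartAt_symm (I := 𝓘(ℝ, E)) hu
    rwa [ModelWithCorners.range_eq_univ, mdifferentiableWithinAt_univ] at this
  have hc := mfderiv_comp u hg hd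
  rw [VectorField.mpullbackWithin_apply]
  obtain ⟨D, hD⟩ := hinv
  rw [← he] at hD
  have hD' : mfderiv 𝓘(ℝ, E) 𝓘(ℝ, E) e.symm u = D := by
    rw [hD, ModelWithCorners.range_eq_univ, mfderivWithin_univ]
  rw [← mfderiv_eq_fderiv, hc, ← hD, hD', ContinuousLinearMap.inverse_equiv]
  exact congrArg (mfderiv 𝓘(ℝ, E) 𝓘(ℝ, ℝ) g (e.symm u)) (D.apply_symm_apply _).symm

/-- The Lie bracket of vector fields is the commutator of the derivations that they define. -/
theorem dfun_mlieBracket [CompleteSpace E] {f : M → ℝ} (hf : ContMDiff 𝓘(ℝ, E) 𝓘(ℝ, ℝ) ∞ f)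
    {X Y : ∀ x : M, TangentSpace 𝓘(ℝ, E) x} (hX : IsSmoothVectorField 𝓘(ℝ, E) X)
    (hY : IsSmoothVectorField 𝓘(ℝ, E) Y) (x : M) :
    dfun 𝓘(ℝ, E) f x (VectorField.mlieBracket 𝓘(ℝ, E) X Y x) =
      dfun 𝓘(ℝ, E) (fun y => dfun 𝓘(ℝ, E) f y (Y y)) x (X x)
        - dfun 𝓘(ℝ, E) (fun y => dfun 𝓘(ℝ, E) f y (X y)) x (Y x) := by
  have h1 : IsManifold 𝓘(ℝ, E) 1 M := .of_le (n := ∞) (by simp)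
  have hle : (2 : WithTop ℕ∞) ≤ ∞ := WithTop.coe_le_coe.2 (le_top : (2 : ℕ∞) ≤ ⊤)
  have h2 : IsManifold 𝓘(ℝ, E) 2 M := .of_le (n := ∞) hle
  set e := extChartAt 𝓘(ℝ, E) x with he
  have hx : e x ∈ e.target := mem_extChartAt_target x
  have hsx : e.symm (e x) = x := extChartAt_to_inv x
  have htar : e.target ∈ 𝓝 (e x) := extChartAt_target_mem_nhds x
  -- `F`, `v`, `w` are the coordinate expressions of `f`, `X`, `Y`.
  set F := f ∘ e.symm with hF
  have hFc : ContDiffAt ℝ 2 F (e x) := by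
    have : ContMDiffOn 𝓘(ℝ, E) 𝓘(ℝ, ℝ) ∞ F e.target :=
      hf.comp_contMDiffOn (contMDiffOn_extChartAt_symm x)
    exact ((this.contMDiffAt htar).contDiffAt).of_le hle
  have key : ∀ V : (∀ y : M, TangentSpace 𝓘(ℝ, E) y), IsSmoothVectorField 𝓘(ℝ, E) V →
      ∃ v : E → E, v = VectorField.mpullbackWithin 𝓘(ℝ, E) 𝓘(ℝ, E) e.symm V (Set.range 𝓘(ℝ, E)) ∧
        DifferentiableAt ℝ v (e x) ∧ ∀ g : M → ℝ, ContMDiff 𝓘(ℝ, E) 𝓘(ℝ, ℝ) ∞ g →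
          ∀ u ∈ e.target, dfun 𝓘(ℝ, E) g (e.symm u) (V (e.symm u))
            = fderiv ℝ (g ∘ e.symm) u (v u) := by
    intro V hV
    refine ⟨_, rfl, ?_, fun g hg u hu =>
      dfun_apply_eq_fderiv V x hu (mdifferentiableAt_of_contMDiff_real hg _)⟩
    have h := VectorField.contMDiffWithinAt_mpullbackWithin_extChartAt_symm (I := 𝓘(ℝ, E)) (n := 2)
      (m := 1) (V := V) (x := x) (s := Set.univ) ((hV x).of_le (by simp)).contMDiffWithinAt
      uniqueMDiffOn_univ (Set.mem_univ _) one_add_one_eq_two.le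
    rw [contMDiffWithinAt_vectorSpace_iff_contDiffWithinAt] at h
    have h4 := h.contDiffAt (Filter.inter_mem htar Filter.univ_mem)
    exact h4.differentiableAt (by simp)
  obtain ⟨v, hv, hvd, hv'⟩ := key X hX
  obtain ⟨w, hw, hwd, hw'⟩ := key Y hY
  have hsec : ∀ (V W : ∀ y : M, TangentSpace 𝓘(ℝ, E) y) (a b : E → E),
      IsSmoothVectorField 𝓘(ℝ, E) W → DifferentiableAt ℝ b (e x) →
      (∀ g : M → ℝ, ContMDiff 𝓘(ℝ, E) 𝓘(ℝ, ℝ) ∞ g → ∀ u ∈ e.target,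
        dfun 𝓘(ℝ, E) g (e.symm u) (V (e.symm u)) = fderiv ℝ (g ∘ e.symm) u (a u)) →
      (∀ g : M → ℝ, ContMDiff 𝓘(ℝ, E) 𝓘(ℝ, ℝ) ∞ g → ∀ u ∈ e.target,
        dfun 𝓘(ℝ, E) g (e.symm u) (W (e.symm u)) = fderiv ℝ (g ∘ e.symm) u (b u)) →
      dfun 𝓘(ℝ, E) (fun y => dfun 𝓘(ℝ, E) f y (W y)) x (V x) =
        fderiv ℝ (fderiv ℝ F) (e x) (a (e x)) (b (e x)) + fderiv ℝ F (e x)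
          (fderiv ℝ b (e x) (a (e x))) := by
    intro V W a b hW hb ha' hb'
    have h5 := ha' _ (contMDiff_dfun_apply hf hW) (e x) hx
    rw [hsx] at h5
    rw [h5]
    have h6 : ((fun y => dfun 𝓘(ℝ, E) f y (W y)) ∘ e.symm) =ᶠ[𝓝 (e x)]
        fun u => fderiv ℝ F u (b u) := by
      filter_upwards [htar] with u hu
      exact hb' f hf u hu
    have hdF : DifferentiableAt ℝ (fderiv ℝ F) (e x) :=
      (hFc.fderiv_right (m := 1) (by norm_num)).differentiableAt (by simp)
    rw [h6.fderiv_eq, fderiv_clm_apply hdF hb]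
    simp [add_comm]
  rw [hsec X Y v w hY hwd hv' hw', hsec Y X w v hX hvd hw' hv']
  have hsymm : fderiv ℝ (fderiv ℝ F) (e x) (v (e x)) (w (e x))
      = fderiv ℝ (fderiv ℝ F) (e x) (w (e x)) (v (e x)) :=
    (hFc.isSymmSndFDerivAt (by simp)).eq _ _
  have hbr : dfun 𝓘(ℝ, E) f x (VectorField.mlieBracket 𝓘(ℝ, E) X Y x) =
      fderiv ℝ F (e x) (fderiv ℝ w (e x) (v (e x)) - fderiv ℝ v (e x) (w (e x))) := by
    rw [← VectorField.mlieBracketWithin_univ, VectorField.mlieBracketWithin_apply, ← he, ← hv, ← hw]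
    have hu : (e.symm ⁻¹' Set.univ ∩ Set.range 𝓘(ℝ, E)) = Set.univ := by simp
    rw [hu, VectorField.lieBracketWithin_univ, VectorField.lieBracket]
    obtain ⟨D, hD⟩ := isInvertible_mfderiv_extChartAt (I := 𝓘(ℝ, E)) (mem_extChartAt_source x)
    have h7 : f =ᶠ[𝓝 x] F ∘ e := by
      filter_upwards [extChartAt_source_mem_nhds (I := 𝓘(ℝ, E)) x] with y hy
      simp only [hF, Function.comp]
      rw [(extChartAt 𝓘(ℝ, E) x).left_inv hy]
    have h8 : mfderiv 𝓘(ℝ, E) 𝓘(ℝ, ℝ) f x =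
        (fderiv ℝ F (e x)).comp (mfderiv 𝓘(ℝ, E) 𝓘(ℝ, E) e x) := by
      rw [h7.mfderiv_eq, mfderiv_comp x (I' := 𝓘(ℝ, E))
        (hFc.differentiableAt (by simp)).mdifferentiableAt
        (mdifferentiableAt_extChartAt (mem_chart_source E x)), mfderiv_eq_fderiv]
      rfl
    rw [dfun, h8, ← hD, ContinuousLinearMap.inverse_equiv]
    exact congrArg (fderiv ℝ F (e x)) (D.apply_symm_apply _)
  rw [hbr, hsymm, map_sub]
  ring

end Bracket

/-! ### Global sections with prescribed germs -/

section Extension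

variable {E M : Type*} [NormedAddCommGroup E] [NormedSpace ℝ E] [FiniteDimensional ℝ E]
  [TopologicalSpace M] [T2Space M] [ChartedSpace E M] [IsManifold 𝓘(ℝ, E) ∞ M]

section Sections

variable {F : Type*} [NormedAddCommGroup F] [NormedSpace ℝ F]
  {V : M → Type*} [TopologicalSpace (TotalSpace F V)] [∀ x, AddCommGroup (V x)]
  [∀ x, Module ℝ (V x)] [∀ x, TopologicalSpace (V x)] [FiberBundle F V] [VectorBundle ℝ F V]

/-- The germ of a smooth section is the germ of a global smooth section. -/
theorem exists_contMDiff_section_eventuallyEq {s : ∀ x, V x} {x : M}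
    (hs : ∀ᶠ y in 𝓝 x, ContMDiffAt 𝓘(ℝ, E) (𝓘(ℝ, E).prod 𝓘(ℝ, F)) ∞
      (fun y => TotalSpace.mk' F y (s y)) y) :
    ∃ s' : ∀ x, V x, ContMDiff 𝓘(ℝ, E) (𝓘(ℝ, E).prod 𝓘(ℝ, F)) ∞
      (fun y => TotalSpace.mk' F y (s' y)) ∧ ∀ᶠ y in 𝓝 x, s' y = s y := by
  obtain ⟨U, hU, hUo, hxU⟩ := eventually_nhds_iff.1 hs
  obtain ⟨f, hf, -⟩ := (SmoothBumpFunction.nhds_basis_support (I := 𝓘(ℝ, E))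
    (hUo.mem_nhds hxU)).mem_iff.1 (hUo.mem_nhds hxU)
  refine ⟨(f : M → ℝ) • s, ?_, ?_⟩
  · exact ContMDiffOn.smul_section_of_tsupport f.contMDiff.contMDiffOn hUo hf
      (fun y hy => (hU y hy).contMDiffWithinAt)
  · filter_upwards [f.eventuallyEq_one] with y hy
    simp [hy]

theorem exists_contMDiff_section_eq [ContMDiffVectorBundle ∞ F V 𝓘(ℝ, E)] {x : M} (v : V x) :
    ∃ s : ∀ x, V x, ContMDiff 𝓘(ℝ, E) (𝓘(ℝ, E).prod 𝓘(ℝ, F)) ∞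
      (fun y => TotalSpace.mk' F y (s y)) ∧ s x = v := by
  obtain ⟨t, ht, hs⟩ := FiberBundle.exists_contMDiffOn_extend 𝓘(ℝ, E) F (k := ∞) v
  obtain ⟨s', h1, h2⟩ := exists_contMDiff_section_eventuallyEq (s := FiberBundle.extend F v)
    (x := x) ((eventually_mem_nhds_iff.2 ht).mono fun y hy => hs.contMDiffAt hy)
  exact ⟨s', h1, by rw [h2.self_of_nhds, FiberBundle.extend_apply_self]⟩

/-- Near each point a vector bundle has a frame of global smooth sections. -/
theorem exists_contMDiff_frame [FiniteDimensional ℝ F] [ContMDiffVectorBundle ∞ F V 𝓘(ℝ, E)]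
    (x : M) : ∃ (s : Fin (Module.finrank ℝ F) → ∀ x, V x) (U : Set M), IsOpen U ∧ x ∈ U ∧
      (∀ i, ContMDiff 𝓘(ℝ, E) (𝓘(ℝ, E).prod 𝓘(ℝ, F)) ∞ (fun y => TotalSpace.mk' F y (s i y))) ∧
      (∀ y ∈ U, LinearIndependent ℝ (fun i => s i y) ∧
        Submodule.span ℝ (Set.range fun i => s i y) = ⊤) ∧
      ∀ X : ∀ x, V x, ContMDiff 𝓘(ℝ, E) (𝓘(ℝ, E).prod 𝓘(ℝ, F)) ∞
          (fun y => TotalSpace.mk' F y (X y)) →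
        ∃ c : Fin (Module.finrank ℝ F) → M → ℝ,
          (∀ i, ContMDiffOn 𝓘(ℝ, E) 𝓘(ℝ, ℝ) ∞ (c i) U) ∧
          ∀ y ∈ U, X y = ∑ i, c i y • s i y := by
  have h1 : ContMDiffVectorBundle 1 F V 𝓘(ℝ, E) := .of_le (n := ∞) (by simp)
  set t := trivializationAt F V x
  let b := Module.finBasis ℝ F
  have hxt : x ∈ t.baseSet := FiberBundle.mem_baseSet_trivializationAt' x
  have hfr := t.isLocalFrameOn_localFrame_baseSet 𝓘(ℝ, E) ∞ b
  have h2 : ∀ i, ∃ s' : ∀ x, V x, ContMDiff 𝓘(ℝ, E) (𝓘(ℝ, E).prod 𝓘(ℝ, F)) ∞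
      (fun y => TotalSpace.mk' F y (s' y)) ∧ ∀ᶠ y in 𝓝 x, s' y = t.localFrame b i y := by
    intro i
    refine exists_contMDiff_section_eventuallyEq ?_
    filter_upwards [t.open_baseSet.mem_nhds hxt] with y hy
    exact contMDiffAt_localFrame_of_mem ∞ t b i hy
  choose s hs hst using h2
  obtain ⟨U, hU, hUo, hxU⟩ := eventually_nhds_iff.1 (Filter.eventually_all.2 hst)
  refine ⟨s, U ∩ t.baseSet, hUo.inter t.open_baseSet, ⟨hxU, hxt⟩, hs, ?_, ?_⟩
  · rintro y ⟨hy, hyt⟩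
    have h3 : (fun i => s i y) = fun i => t.localFrame b i y := funext (hU y hy)
    rw [h3]
    exact ⟨hfr.linearIndependent hyt, top_le_iff.1 (hfr.generating hyt)⟩
  · intro X hX
    refine ⟨fun i y => t.localFrameCoeff 𝓘(ℝ, E) b i y (X y), fun i => ?_, ?_⟩
    · exact (contMDiffOn_baseSet_localFrameCoeff (k := ∞) (e := t) b hX.contMDiffOn i).mono
        Set.inter_subset_right
    · rintro y ⟨hy, hyt⟩
      have h3 := t.eq_sum_localFrameCoeff_smul (I := 𝓘(ℝ, E)) (b := b) (s := X) hyt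
      simp only [hU y hy]
      exact h3

end Sections

/-- Every covector is the differential of a smooth function. -/
theorem exists_dfun_eq {x : M} (φ : TangentSpace 𝓘(ℝ, E) x →L[ℝ] ℝ) :
    ∃ f : C^∞⟮𝓘(ℝ, E), M; ℝ⟯, dfun 𝓘(ℝ, E) f x = φ := by
  have h1 : IsManifold 𝓘(ℝ, E) 1 M := .of_le (n := ∞) (by simp)
  obtain ⟨D, hD⟩ := isInvertible_mfderiv_extChartAt (I := 𝓘(ℝ, E)) (mem_extChartAt_source x)
  obtain ⟨b⟩ : Nonempty (SmoothBumpFunction 𝓘(ℝ, E) x) := inferInstance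
  let L : E →L[ℝ] ℝ := φ.comp D.symm.toContinuousLinearMap
  have hg : ContMDiffOn 𝓘(ℝ, E) 𝓘(ℝ, ℝ) ∞ (fun y => L (extChartAt 𝓘(ℝ, E) x y))
      (chartAt E x).source := L.contMDiff.comp_contMDiffOn contMDiffOn_extChartAt
  refine ⟨⟨fun y => b y • L (extChartAt 𝓘(ℝ, E) x y), b.contMDiff_smul hg⟩, ?_⟩
  have h2 : (fun y => b y • L (extChartAt 𝓘(ℝ, E) x y)) =ᶠ[𝓝 x]
      L ∘ (extChartAt 𝓘(ℝ, E) x) := by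
    filter_upwards [b.eventuallyEq_one] with y hy
    simp [hy]
  have h3 : mfderiv 𝓘(ℝ, E) 𝓘(ℝ, ℝ) (fun y => b y • L (extChartAt 𝓘(ℝ, E) x y)) x
      = L.comp (mfderiv 𝓘(ℝ, E) 𝓘(ℝ, E) (extChartAt 𝓘(ℝ, E) x) x) := by
    rw [h2.mfderiv_eq, mfderiv_comp x (I' := 𝓘(ℝ, E)) L.mdifferentiableAt
        (mdifferentiableAt_extChartAt (mem_chart_source E x)), mfderiv_eq_fderiv, L.fderiv]
    rfl
  change mfderiv 𝓘(ℝ, E) 𝓘(ℝ, ℝ) (fun y => b y • L (extChartAt 𝓘(ℝ, E) x y)) x = φ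
  rw [h3, ← hD]
  ext v
  exact congrArg φ (D.symm_apply_apply v)

/-- The smooth functions separate tangent vectors. -/
theorem eq_of_forall_dfun_eq {x : M} {v w : TangentSpace 𝓘(ℝ, E) x}
    (h : ∀ f : C^∞⟮𝓘(ℝ, E), M; ℝ⟯, dfun 𝓘(ℝ, E) f x v = dfun 𝓘(ℝ, E) f x w) : v = w := by
  have h1 : ∀ φ : StrongDual ℝ E, φ v = φ w := by
    intro φ
    obtain ⟨f, hf⟩ := exists_dfun_eq (x := x) φ
    rw [← hf]
    exact h f
  exact (SeparatingDual.eq_iff_forall_dual_eq (R := ℝ) (V := E)).2 h1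

theorem exists_isSmoothVectorField_eq {x : M} (v : TangentSpace 𝓘(ℝ, E) x) :
    ∃ X : ∀ x : M, TangentSpace 𝓘(ℝ, E) x, IsSmoothVectorField 𝓘(ℝ, E) X ∧ X x = v :=
  exists_contMDiff_section_eq v

end Extension

/-! ### Related vector fields -/

section Related

variable {E S F P : Type*} [NormedAddCommGroup E] [NormedSpace ℝ E] [FiniteDimensional ℝ E]
  [TopologicalSpace S] [ChartedSpace E S] [IsManifold 𝓘(ℝ, E) ∞ S]
  [NormedAddCommGroup F] [NormedSpace ℝ F] [FiniteDimensional ℝ F]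
  [TopologicalSpace P] [T2Space P] [ChartedSpace F P] [IsManifold 𝓘(ℝ, F) ∞ P]

/-- If `X` and `Y` are `μ`-related to `X'` and `Y'` near `x`, then the Lie brackets are `μ`-related
at `x`. -/
theorem mfderiv_mlieBracket {μ : S → P} (hμ : ContMDiff 𝓘(ℝ, E) 𝓘(ℝ, F) ∞ μ)
    {X Y : ∀ x : S, TangentSpace 𝓘(ℝ, E) x} {X' Y' : ∀ x : P, TangentSpace 𝓘(ℝ, F) x}
    (hX : IsSmoothVectorField 𝓘(ℝ, E) X) (hY : IsSmoothVectorField 𝓘(ℝ, E) Y)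
    (hX' : IsSmoothVectorField 𝓘(ℝ, F) X') (hY' : IsSmoothVectorField 𝓘(ℝ, F) Y') {x : S}
    (h₁ : ∀ᶠ y in 𝓝 x, mfderiv 𝓘(ℝ, E) 𝓘(ℝ, F) μ y (X y) = X' (μ y))
    (h₂ : ∀ᶠ y in 𝓝 x, mfderiv 𝓘(ℝ, E) 𝓘(ℝ, F) μ y (Y y) = Y' (μ y)) :
    mfderiv 𝓘(ℝ, E) 𝓘(ℝ, F) μ x (VectorField.mlieBracket 𝓘(ℝ, E) X Y x)
      = VectorField.mlieBracket 𝓘(ℝ, F) X' Y' (μ x) := by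
  have : CompleteSpace E := FiniteDimensional.complete ℝ E
  have : CompleteSpace F := FiniteDimensional.complete ℝ F
  have hμd : ∀ y, MDifferentiableAt 𝓘(ℝ, E) 𝓘(ℝ, F) μ y := fun y =>
    hμ.contMDiffAt.mdifferentiableAt (by simp)
  have hc : ∀ (g : P → ℝ), ContMDiff 𝓘(ℝ, F) 𝓘(ℝ, ℝ) ∞ g → ∀ (y : S) (v : TangentSpace 𝓘(ℝ, E) y),
      dfun 𝓘(ℝ, E) (g ∘ μ) y v = dfun 𝓘(ℝ, F) g (μ y) (mfderiv 𝓘(ℝ, E) 𝓘(ℝ, F) μ y v) := by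
    intro g hg y v
    have h := mfderiv_comp y (mdifferentiableAt_of_contMDiff_real hg (μ y)) (hμd y)
    exact DFunLike.congr_fun h v
  refine eq_of_forall_dfun_eq fun f => ?_
  have hf : ContMDiff 𝓘(ℝ, F) 𝓘(ℝ, ℝ) ∞ f := f.contMDiff
  rw [← hc f hf, dfun_mlieBracket (hf.comp hμ) hX hY, dfun_mlieBracket hf hX' hY']
  have hsec : ∀ {V W : ∀ x : S, TangentSpace 𝓘(ℝ, E) x} {V' W' : ∀ x : P, TangentSpace 𝓘(ℝ, F) x},
      IsSmoothVectorField 𝓘(ℝ, F) W' →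
      (∀ᶠ y in 𝓝 x, mfderiv 𝓘(ℝ, E) 𝓘(ℝ, F) μ y (V y) = V' (μ y)) →
      (∀ᶠ y in 𝓝 x, mfderiv 𝓘(ℝ, E) 𝓘(ℝ, F) μ y (W y) = W' (μ y)) →
      dfun 𝓘(ℝ, E) (fun y => dfun 𝓘(ℝ, E) (f ∘ μ) y (W y)) x (V x) =
        dfun 𝓘(ℝ, F) (fun y => dfun 𝓘(ℝ, F) f y (W' y)) (μ x) (V' (μ x)) := by
    intro V W V' W' hW' hV hW
    have h3 : (fun y => dfun 𝓘(ℝ, E) (f ∘ μ) y (W y)) =ᶠ[𝓝 x]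
        (fun y => dfun 𝓘(ℝ, F) f y (W' y)) ∘ μ := by
      filter_upwards [hW] with y hy
      rw [hc f hf, hy]
      rfl
    have h4 : dfun 𝓘(ℝ, E) (fun y => dfun 𝓘(ℝ, E) (f ∘ μ) y (W y)) x =
        dfun 𝓘(ℝ, E) ((fun y => dfun 𝓘(ℝ, F) f y (W' y)) ∘ μ) x := h3.mfderiv_eq
    rw [h4, hc _ (contMDiff_dfun_apply hf hW'), hV.self_of_nhds]
  rw [hsec hY' h₁ h₂, hsec hX' h₂ h₁]

end Related

/-! ### Lifts of vector fields through submersions -/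

section Lift

variable {E M : Type*} [NormedAddCommGroup E] [NormedSpace ℝ E] [FiniteDimensional ℝ E]
  [TopologicalSpace M] [T2Space M] [ChartedSpace E M] [IsManifold 𝓘(ℝ, E) ∞ M]
  {F P : Type*} [NormedAddCommGroup F] [NormedSpace ℝ F]
  [TopologicalSpace P] [ChartedSpace F P] [IsManifold 𝓘(ℝ, F) ∞ P]
  {K : Type*} [NormedAddCommGroup K] [NormedSpace ℝ K]

/-- Vector fields lift locally through a submersion. -/
theorem IsLocalSplitting.exists_lift_vectorField {f : M → P} {x : M} {pr : M → K} {sec : P × K → M}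
    (h : IsLocalSplitting (E := E) (F := F) f x pr sec) (hf : ContMDiff 𝓘(ℝ, E) 𝓘(ℝ, F) ∞ f)
    {Y : ∀ y : P, TangentSpace 𝓘(ℝ, F) y} (hY : IsSmoothVectorField 𝓘(ℝ, F) Y) :
    ∃ Z : ∀ y : M, TangentSpace 𝓘(ℝ, E) y, IsSmoothVectorField 𝓘(ℝ, E) Z ∧
      ∀ᶠ z in 𝓝 x, mfderiv 𝓘(ℝ, E) 𝓘(ℝ, F) f z (Z z) = Y (f z) := by
  have h1 : IsManifold 𝓘(ℝ, E) 1 M := .of_le (n := ∞) (by simp)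
  have h2 : IsManifold 𝓘(ℝ, F) 1 P := .of_le (n := ∞) (by simp)
  have hpair : Filter.Tendsto (fun z => (f z, pr z)) (𝓝 x) (𝓝 (f x, pr x)) :=
    (hf.continuous.continuousAt.prodMk h.contMDiffAt_pr.continuousAt)
  let Z₀ : ∀ z : M, TangentSpace 𝓘(ℝ, E) (sec (f z, pr z)) := fun z =>
    mfderiv 𝓘(ℝ, F) 𝓘(ℝ, E) (fun p => sec (p, pr z)) (f z) (Y (f z))
  let Z₁ : ∀ z : M, TangentSpace 𝓘(ℝ, E) z := fun z => (Z₀ z : E)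
  have hsmooth : ∀ᶠ z in 𝓝 x, ContMDiffAt 𝓘(ℝ, E) 𝓘(ℝ, E).tangent ∞
      (fun z => (⟨z, Z₁ z⟩ : TangentBundle 𝓘(ℝ, E) M)) z := by
    filter_upwards [h.sec_eq.eventually_nhds, h.eventually_contMDiffAt_pr,
      hpair.eventually h.eventually_contMDiffAt_sec] with z hz hpr hsec
    have hs : ContMDiffAt (𝓘(ℝ, E).prod 𝓘(ℝ, F)) 𝓘(ℝ, E) ∞
        (Function.uncurry fun (z : M) (p : P) => sec (p, pr z)) (z, f z) :=
      ContMDiffAt.comp (g := sec) (f := fun q : M × P => (q.2, pr q.1)) (z, f z) hsec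
        (contMDiffAt_snd.prodMk (hpr.comp (z, f z) contMDiffAt_fst))
    have hd := ContMDiffAt.mfderiv (m := ∞) (fun (z : M) (p : P) => sec (p, pr z)) f hs
      hf.contMDiffAt (by simp)
    have hb : ContMDiffAt 𝓘(ℝ, E) 𝓘(ℝ, E) ∞ (fun z => sec (f z, pr z)) z :=
      ContMDiffAt.comp (g := sec) z hsec (hf.contMDiffAt.prodMk hpr)
    have hYf : ContMDiffAt 𝓘(ℝ, E) 𝓘(ℝ, F).tangent ∞
        (fun z => (⟨f z, Y (f z)⟩ : TangentBundle 𝓘(ℝ, F) P)) z :=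
      ContMDiffAt.comp (g := fun y => (⟨y, Y y⟩ : TangentBundle 𝓘(ℝ, F) P)) z (hY (f z))
        hf.contMDiffAt
    have h3 : ContMDiffAt 𝓘(ℝ, E) 𝓘(ℝ, E).tangent ∞
        (fun z => (⟨sec (f z, pr z), Z₀ z⟩ : TangentBundle 𝓘(ℝ, E) M)) z :=
      ContMDiffAt.clm_apply_of_inCoordinates (F₁ := F) (b₁ := f) (b₂ := fun z => sec (f z, pr z))
        (E₁ := TangentSpace 𝓘(ℝ, F)) (F₂ := E) (E₂ := TangentSpace 𝓘(ℝ, E))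
        (ϕ := fun z => mfderiv 𝓘(ℝ, F) 𝓘(ℝ, E) (fun p => sec (p, pr z)) (f z))
        (v := fun z => Y (f z)) (m₀ := z) hd hYf hb
    refine h3.congr_of_eventuallyEq ?_
    filter_upwards [hz] with y hy
    exact (LieGroupoid.tangentBundle_mk_congr (E := E) hy (Z₀ y)).symm
  have hrel : ∀ᶠ z in 𝓝 x, mfderiv 𝓘(ℝ, E) 𝓘(ℝ, F) f z (Z₁ z) = Y (f z) := by
    filter_upwards [h.sec_eq, hpair.eventually h.eventually_contMDiffAt_sec,
      hpair.eventually h.map_sec.eventually_nhds] with z hz hsec hmap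
    have hs : MDifferentiableAt 𝓘(ℝ, F) 𝓘(ℝ, E) (fun p => sec (p, pr z)) (f z) :=
      (ContMDiffAt.comp (g := sec) (f := fun p : P => (p, pr z)) (f z) hsec
        (contMDiffAt_id.prodMk contMDiffAt_const)).mdifferentiableAt (by simp)
    have hc := mfderiv_comp (f z) (hf.contMDiffAt.mdifferentiableAt (by simp)) hs
    have hid : (f ∘ fun p => sec (p, pr z)) =ᶠ[𝓝 (f z)] id := by
      have : Filter.Tendsto (fun p : P => (p, pr z)) (𝓝 (f z)) (𝓝 (f z, pr z)) :=
        continuousAt_id.prodMk continuousAt_const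
      exact (this.eventually hmap).mono fun p hp => hp.1
    rw [hid.mfderiv_eq, mfderiv_id] at hc
    have h4 : ∀ (y : M) (v : E), y = z → (mfderiv 𝓘(ℝ, E) 𝓘(ℝ, F) f z v : F) =
        mfderiv 𝓘(ℝ, E) 𝓘(ℝ, F) f y v := by
      rintro y v rfl
      rfl
    exact (h4 _ (Z₁ z) hz).trans (DFunLike.congr_fun hc (Y (f z))).symm
  obtain ⟨Z, hZ, hZ'⟩ := exists_contMDiff_section_eventuallyEq hsmooth
  refine ⟨Z, hZ, ?_⟩
  filter_upwards [hZ', hrel] with z h3 h4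
  rw [h3, h4]

end Lift

theorem LieGroupoid.exists_lift_vectorField {E F S P : Type*} [NormedAddCommGroup E]
    [NormedSpace ℝ E] [FiniteDimensional ℝ E] [NormedAddCommGroup F] [NormedSpace ℝ F]
    [TopologicalSpace S] [T2Space S] [ChartedSpace E S] [IsManifold 𝓘(ℝ, E) ∞ S]
    [TopologicalSpace P] [ChartedSpace F P] [IsManifold 𝓘(ℝ, F) ∞ P] (G : LieGroupoid E F S P)
    {Y : ∀ y : P, TangentSpace 𝓘(ℝ, F) y} (hY : IsSmoothVectorField 𝓘(ℝ, F) Y) (g : S) :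
    ∃ Z : ∀ y : S, TangentSpace 𝓘(ℝ, E) y, IsSmoothVectorField 𝓘(ℝ, E) Z ∧
      ∀ᶠ z in 𝓝 g, mfderiv 𝓘(ℝ, E) 𝓘(ℝ, F) G.tgt z (Z z) = Y (G.tgt z) := by
  obtain ⟨K, _, _, hK⟩ := G.tgt_submersion
  obtain ⟨pr, sec, hs⟩ := (hK g).exists_isLocalSplitting
  exact hs.exists_lift_vectorField G.contMDiff_tgt hY

namespace LieGroupoid

variable {E F S P : Type*} [NormedAddCommGroup E] [NormedSpace ℝ E]
  [NormedAddCommGroup F] [NormedSpace ℝ F] [TopologicalSpace S] [ChartedSpace E S]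
  [TopologicalSpace P] [ChartedSpace F P] {G : LieGroupoid E F S P}

theorem dfun_comp_tgt {f : P → ℝ} (hf : ContMDiff 𝓘(ℝ, F) 𝓘(ℝ, ℝ) ∞ f) (g : S) :
    dfun 𝓘(ℝ, E) (f ∘ G.tgt) g =
      (dfun 𝓘(ℝ, F) f (G.tgt g)).comp (mfderiv 𝓘(ℝ, E) 𝓘(ℝ, F) G.tgt g) :=
  mfderiv_comp g (mdifferentiableAt_of_contMDiff_real hf _) (G.mdifferentiableAt_tgt g)

theorem mfderiv_tgt_surjective [IsManifold 𝓘(ℝ, F) ∞ P] (g : S) :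
    Function.Surjective (mfderiv 𝓘(ℝ, E) 𝓘(ℝ, F) G.tgt g) := by
  intro y
  obtain ⟨K, _, _, hK⟩ := G.tgt_submersion
  obtain ⟨pr, sec, hs⟩ := (hK g).exists_isLocalSplitting
  obtain ⟨⟨g', v⟩, hg', hv⟩ := hs.exists_tangentMap_eq ⟨G.tgt g, y⟩ rfl
  obtain rfl : g' = g := hg'
  exact ⟨v, TotalSpace.mk_inj.1 hv⟩

theorem isSmoothOneForm_algebroidMap [IsManifold 𝓘(ℝ, E) ∞ S] [IsManifold 𝓘(ℝ, F) ∞ P]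
    {Ω : SymplecticForm 𝓘(ℝ, E) S} {X : ∀ m, G.algebroidFiber m} (hX : G.IsSmoothSection X) :
    IsSmoothOneForm 𝓘(ℝ, F) (fun m => G.algebroidMap Ω m (X m)) := fun m =>
  contMDiffAt_oneForm_comp_mfderiv (f := G.one)
    (Ω.contMDiffAt_flat G.contMDiff_one.contMDiffAt (hX m))

variable [IsManifold 𝓘(ℝ, E) ∞ S] [FiniteDimensional ℝ E] {Ω : SymplecticForm 𝓘(ℝ, E) S}

/-! ### The vector field of the pullback of a 1-form along the target map -/

/-- The vector field `(β^* φ)^♯` on `S`, for a 1-form `φ` on `P`. -/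
noncomputable def pullbackField (G : LieGroupoid E F S P) (Ω : SymplecticForm 𝓘(ℝ, E) S)
    (φ : ∀ m : P, TangentSpace 𝓘(ℝ, F) m →L[ℝ] ℝ) (g : S) : TangentSpace 𝓘(ℝ, E) g :=
  Ω.sharp g ((φ (G.tgt g)).comp (mfderiv 𝓘(ℝ, E) 𝓘(ℝ, F) G.tgt g))

theorem flat_pullbackField (φ : ∀ m : P, TangentSpace 𝓘(ℝ, F) m →L[ℝ] ℝ) (g : S) :
    Ω.flat g (G.pullbackField Ω φ g) =
      (φ (G.tgt g)).comp (mfderiv 𝓘(ℝ, E) 𝓘(ℝ, F) G.tgt g) :=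
  (Ω.sharp g).symm_apply_apply _

theorem form_pullbackField (φ : ∀ m : P, TangentSpace 𝓘(ℝ, F) m →L[ℝ] ℝ) (g : S)
    (w : TangentSpace 𝓘(ℝ, E) g) :
    Ω.form g (G.pullbackField Ω φ g) w =
      -φ (G.tgt g) (mfderiv 𝓘(ℝ, E) 𝓘(ℝ, F) G.tgt g w) := by
  have h : -Ω.form g (G.pullbackField Ω φ g) w = φ (G.tgt g) (mfderiv 𝓘(ℝ, E) 𝓘(ℝ, F) G.tgt g w) :=
    DFunLike.congr_fun (flat_pullbackField (Ω := Ω) φ g) w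
  rw [← h, neg_neg]

theorem eq_pullbackField {φ : ∀ m : P, TangentSpace 𝓘(ℝ, F) m →L[ℝ] ℝ} {g : S}
    {v : TangentSpace 𝓘(ℝ, E) g}
    (h : ∀ w, Ω.form g v w = -φ (G.tgt g) (mfderiv 𝓘(ℝ, E) 𝓘(ℝ, F) G.tgt g w)) :
    v = G.pullbackField Ω φ g := by
  refine Ω.flat_injective g ?_
  rw [flat_pullbackField]
  ext w
  have h' : -Ω.form g v w = φ (G.tgt g) (mfderiv 𝓘(ℝ, E) 𝓘(ℝ, F) G.tgt g w) := by
    rw [h, neg_neg]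
  exact h'

theorem pullbackField_add (φ ψ : ∀ m : P, TangentSpace 𝓘(ℝ, F) m →L[ℝ] ℝ) :
    G.pullbackField Ω (fun m => φ m + ψ m) = G.pullbackField Ω φ + G.pullbackField Ω ψ :=
  funext fun g => (Ω.sharp g).map_add ((φ (G.tgt g)).comp (mfderiv 𝓘(ℝ, E) 𝓘(ℝ, F) G.tgt g))
    ((ψ (G.tgt g)).comp (mfderiv 𝓘(ℝ, E) 𝓘(ℝ, F) G.tgt g))

theorem pullbackField_smul (f : P → ℝ) (φ : ∀ m : P, TangentSpace 𝓘(ℝ, F) m →L[ℝ] ℝ) :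
    G.pullbackField Ω (fun m => f m • φ m) = (f ∘ G.tgt) • G.pullbackField Ω φ :=
  funext fun g => (Ω.sharp g).map_smul (f (G.tgt g))
    ((φ (G.tgt g)).comp (mfderiv 𝓘(ℝ, E) 𝓘(ℝ, F) G.tgt g))

theorem eq_of_pullbackField_eq [IsManifold 𝓘(ℝ, F) ∞ P]
    {φ ψ : ∀ m : P, TangentSpace 𝓘(ℝ, F) m →L[ℝ] ℝ}
    (h : ∀ g, G.pullbackField Ω φ g = G.pullbackField Ω ψ g) : φ = ψ := by
  funext m
  obtain ⟨g, rfl⟩ := G.tgt_surjective m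
  have h1 : (φ (G.tgt g)).comp (mfderiv 𝓘(ℝ, E) 𝓘(ℝ, F) G.tgt g) =
      (ψ (G.tgt g)).comp (mfderiv 𝓘(ℝ, E) 𝓘(ℝ, F) G.tgt g) := (Ω.sharp g).injective (h g)
  ext y
  obtain ⟨v, rfl⟩ := G.mfderiv_tgt_surjective g y
  exact DFunLike.congr_fun h1 v

theorem isSmoothVectorField_pullbackField [IsManifold 𝓘(ℝ, F) ∞ P]
    {φ : ∀ m : P, TangentSpace 𝓘(ℝ, F) m →L[ℝ] ℝ} (hφ : IsSmoothOneForm 𝓘(ℝ, F) φ) :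
    IsSmoothVectorField 𝓘(ℝ, E) (G.pullbackField Ω φ) := by
  intro g
  refine Ω.contMDiffAt_sharp (b := id) (contMDiffAt_oneForm_comp_mfderiv (f := G.tgt)
    (φ := fun g => φ (G.tgt g)) ?_)
  exact ContMDiffAt.comp (g := fun m => TotalSpace.mk' (F →L[ℝ] ℝ)
    (E := fun x : P => TangentSpace 𝓘(ℝ, F) x →L[ℝ] ℝ) m (φ m)) g (hφ _)
    G.contMDiff_tgt.contMDiffAt

/-! ### The isomorphism of the algebroid with the cotangent bundle -/

variable [IsManifold 𝓘(ℝ, F) ∞ P]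

/-- Vectors tangent to the source fibres at units are orthogonal to those tangent to the target
fibres, so that pairing with them only depends on the image under `T(β)`. -/
theorem form_algebroidFiber (hG : G.IsSymplectic Ω) (m : P) (X : G.algebroidFiber m)
    (v : TangentSpace 𝓘(ℝ, E) (G.one m)) :
    Ω.form (G.one m) X v = Ω.form (G.one m) X (G.oneDeriv m (G.tgtDeriv m v)) := by
  have h1 : G.tgtDeriv m (v - G.oneDeriv m (G.tgtDeriv m v)) = 0 := by
    rw [map_sub, tgtDeriv_oneDeriv, sub_self]
  have h := form_eq_zero_of_src_of_tgt hG (G.one m) X _ X.2 h1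
  rw [map_sub] at h
  exact sub_eq_zero.1 h

theorem flat_eq_algebroidMap_comp (hG : G.IsSymplectic Ω) (m : P) (X : G.algebroidFiber m) :
    Ω.flat (G.one m) X = (G.algebroidMap Ω m X).comp (G.tgtDeriv m) :=
  ContinuousLinearMap.ext fun v => congrArg Neg.neg (form_algebroidFiber hG m X v)

theorem algebroidMap_bijective [FiniteDimensional ℝ F] (hG : G.IsSymplectic Ω) (m : P) :
    Function.Bijective (G.algebroidMap Ω m) := by
  have hinj : Function.Injective (G.algebroidMap Ω m) := by
    rw [injective_iff_map_eq_zero]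
    intro X hX
    have h := flat_eq_algebroidMap_comp hG m X
    rw [hX] at h
    refine Subtype.ext (Ω.flat_injective (G.one m) ?_)
    rw [h]
    exact ((Ω.flat (G.one m)).map_zero).symm
  refine ⟨hinj, ?_⟩
  have : FiniteDimensional ℝ (TangentSpace 𝓘(ℝ, E) (G.one m)) :=
    inferInstanceAs (FiniteDimensional ℝ E)
  have e : (F →ₗ[ℝ] ℝ) ≃ₗ[ℝ] (TangentSpace 𝓘(ℝ, F) m →L[ℝ] ℝ) :=
    LinearMap.toContinuousLinearMap (E := F)
  have : FiniteDimensional ℝ (TangentSpace 𝓘(ℝ, F) m →L[ℝ] ℝ) := e.finiteDimensional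
  refine (LinearMap.injective_iff_surjective_of_finrank_eq_finrank ?_).1 hinj
  rw [finrank_algebroidFiber hG, ← e.finrank_eq]
  exact Subspace.dual_finrank_eq.symm

theorem mfderiv_src_rightDeriv (g : S) (X : G.algebroidFiber (G.tgt g)) :
    mfderiv 𝓘(ℝ, E) 𝓘(ℝ, F) G.src g (G.rightDeriv g X) = 0 := by
  have hT := G.tangentGroupoid_isGroupoid
  have hX := src_algebroidFiber_eq_tgt_zero g X
  have h := hT.src_mul _ _ hX
  rw [← rightDeriv_eq_mul g X, tangentGroupoid_src_zero] at h
  exact TotalSpace.mk_inj.1 h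

theorem mfderiv_tgt_rightDeriv (g : S) (X : G.algebroidFiber (G.tgt g)) :
    mfderiv 𝓘(ℝ, E) 𝓘(ℝ, F) G.tgt g (G.rightDeriv g X) = G.tgtDeriv (G.tgt g) X := by
  have hT := G.tangentGroupoid_isGroupoid
  have hX := src_algebroidFiber_eq_tgt_zero g X
  have h := hT.tgt_mul _ _ hX
  rw [← rightDeriv_eq_mul g X] at h
  have h' : (⟨G.tgt g, mfderiv 𝓘(ℝ, E) 𝓘(ℝ, F) G.tgt g (G.rightDeriv g X)⟩ :
      TangentBundle 𝓘(ℝ, F) P) = ⟨G.tgt g, G.tgtDeriv (G.tgt g) X⟩ :=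
    h.trans (tangentBundle_mk_congr (E := F) (G.isGroupoid.tgt_one (G.tgt g))
      (G.tgtDeriv (G.tgt g) X))
  exact TotalSpace.mk_inj.1 h'

/-- Right-invariant vector fields are the fields `(β^* φ)^♯`. -/
theorem rightInvariant_eq_pullbackField (hG : G.IsSymplectic Ω) (X : ∀ m, G.algebroidFiber m) :
    G.rightInvariant X = G.pullbackField Ω (fun m => G.algebroidMap Ω m (X m)) := by
  funext g
  refine eq_pullbackField fun w => ?_
  have h := form_rightDeriv hG g w (X (G.tgt g))
  rw [Ω.form_swap, Ω.form_swap (G.one (G.tgt g)), neg_inj] at h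
  refine h.trans ?_
  exact (neg_neg _).symm

end LieGroupoid

namespace LieGroupoid

variable {E F S P : Type*} [NormedAddCommGroup E] [NormedSpace ℝ E] [FiniteDimensional ℝ E]
  [NormedAddCommGroup F] [NormedSpace ℝ F] [FiniteDimensional ℝ F]
  [TopologicalSpace S] [ChartedSpace E S] [IsManifold 𝓘(ℝ, E) ∞ S]
  [TopologicalSpace P] [ChartedSpace F P] [IsManifold 𝓘(ℝ, F) ∞ P]
  {G : LieGroupoid E F S P} {Ω : SymplecticForm 𝓘(ℝ, E) S}

/-- The isomorphism `r : A_m S → T^*_m P`. -/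
noncomputable def algebroidEquiv (hG : G.IsSymplectic Ω) (m : P) :
    G.algebroidFiber m ≃ₗ[ℝ] (TangentSpace 𝓘(ℝ, F) m →L[ℝ] ℝ) :=
  LinearEquiv.ofBijective (G.algebroidMap Ω m) (algebroidMap_bijective hG m)

/-- The map `a : T^*P → TP` obtained from the anchor of the algebroid by transport along `r`. -/
noncomputable def cotangentAnchor (hG : G.IsSymplectic Ω) (m : P) :
    (TangentSpace 𝓘(ℝ, F) m →L[ℝ] ℝ) →ₗ[ℝ] TangentSpace 𝓘(ℝ, F) m :=
  (G.tgtDeriv m).toLinearMap ∘ₗ (G.algebroidFiber m).subtype ∘ₗ (algebroidEquiv hG m).symm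

theorem cotangentAnchor_algebroidMap (hG : G.IsSymplectic Ω) (m : P) (X : G.algebroidFiber m) :
    cotangentAnchor hG m (G.algebroidMap Ω m X) = G.tgtDeriv m X := by
  change G.tgtDeriv m ((algebroidEquiv hG m).symm (algebroidEquiv hG m X)) = _
  rw [LinearEquiv.symm_apply_apply]

theorem rightInvariant_algebroidEquiv_symm (hG : G.IsSymplectic Ω)
    (φ : ∀ m : P, TangentSpace 𝓘(ℝ, F) m →L[ℝ] ℝ) :
    G.rightInvariant (fun m => (algebroidEquiv hG m).symm (φ m)) = G.pullbackField Ω φ := by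
  rw [rightInvariant_eq_pullbackField hG]
  congr 1
  funext m
  exact (algebroidEquiv hG m).apply_symm_apply (φ m)

theorem mfderiv_src_pullbackField (hG : G.IsSymplectic Ω)
    (φ : ∀ m : P, TangentSpace 𝓘(ℝ, F) m →L[ℝ] ℝ) (g : S) :
    mfderiv 𝓘(ℝ, E) 𝓘(ℝ, F) G.src g (G.pullbackField Ω φ g) = 0 := by
  rw [← rightInvariant_algebroidEquiv_symm hG]
  exact mfderiv_src_rightDeriv _ _

theorem mfderiv_tgt_pullbackField (hG : G.IsSymplectic Ω)
    (φ : ∀ m : P, TangentSpace 𝓘(ℝ, F) m →L[ℝ] ℝ) (g : S) :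
    mfderiv 𝓘(ℝ, E) 𝓘(ℝ, F) G.tgt g (G.pullbackField Ω φ g)
      = cotangentAnchor hG (G.tgt g) (φ (G.tgt g)) := by
  rw [← rightInvariant_algebroidEquiv_symm hG]
  exact mfderiv_tgt_rightDeriv _ _

theorem algebroidEquiv_symm_eq_pullbackField (hG : G.IsSymplectic Ω)
    (φ : ∀ m : P, TangentSpace 𝓘(ℝ, F) m →L[ℝ] ℝ) (m : P) :
    ((algebroidEquiv hG m).symm (φ m) : TangentSpace 𝓘(ℝ, E) (G.one m))
      = G.pullbackField Ω φ (G.one m) := by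
  refine eq_pullbackField fun w => ?_
  have h := DFunLike.congr_fun (flat_eq_algebroidMap_comp hG m ((algebroidEquiv hG m).symm (φ m))) w
  have h1 : G.algebroidMap Ω m ((algebroidEquiv hG m).symm (φ m)) = φ m :=
    (algebroidEquiv hG m).apply_symm_apply (φ m)
  rw [h1] at h
  have h2 : ∀ (y : P) (v : F), y = m → φ m v = φ y v := by
    rintro y v rfl
    rfl
  have h3 : -Ω.form (G.one m) ((algebroidEquiv hG m).symm (φ m)) w
      = φ (G.tgt (G.one m)) (mfderiv 𝓘(ℝ, E) 𝓘(ℝ, F) G.tgt (G.one m) w) :=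
    h.trans (h2 _ _ (G.isGroupoid.tgt_one m))
  rw [← h3, neg_neg]

/-- The field `r⁻¹ ∘ φ` is a smooth section of the algebroid when `φ` is a smooth 1-form. -/
theorem isSmoothSection_algebroidEquiv_symm (hG : G.IsSymplectic Ω)
    {φ : ∀ m : P, TangentSpace 𝓘(ℝ, F) m →L[ℝ] ℝ} (hφ : IsSmoothOneForm 𝓘(ℝ, F) φ) :
    G.IsSmoothSection (fun m => (algebroidEquiv hG m).symm (φ m)) := by
  have h : ContMDiff 𝓘(ℝ, F) 𝓘(ℝ, E).tangent ∞ (fun m =>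
      (⟨G.one m, G.pullbackField Ω φ (G.one m)⟩ : TangentBundle 𝓘(ℝ, E) S)) :=
    (isSmoothVectorField_pullbackField hφ).comp G.contMDiff_one
  refine h.congr fun m => ?_
  exact congrArg (TotalSpace.mk (G.one m)) (algebroidEquiv_symm_eq_pullbackField hG φ m)

theorem isSmoothVectorField_cotangentAnchor (hG : G.IsSymplectic Ω)
    {φ : ∀ m : P, TangentSpace 𝓘(ℝ, F) m →L[ℝ] ℝ} (hφ : IsSmoothOneForm 𝓘(ℝ, F) φ) :
    IsSmoothVectorField 𝓘(ℝ, F) (fun m => cotangentAnchor hG m (φ m)) := by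
  have h := (G.contMDiff_tgt.contMDiff_tangentMap (m := ∞) (by simp)).comp
    (isSmoothSection_algebroidEquiv_symm hG hφ)
  refine h.congr fun m => ?_
  exact (tangentBundle_mk_congr (E := F) (G.isGroupoid.tgt_one m)
    (cotangentAnchor hG m (φ m))).symm

theorem form_pullbackField_pullbackField (hG : G.IsSymplectic Ω)
    (φ ψ : ∀ m : P, TangentSpace 𝓘(ℝ, F) m →L[ℝ] ℝ) (g : S) :
    Ω.form g (G.pullbackField Ω φ g) (G.pullbackField Ω ψ g)
      = ψ (G.tgt g) (cotangentAnchor hG (G.tgt g) (φ (G.tgt g))) := by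
  rw [Ω.form_swap, form_pullbackField, mfderiv_tgt_pullbackField hG, neg_neg]

/-! ### Lie brackets of right-invariant fields -/

/-- `⟨L_{aφ} ψ - L_{aψ} φ - d(ψ(aφ)), Y⟩` at `m`, for the map `a = cotangentAnchor : T^*P → TP`. -/
noncomputable def formBracketPairing (hG : G.IsSymplectic Ω)
    (φ ψ : ∀ m : P, TangentSpace 𝓘(ℝ, F) m →L[ℝ] ℝ) (Y : ∀ m : P, TangentSpace 𝓘(ℝ, F) m) (m : P) :
    ℝ :=
  PoissonStructure.lieDerivPairing 𝓘(ℝ, F) (fun q => cotangentAnchor hG q (φ q)) ψ Y m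
    - PoissonStructure.lieDerivPairing 𝓘(ℝ, F) (fun q => cotangentAnchor hG q (ψ q)) φ Y m
    - dfun 𝓘(ℝ, F) (fun q => ψ q (cotangentAnchor hG q (φ q))) m (Y m)

variable [T2Space P]

theorem mlieBracket_pullbackField_related (hG : G.IsSymplectic Ω)
    {φ ψ : ∀ m : P, TangentSpace 𝓘(ℝ, F) m →L[ℝ] ℝ} (hφ : IsSmoothOneForm 𝓘(ℝ, F) φ)
    (hψ : IsSmoothOneForm 𝓘(ℝ, F) ψ) (g : S) :
    mfderiv 𝓘(ℝ, E) 𝓘(ℝ, F) G.tgt g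
        (VectorField.mlieBracket 𝓘(ℝ, E) (G.pullbackField Ω φ) (G.pullbackField Ω ψ) g)
      = VectorField.mlieBracket 𝓘(ℝ, F) (fun q => cotangentAnchor hG q (φ q))
        (fun q => cotangentAnchor hG q (ψ q)) (G.tgt g) :=
  mfderiv_mlieBracket G.contMDiff_tgt (isSmoothVectorField_pullbackField hφ)
    (isSmoothVectorField_pullbackField hψ) (isSmoothVectorField_cotangentAnchor hG hφ)
    (isSmoothVectorField_cotangentAnchor hG hψ)
    (.of_forall fun g => mfderiv_tgt_pullbackField hG φ g)
    (.of_forall fun g => mfderiv_tgt_pullbackField hG ψ g)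

theorem mfderiv_src_mlieBracket_pullbackField (hG : G.IsSymplectic Ω)
    {φ ψ : ∀ m : P, TangentSpace 𝓘(ℝ, F) m →L[ℝ] ℝ} (hφ : IsSmoothOneForm 𝓘(ℝ, F) φ)
    (hψ : IsSmoothOneForm 𝓘(ℝ, F) ψ) (g : S) :
    mfderiv 𝓘(ℝ, E) 𝓘(ℝ, F) G.src g
      (VectorField.mlieBracket 𝓘(ℝ, E) (G.pullbackField Ω φ) (G.pullbackField Ω ψ) g) = 0 := by
  have h0 : IsSmoothVectorField 𝓘(ℝ, F) (0 : ∀ m : P, TangentSpace 𝓘(ℝ, F) m) :=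
    contMDiff_zeroSection ℝ (TangentSpace 𝓘(ℝ, F))
  rw [mfderiv_mlieBracket G.contMDiff_src (isSmoothVectorField_pullbackField hφ)
    (isSmoothVectorField_pullbackField hψ) h0 h0
    (.of_forall fun g => mfderiv_src_pullbackField hG φ g)
    (.of_forall fun g => mfderiv_src_pullbackField hG ψ g), VectorField.mlieBracket_zero_left]
  rfl

/-- The formula for `dΩ = 0`, evaluated on `V_φ`, `V_ψ` and a local lift `Z` of `Y`, in which all
terms descend to `P`. The lift and `w` differ by a vector tangent to the target fibre, which does
not matter because the bracket is tangent to the source fibre. -/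
theorem flat_mlieBracket_pullbackField [T2Space S] (hG : G.IsSymplectic Ω)
    {φ ψ : ∀ m : P, TangentSpace 𝓘(ℝ, F) m →L[ℝ] ℝ} (hφ : IsSmoothOneForm 𝓘(ℝ, F) φ)
    (hψ : IsSmoothOneForm 𝓘(ℝ, F) ψ) {Y : ∀ m : P, TangentSpace 𝓘(ℝ, F) m}
    (hY : IsSmoothVectorField 𝓘(ℝ, F) Y) (g : S) {w : TangentSpace 𝓘(ℝ, E) g}
    (hw : mfderiv 𝓘(ℝ, E) 𝓘(ℝ, F) G.tgt g w = Y (G.tgt g)) :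
    Ω.form g (VectorField.mlieBracket 𝓘(ℝ, E) (G.pullbackField Ω φ) (G.pullbackField Ω ψ) g) w
      = -formBracketPairing hG φ ψ Y (G.tgt g) := by
  obtain ⟨Z, hZ, hZY⟩ := G.exists_lift_vectorField hY g
  set V := G.pullbackField Ω φ
  set W := G.pullbackField Ω ψ
  have hVs : IsSmoothVectorField 𝓘(ℝ, E) V := isSmoothVectorField_pullbackField hφ
  have hWs : IsSmoothVectorField 𝓘(ℝ, E) W := isSmoothVectorField_pullbackField hψ
  have hφa := isSmoothVectorField_cotangentAnchor hG hφ
  have hwZ : Ω.form g (VectorField.mlieBracket 𝓘(ℝ, E) V W g) w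
      = Ω.form g (VectorField.mlieBracket 𝓘(ℝ, E) V W g) (Z g) := by
    have h1 := form_eq_zero_of_src_of_tgt hG g _ (w - Z g)
      (mfderiv_src_mlieBracket_pullbackField hG hφ hψ g)
      (by rw [map_sub, hw, hZY.self_of_nhds, sub_self])
    rw [map_sub] at h1
    exact sub_eq_zero.1 h1
  have hd : ∀ (f : P → ℝ) (k : S → ℝ) (v : TangentSpace 𝓘(ℝ, E) g),
      ContMDiff 𝓘(ℝ, F) 𝓘(ℝ, ℝ) ∞ f → (∀ᶠ z in 𝓝 g, k z = f (G.tgt z)) →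
      dfun 𝓘(ℝ, E) k g v = dfun 𝓘(ℝ, F) f (G.tgt g) (mfderiv 𝓘(ℝ, E) 𝓘(ℝ, F) G.tgt g v) := by
    intro f k v hf hk
    have h1 : k =ᶠ[𝓝 g] f ∘ G.tgt := hk
    have h2 : dfun 𝓘(ℝ, E) k g = dfun 𝓘(ℝ, E) (f ∘ G.tgt) g := h1.mfderiv_eq
    rw [h2, dfun_comp_tgt hf]
    rfl
  have hneg : ∀ (f : P → ℝ) (m : P) (v : TangentSpace 𝓘(ℝ, F) m),
      dfun 𝓘(ℝ, F) (fun q => -f q) m v = -dfun 𝓘(ℝ, F) f m v := by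
    intro f m v
    exact DFunLike.congr_fun (mfderiv_neg (f := f) (x := m)) v
  have hpair : ∀ (χ : ∀ m : P, TangentSpace 𝓘(ℝ, F) m →L[ℝ] ℝ) (v : TangentSpace 𝓘(ℝ, E) g),
      IsSmoothOneForm 𝓘(ℝ, F) χ →
      dfun 𝓘(ℝ, E) (fun z => Ω.form z (G.pullbackField Ω χ z) (Z z)) g v
        = -dfun 𝓘(ℝ, F) (fun q => χ q (Y q)) (G.tgt g) (mfderiv 𝓘(ℝ, E) 𝓘(ℝ, F) G.tgt g v) := by
    intro χ v hχ
    rw [hd (fun q => -χ q (Y q)) _ v (contMDiff_oneForm_apply hχ hY).neg, hneg]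
    filter_upwards [hZY] with z hz
    rw [form_pullbackField, hz]
  have hbr : ∀ (χ ρ : ∀ m : P, TangentSpace 𝓘(ℝ, F) m →L[ℝ] ℝ), IsSmoothOneForm 𝓘(ℝ, F) χ →
      Ω.form g (VectorField.mlieBracket 𝓘(ℝ, E) (G.pullbackField Ω χ) Z g) (G.pullbackField Ω ρ g)
        = ρ (G.tgt g) (VectorField.mlieBracket 𝓘(ℝ, F) (fun q => cotangentAnchor hG q (χ q)) Y
          (G.tgt g)) := by
    intro χ ρ hχ
    rw [Ω.form_swap, form_pullbackField, mfderiv_mlieBracket G.contMDiff_tgt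
      (isSmoothVectorField_pullbackField hχ) hZ (isSmoothVectorField_cotangentAnchor hG hχ) hY
      (.of_forall fun g => mfderiv_tgt_pullbackField hG χ g) hZY, neg_neg]
  have hVW : dfun 𝓘(ℝ, E) (fun z => Ω.form z (V z) (W z)) g (Z g)
      = dfun 𝓘(ℝ, F) (fun q => ψ q (cotangentAnchor hG q (φ q))) (G.tgt g) (Y (G.tgt g)) := by
    rw [hd _ _ (Z g) (contMDiff_oneForm_apply hψ hφa)
      (.of_forall fun z => form_pullbackField_pullbackField hG φ ψ z), hZY.self_of_nhds]
  have hcl := Ω.closed V W Z hVs hWs hZ g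
  rw [hVW, hbr φ ψ hφ, hbr ψ φ hψ, hpair ψ (V g) hψ, hpair φ (W g) hφ,
    mfderiv_tgt_pullbackField hG, mfderiv_tgt_pullbackField hG] at hcl
  rw [hwZ, formBracketPairing, PoissonStructure.lieDerivPairing, PoissonStructure.lieDerivPairing]
  linarith

/-- The fields `(β^* φ)^♯` are closed under the Lie bracket; the induced bracket of 1-forms is given
by the formula for the bracket of the cotangent algebroid. -/
theorem exists_mlieBracket_pullbackField_eq [T2Space S] (hG : G.IsSymplectic Ω)
    {φ ψ : ∀ m : P, TangentSpace 𝓘(ℝ, F) m →L[ℝ] ℝ} (hφ : IsSmoothOneForm 𝓘(ℝ, F) φ)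
    (hψ : IsSmoothOneForm 𝓘(ℝ, F) ψ) :
    ∃ θ : ∀ m : P, TangentSpace 𝓘(ℝ, F) m →L[ℝ] ℝ, IsSmoothOneForm 𝓘(ℝ, F) θ ∧
      VectorField.mlieBracket 𝓘(ℝ, E) (G.pullbackField Ω φ) (G.pullbackField Ω ψ)
        = G.pullbackField Ω θ ∧
      ∀ Y : (∀ m : P, TangentSpace 𝓘(ℝ, F) m), IsSmoothVectorField 𝓘(ℝ, F) Y → ∀ m,
        θ m (Y m) = formBracketPairing hG φ ψ Y m := by
  have hEc : CompleteSpace E := FiniteDimensional.complete ℝ E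
  set B := VectorField.mlieBracket 𝓘(ℝ, E) (G.pullbackField Ω φ) (G.pullbackField Ω ψ)
  have hBs : IsSmoothVectorField 𝓘(ℝ, E) B :=
    (isSmoothVectorField_pullbackField hφ).mlieBracket (isSmoothVectorField_pullbackField hψ)
  let θ : ∀ m : P, TangentSpace 𝓘(ℝ, F) m →L[ℝ] ℝ := fun m =>
    (Ω.flat (G.one m) (B (G.one m))).comp (G.oneDeriv m)
  have hθs : IsSmoothOneForm 𝓘(ℝ, F) θ := fun m =>
    contMDiffAt_oneForm_comp_mfderiv (f := G.one)
      (Ω.contMDiffAt_flat G.contMDiff_one.contMDiffAt (hBs.comp G.contMDiff_one m))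
  have hθ : ∀ Y : (∀ m : P, TangentSpace 𝓘(ℝ, F) m), IsSmoothVectorField 𝓘(ℝ, F) Y → ∀ m,
      θ m (Y m) = formBracketPairing hG φ ψ Y m := by
    intro Y hY m
    have h1 : ∀ y : P, y = m → (Y m : F) = Y y := by
      rintro y rfl
      rfl
    have h2 := flat_mlieBracket_pullbackField hG hφ hψ hY (G.one m) (w := G.oneDeriv m (Y m))
      ((tgtDeriv_oneDeriv G m (Y m)).trans (h1 _ (G.isGroupoid.tgt_one m)))
    rw [G.isGroupoid.tgt_one] at h2
    have h3 : θ m (Y m) = -Ω.form (G.one m) (B (G.one m)) (G.oneDeriv m (Y m)) := rfl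
    rw [h3, h2, neg_neg]
  refine ⟨θ, hθs, ?_, hθ⟩
  funext g
  refine eq_pullbackField fun w => ?_
  obtain ⟨Y, hY, hYw⟩ := exists_isSmoothVectorField_eq (mfderiv 𝓘(ℝ, E) 𝓘(ℝ, F) G.tgt g w)
  rw [flat_mlieBracket_pullbackField hG hφ hψ hY g hYw.symm, ← hθ Y hY, hYw]

end LieGroupoid

namespace LieGroupoid

variable {E F S P : Type*} [NormedAddCommGroup E] [NormedSpace ℝ E] [FiniteDimensional ℝ E]
  [NormedAddCommGroup F] [NormedSpace ℝ F] [FiniteDimensional ℝ F]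
  [TopologicalSpace S] [ChartedSpace E S] [IsManifold 𝓘(ℝ, E) ∞ S]
  [TopologicalSpace P] [ChartedSpace F P] [IsManifold 𝓘(ℝ, F) ∞ P]
  {G : LieGroupoid E F S P} {Ω : SymplecticForm 𝓘(ℝ, E) S}

/-! ### The Poisson structure on the base -/

theorem cotangentAnchor_skew (hG : G.IsSymplectic Ω)
    (φ ψ : ∀ m : P, TangentSpace 𝓘(ℝ, F) m →L[ℝ] ℝ) (m : P) :
    ψ m (cotangentAnchor hG m (φ m)) = -φ m (cotangentAnchor hG m (ψ m)) := by
  obtain ⟨g, rfl⟩ := G.tgt_surjective m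
  rw [← form_pullbackField_pullbackField hG, ← form_pullbackField_pullbackField hG, Ω.form_swap]

theorem bracket_comp_tgt (hG : G.IsSymplectic Ω) (f₁ f₂ : C^∞⟮𝓘(ℝ, F), P; ℝ⟯) (g : S) :
    Ω.bracket (f₁ ∘ G.tgt) (f₂ ∘ G.tgt) g = dfun 𝓘(ℝ, F) f₂ (G.tgt g)
      (cotangentAnchor hG (G.tgt g) (dfun 𝓘(ℝ, F) f₁ (G.tgt g))) := by
  rw [SymplecticForm.bracket, dfun_comp_tgt f₁.contMDiff, dfun_comp_tgt f₂.contMDiff]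
  exact form_pullbackField_pullbackField hG (dfun 𝓘(ℝ, F) f₁) (dfun 𝓘(ℝ, F) f₂) g

/-- The vector field on `P` obtained from `df` and the anchor `T^*P → TP`. -/
noncomputable def hamiltonianField (hG : G.IsSymplectic Ω) (f : P → ℝ) (m : P) :
    TangentSpace 𝓘(ℝ, F) m :=
  cotangentAnchor hG m (dfun 𝓘(ℝ, F) f m)

theorem isSmoothVectorField_hamiltonianField (hG : G.IsSymplectic Ω) {f : P → ℝ}
    (hf : ContMDiff 𝓘(ℝ, F) 𝓘(ℝ, ℝ) ∞ f) :
    IsSmoothVectorField 𝓘(ℝ, F) (hamiltonianField hG f) :=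
  isSmoothVectorField_cotangentAnchor hG (isSmoothOneForm_dfun hf)

theorem dfun_hamiltonianField_skew (hG : G.IsSymplectic Ω) (f h : P → ℝ) (m : P) :
    dfun 𝓘(ℝ, F) h m (hamiltonianField hG f m) = -dfun 𝓘(ℝ, F) f m (hamiltonianField hG h m) :=
  cotangentAnchor_skew hG (dfun 𝓘(ℝ, F) f) (dfun 𝓘(ℝ, F) h) m

theorem contMDiff_dfun_hamiltonianField (hG : G.IsSymplectic Ω) {f h : P → ℝ}
    (hf : ContMDiff 𝓘(ℝ, F) 𝓘(ℝ, ℝ) ∞ f) (hh : ContMDiff 𝓘(ℝ, F) 𝓘(ℝ, ℝ) ∞ h) :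
    ContMDiff 𝓘(ℝ, F) 𝓘(ℝ, ℝ) ∞ (fun m => dfun 𝓘(ℝ, F) h m (hamiltonianField hG f m)) :=
  contMDiff_dfun_apply hh (isSmoothVectorField_hamiltonianField hG hf)

variable [T2Space P]

/-- The anchor of any Poisson structure for which `β` is Poisson is the one transported from the
algebroid. This determines it, as the covectors at `m` are the differentials of functions. -/
theorem anchor_eq_cotangentAnchor (hG : G.IsSymplectic Ω) {ϖ : PoissonStructure 𝓘(ℝ, F) P}
    (h : ϖ.IsPoissonMap Ω G.tgt) (m : P) (φ : TangentSpace 𝓘(ℝ, F) m →L[ℝ] ℝ) :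
    ϖ.anchor m φ = cotangentAnchor hG m φ := by
  have h1 : ∀ f₁ f₂ : C^∞⟮𝓘(ℝ, F), P; ℝ⟯, dfun 𝓘(ℝ, F) f₁ m = φ →
      dfun 𝓘(ℝ, F) f₂ m (cotangentAnchor hG m φ) = ϖ.bracket f₁ f₂ m := by
    rintro f₁ f₂ rfl
    obtain ⟨g, rfl⟩ := G.tgt_surjective m
    rw [← h f₁ f₂ g, bracket_comp_tgt hG]
  have hex : ∃ v : TangentSpace 𝓘(ℝ, F) m, ∀ f₁ f₂ : C^∞⟮𝓘(ℝ, F), P; ℝ⟯, dfun 𝓘(ℝ, F) f₁ m = φ →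
      dfun 𝓘(ℝ, F) f₂ m v = ϖ.bracket f₁ f₂ m := ⟨_, h1⟩
  rw [PoissonStructure.anchor, dif_pos hex]
  obtain ⟨f₁, hf₁⟩ := exists_dfun_eq φ
  refine eq_of_forall_dfun_eq fun f₂ => ?_
  rw [hex.choose_spec f₁ f₂ hf₁, h1 f₁ f₂ hf₁]

variable [T2Space S]

/-- The Hamiltonian field of a bracket is the Lie bracket of the Hamiltonian fields. -/
theorem hamiltonianField_bracket (hG : G.IsSymplectic Ω) {f h : P → ℝ}
    (hf : ContMDiff 𝓘(ℝ, F) 𝓘(ℝ, ℝ) ∞ f) (hh : ContMDiff 𝓘(ℝ, F) 𝓘(ℝ, ℝ) ∞ h) (m : P) :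
    hamiltonianField hG (fun q => dfun 𝓘(ℝ, F) h q (hamiltonianField hG f q)) m =
      VectorField.mlieBracket 𝓘(ℝ, F) (hamiltonianField hG f) (hamiltonianField hG h) m := by
  have hFc : CompleteSpace F := FiniteDimensional.complete ℝ F
  have hf1 := isSmoothOneForm_dfun hf
  have hh1 := isSmoothOneForm_dfun hh
  -- The bracket of the exact forms `df` and `dh` is `d{f, h}`.
  obtain ⟨θ, -, hθ, hθY⟩ := exists_mlieBracket_pullbackField_eq hG hf1 hh1
  have h1 : ∀ m, θ m = dfun 𝓘(ℝ, F) (fun q => dfun 𝓘(ℝ, F) h q (hamiltonianField hG f q)) m := by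
    intro m
    ext y
    obtain ⟨Y, hY, rfl⟩ := exists_isSmoothVectorField_eq y
    rw [hθY Y hY]
    have e1 := dfun_mlieBracket hh (isSmoothVectorField_hamiltonianField hG hf) hY m
    have e2 := dfun_mlieBracket hf (isSmoothVectorField_hamiltonianField hG hh) hY m
    have e3 : dfun 𝓘(ℝ, F) (fun q => dfun 𝓘(ℝ, F) f q (hamiltonianField hG h q)) m (Y m)
        = -dfun 𝓘(ℝ, F) (fun q => dfun 𝓘(ℝ, F) h q (hamiltonianField hG f q)) m (Y m) := by
      have : (fun q => dfun 𝓘(ℝ, F) f q (hamiltonianField hG h q))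
          = -fun q => dfun 𝓘(ℝ, F) h q (hamiltonianField hG f q) :=
        funext fun q => dfun_hamiltonianField_skew hG h f q
      rw [this, dfun, mfderiv_neg]
      rfl
    have e4 : formBracketPairing hG (dfun 𝓘(ℝ, F) f) (dfun 𝓘(ℝ, F) h) Y m =
      (dfun 𝓘(ℝ, F) (fun q => dfun 𝓘(ℝ, F) h q (Y q)) m (hamiltonianField hG f m)
        - dfun 𝓘(ℝ, F) h m (VectorField.mlieBracket 𝓘(ℝ, F) (hamiltonianField hG f) Y m))
      - (dfun 𝓘(ℝ, F) (fun q => dfun 𝓘(ℝ, F) f q (Y q)) m (hamiltonianField hG h m)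
        - dfun 𝓘(ℝ, F) f m (VectorField.mlieBracket 𝓘(ℝ, F) (hamiltonianField hG h) Y m))
      - dfun 𝓘(ℝ, F) (fun q => dfun 𝓘(ℝ, F) h q (hamiltonianField hG f q)) m (Y m) := rfl
    rw [e4, e1, e2, e3]
    ring
  rw [hamiltonianField, ← h1]
  obtain ⟨g, rfl⟩ := G.tgt_surjective m
  rw [← mfderiv_tgt_pullbackField hG θ g, ← hθ]
  exact mlieBracket_pullbackField_related hG hf1 hh1 g

/-- The Poisson structure of the base, `{f, h} = ⟨dh, a(df)⟩`. -/
noncomputable def poissonStructure (hG : G.IsSymplectic Ω) : PoissonStructure 𝓘(ℝ, F) P where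
  bracket f h := ⟨fun m => dfun 𝓘(ℝ, F) h m (hamiltonianField hG f m),
    contMDiff_dfun_hamiltonianField hG f.contMDiff h.contMDiff⟩
  add_right f g h := by
    ext m
    exact DFunLike.congr_fun (mfderiv_add (mdifferentiableAt_of_contMDiff_real g.contMDiff m)
      (mdifferentiableAt_of_contMDiff_real h.contMDiff m)) _
  smul_right c f g := by
    ext m
    exact DFunLike.congr_fun
      (const_smul_mfderiv (mdifferentiableAt_of_contMDiff_real g.contMDiff m) c) _
  skew f g := by
    ext m
    exact dfun_hamiltonianField_skew hG f g m
  jacobi f g h := by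
    have hFc : CompleteSpace F := FiniteDimensional.complete ℝ F
    ext m
    have h1 := congrArg (dfun 𝓘(ℝ, F) h m)
      (hamiltonianField_bracket hG f.contMDiff g.contMDiff m)
    rw [dfun_mlieBracket h.contMDiff (isSmoothVectorField_hamiltonianField hG f.contMDiff)
      (isSmoothVectorField_hamiltonianField hG g.contMDiff), dfun_hamiltonianField_skew] at h1
    have h2 : dfun 𝓘(ℝ, F) (fun q => dfun 𝓘(ℝ, F) f q (hamiltonianField hG h q)) m
        (hamiltonianField hG g m) =
        -dfun 𝓘(ℝ, F) (fun q => dfun 𝓘(ℝ, F) h q (hamiltonianField hG f q)) m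
        (hamiltonianField hG g m) := by
      have : (fun q => dfun 𝓘(ℝ, F) f q (hamiltonianField hG h q))
          = -fun q => dfun 𝓘(ℝ, F) h q (hamiltonianField hG f q) :=
        funext fun q => dfun_hamiltonianField_skew hG h f q
      rw [this, dfun, mfderiv_neg]
      rfl
    change dfun 𝓘(ℝ, F) (fun q => dfun 𝓘(ℝ, F) h q (hamiltonianField hG g q)) m
        (hamiltonianField hG f m) +
      dfun 𝓘(ℝ, F) (fun q => dfun 𝓘(ℝ, F) f q (hamiltonianField hG h q)) m
        (hamiltonianField hG g m) +
      dfun 𝓘(ℝ, F) (fun q => dfun 𝓘(ℝ, F) g q (hamiltonianField hG f q)) m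
        (hamiltonianField hG h m) = 0
    rw [h2]
    linarith
  leibniz f g h := by
    ext m
    have h1 := ((mdifferentiableAt_of_contMDiff_real g.contMDiff m).hasMFDerivAt.mul
      (mdifferentiableAt_of_contMDiff_real h.contMDiff m).hasMFDerivAt).mfderiv
    have h2 : dfun 𝓘(ℝ, F) (g * h : C^∞⟮𝓘(ℝ, F), P; ℝ⟯) m (hamiltonianField hG f m) =
        g m * dfun 𝓘(ℝ, F) h m (hamiltonianField hG f m)
          + h m * dfun 𝓘(ℝ, F) g m (hamiltonianField hG f m) := DFunLike.congr_fun h1 _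
    change _ = g m * dfun 𝓘(ℝ, F) h m (hamiltonianField hG f m)
      + dfun 𝓘(ℝ, F) g m (hamiltonianField hG f m) * h m
    rw [mul_comm _ (h m)]
    exact h2

theorem isPoissonMap_poissonStructure (hG : G.IsSymplectic Ω) :
    (poissonStructure hG).IsPoissonMap Ω G.tgt := fun f₁ f₂ g => bracket_comp_tgt hG f₁ f₂ g

theorem existsUnique_isPoissonMap (hG : G.IsSymplectic Ω) :
    ∃! ϖ : PoissonStructure 𝓘(ℝ, F) P, ϖ.IsPoissonMap Ω G.tgt := by
  refine ⟨poissonStructure hG, isPoissonMap_poissonStructure hG, fun ϖ h => ?_⟩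
  ext f₁ f₂ m
  obtain ⟨g, rfl⟩ := G.tgt_surjective m
  rw [← h f₁ f₂ g, isPoissonMap_poissonStructure hG f₁ f₂ g]

end LieGroupoid

/-! ### Transport of Lie algebroids along isomorphisms -/

namespace LieAlgebroidData

variable {F H M : Type*} [NormedAddCommGroup F] [NormedSpace ℝ F] [TopologicalSpace H]
  {J : ModelWithCorners ℝ F H} [TopologicalSpace M] [ChartedSpace H M]
  {A B : LieAlgebroidData J M} {φ : ∀ m, A.Fiber m →ₗ[ℝ] B.Fiber m}

/-- A frame for `A` is obtained as the preimage of a frame for `B`. -/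
theorem IsIso.isVectorBundle (h : IsIso A B φ) (hB : B.IsVectorBundle) : A.IsVectorBundle where
  zero := (h.smooth_iff _).2 (by simpa using hB.zero)
  add X Y hX hY := (h.smooth_iff _).2 (by
    simpa using hB.add _ _ ((h.smooth_iff X).1 hX) ((h.smooth_iff Y).1 hY))
  smul f X hX := (h.smooth_iff _).2 (by simpa using hB.smul f _ ((h.smooth_iff X).1 hX))
  isLocal X hX := (h.smooth_iff _).2 (hB.isLocal _ fun m => by
    obtain ⟨Y, hY, hXY⟩ := hX m
    exact ⟨_, (h.smooth_iff Y).1 hY, hXY.mono fun q hq => by rw [hq]⟩)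
  exists_frame m₀ := by
    obtain ⟨k, s, U, hU, hm, hs, hb, hc⟩ := hB.exists_frame m₀
    have hsur : ∀ i, ∃ t : ∀ m, A.Fiber m, ∀ m, φ m (t m) = s i m := fun i => by
      choose t ht using fun m => (h.bijective m).2 (s i m)
      exact ⟨t, ht⟩
    choose t ht using hsur
    refine ⟨k, t, U, hU, hm, fun i => ?_, fun m hmU => ?_, fun X hX => ?_⟩
    · rw [h.smooth_iff]
      simpa only [ht] using hs i
    · let e : A.Fiber m ≃ₗ[ℝ] B.Fiber m := LinearEquiv.ofBijective (φ m) (h.bijective m)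
      have he : (fun i => t i m) = e.symm ∘ fun i => s i m := by
        funext i
        exact (e.symm_apply_eq.2 (ht i m).symm).symm
      obtain ⟨h1, h2⟩ := hb m hmU
      rw [he]
      refine ⟨h1.map' e.symm.toLinearMap e.symm.ker, ?_⟩
      rw [Set.range_comp]
      change Submodule.span ℝ (e.symm.toLinearMap '' _) = ⊤
      rw [Submodule.span_image, h2, Submodule.map_top, LinearMap.range_eq_top]
      exact e.symm.surjective
    · obtain ⟨c, hcs, hc⟩ := hc _ ((h.smooth_iff X).1 hX)
      refine ⟨c, hcs, fun m hmU => (h.bijective m).1 ?_⟩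
      rw [hc m hmU, map_sum]
      simp only [map_smul, ht]

/-- The axioms of a Lie algebroid are transported along isomorphisms. -/
theorem IsIso.isLieAlgebroid [IsManifold J ∞ M] (h : IsIso A B φ) (hB : B.IsLieAlgebroid) :
    A.IsLieAlgebroid := by
  have hs : ∀ {X}, A.IsSmooth X → B.IsSmooth (fun m => φ m (X m)) := fun hX => (h.smooth_iff _).1 hX
  have hbr : ∀ X Y, A.IsSmooth X → A.IsSmooth Y → (fun m => φ m (A.bracket X Y m)) =
      B.bracket (fun q => φ q (X q)) (fun q => φ q (Y q)) := fun X Y hX hY =>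
    funext (h.bracket X Y hX hY)
  have hbs : ∀ X Y, A.IsSmooth X → A.IsSmooth Y → A.IsSmooth (A.bracket X Y) := fun X Y hX hY => by
    rw [h.smooth_iff, hbr X Y hX hY]
    exact hB.bracket_smooth _ _ (hs hX) (hs hY)
  have hvb := h.isVectorBundle hB.isVectorBundle
  have hconst : ∀ (c : ℝ) X, A.IsSmooth X → A.IsSmooth (fun q => c • X q) := fun c X hX =>
    hvb.smul (ContMDiffMap.const c) X hX
  refine ⟨hvb, fun m x y => ?_, fun m c x => ?_, fun X hX => ?_, hbs, fun X Y Z hX hY hZ m => ?_,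
    fun c X Y hX hY m => ?_, fun X Y hX hY m => ?_, fun X Y Z hX hY hZ m => ?_,
    fun f X Y hX hY m => ?_, fun X Y hX hY m => ?_⟩
  · rw [← h.anchor, ← h.anchor, ← h.anchor, map_add, hB.anchor_add]
  · rw [← h.anchor, ← h.anchor, map_smul, hB.anchor_smul]
  · simpa only [h.anchor] using hB.anchor_smooth _ (hs hX)
  · refine (h.bijective m).1 ?_
    rw [h.bracket _ _ hX (hvb.add _ _ hY hZ), map_add, h.bracket _ _ hX hY, h.bracket _ _ hX hZ]
    simp only [map_add]
    exact hB.bracket_add _ _ _ (hs hX) (hs hY) (hs hZ) m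
  · refine (h.bijective m).1 ?_
    rw [h.bracket _ _ hX (hconst c Y hY), map_smul, h.bracket _ _ hX hY]
    simp only [map_smul]
    exact hB.bracket_smul c _ _ (hs hX) (hs hY) m
  · refine (h.bijective m).1 ?_
    rw [h.bracket _ _ hX hY, map_neg, h.bracket _ _ hY hX]
    exact hB.bracket_skew _ _ (hs hX) (hs hY) m
  · refine (h.bijective m).1 ?_
    rw [map_add, map_add, map_zero, h.bracket _ _ hX (hbs _ _ hY hZ),
      h.bracket _ _ hY (hbs _ _ hZ hX), h.bracket _ _ hZ (hbs _ _ hX hY), hbr _ _ hY hZ,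
      hbr _ _ hZ hX, hbr _ _ hX hY]
    exact hB.jacobi _ _ _ (hs hX) (hs hY) (hs hZ) m
  · refine (h.bijective m).1 ?_
    rw [h.bracket _ _ hX (hvb.smul f Y hY), map_add, map_smul, map_smul, h.bracket _ _ hX hY,
      ← h.anchor]
    simp only [map_smul]
    exact hB.leibniz f _ _ (hs hX) (hs hY) m
  · rw [← h.anchor, h.bracket _ _ hX hY, hB.anchor_bracket _ _ (hs hX) (hs hY)]
    simp only [h.anchor]

end LieAlgebroidData

namespace LieGroupoid

variable {E F S P : Type*} [NormedAddCommGroup E] [NormedSpace ℝ E] [FiniteDimensional ℝ E]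
  [NormedAddCommGroup F] [NormedSpace ℝ F] [FiniteDimensional ℝ F]
  [TopologicalSpace S] [T2Space S] [ChartedSpace E S] [IsManifold 𝓘(ℝ, E) ∞ S]
  [TopologicalSpace P] [T2Space P] [ChartedSpace F P] [IsManifold 𝓘(ℝ, F) ∞ P]
  {G : LieGroupoid E F S P} {Ω : SymplecticForm 𝓘(ℝ, E) S} {ϖ : PoissonStructure 𝓘(ℝ, F) P}

/-! ### The isomorphism of Lie algebroids -/

/-- The bracket of the cotangent algebroid, which is defined by a choice of a 1-form with the
required pairings, is the form `θ` with `[V_φ, V_ψ] = V_θ`. -/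
theorem cotangentAlgebroid_bracket (hG : G.IsSymplectic Ω) (h : ϖ.IsPoissonMap Ω G.tgt)
    {φ ψ : ∀ m : P, TangentSpace 𝓘(ℝ, F) m →L[ℝ] ℝ} (hφ : IsSmoothOneForm 𝓘(ℝ, F) φ)
    (hψ : IsSmoothOneForm 𝓘(ℝ, F) ψ) :
    IsSmoothOneForm 𝓘(ℝ, F) (ϖ.cotangentAlgebroid.bracket φ ψ) ∧
      G.pullbackField Ω (ϖ.cotangentAlgebroid.bracket φ ψ) =
        VectorField.mlieBracket 𝓘(ℝ, E) (G.pullbackField Ω φ) (G.pullbackField Ω ψ) := by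
  obtain ⟨θ, hθs, hθ, hθY⟩ := exists_mlieBracket_pullbackField_eq hG hφ hψ
  have h1 : ∀ (Y : ∀ m : P, TangentSpace 𝓘(ℝ, F) m) (m : P), formBracketPairing hG φ ψ Y m =
      PoissonStructure.lieDerivPairing 𝓘(ℝ, F) (fun q => ϖ.anchor q (φ q)) ψ Y m
      - PoissonStructure.lieDerivPairing 𝓘(ℝ, F) (fun q => ϖ.anchor q (ψ q)) φ Y m
      - dfun 𝓘(ℝ, F) (fun q => ψ q (ϖ.anchor q (φ q))) m (Y m) := by
    intro Y m
    simp only [anchor_eq_cotangentAnchor hG h]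
    rfl
  have hex : ∃ θ, ϖ.IsFormBracket φ ψ θ := ⟨θ, fun Y hY m => by rw [hθY Y hY, h1]⟩
  have h2 : ϖ.cotangentAlgebroid.bracket φ ψ = hex.choose := dif_pos hex
  have h3 : hex.choose = θ := by
    funext m
    ext y
    obtain ⟨Y, hY, rfl⟩ := exists_isSmoothVectorField_eq y
    rw [hex.choose_spec Y hY m, hθY Y hY m, h1]
  rw [h2, h3]
  exact ⟨hθs, hθ.symm⟩

theorem cotangentAlgebroid_isVectorBundle (ϖ : PoissonStructure 𝓘(ℝ, F) P) :
    ϖ.cotangentAlgebroid.IsVectorBundle where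
  zero := contMDiff_zeroSection ℝ (fun m : P => TangentSpace 𝓘(ℝ, F) m →L[ℝ] ℝ)
  add X Y hX hY :=
    have : ∀ m : P, ContinuousAdd (TangentSpace 𝓘(ℝ, F) m →L[ℝ] ℝ) :=
      fun _ => inferInstanceAs (ContinuousAdd (F →L[ℝ] ℝ))
    ContMDiff.add_section (V := fun m : P => TangentSpace 𝓘(ℝ, F) m →L[ℝ] ℝ) hX hY
  smul f X hX :=
    ContMDiff.smul_section (V := fun m : P => TangentSpace 𝓘(ℝ, F) m →L[ℝ] ℝ) f.contMDiff hX
  isLocal X hX m := by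
    obtain ⟨Y, hY, hXY⟩ := hX m
    refine (hY m).congr_of_eventuallyEq (hXY.mono fun q hq => ?_)
    exact congrArg (TotalSpace.mk q) hq
  exists_frame m₀ := by
    obtain ⟨s, U, h⟩ := exists_contMDiff_frame (E := F) (F := F →L[ℝ] ℝ)
      (V := fun m : P => TangentSpace 𝓘(ℝ, F) m →L[ℝ] ℝ) m₀
    exact ⟨_, s, U, h⟩

/-- The bracket of `1`-forms on `P` is carried by the injective map `φ ↦ V_φ` to the commutator of
vector fields on `S`, and the function `f` acts through `f ∘ β`. So the Lie algebra identities and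
the Leibniz rule are those of vector fields, and the anchor is a homomorphism because `V_φ` is
`β`-related to the anchor of `φ`. -/
theorem cotangentAlgebroid_isLieAlgebroid (hG : G.IsSymplectic Ω) (h : ϖ.IsPoissonMap Ω G.tgt) :
    ϖ.cotangentAlgebroid.IsLieAlgebroid := by
  have hEc : CompleteSpace E := FiniteDimensional.complete ℝ E
  have h2 : IsManifold 𝓘(ℝ, E) 2 S := .of_le (n := ∞) (WithTop.coe_le_coe.2 (le_top : (2 : ℕ∞) ≤ ⊤))
  have h3 : IsManifold 𝓘(ℝ, E) (minSmoothness ℝ 3) S := isManifold_minSmoothness 3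
  have hvb := cotangentAlgebroid_isVectorBundle ϖ
  have hV : ∀ {φ : ∀ m : P, TangentSpace 𝓘(ℝ, F) m →L[ℝ] ℝ}, IsSmoothOneForm 𝓘(ℝ, F) φ →
      ∀ g, MDifferentiableAt 𝓘(ℝ, E) 𝓘(ℝ, E).tangent
        (fun g => (⟨g, G.pullbackField Ω φ g⟩ : TangentBundle 𝓘(ℝ, E) S)) g := fun hφ g =>
    (isSmoothVectorField_pullbackField hφ g).mdifferentiableAt (by simp)
  have hV2 : ∀ {φ : ∀ m : P, TangentSpace 𝓘(ℝ, F) m →L[ℝ] ℝ}, IsSmoothOneForm 𝓘(ℝ, F) φ →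
      ∀ g, ContMDiffAt 𝓘(ℝ, E) 𝓘(ℝ, E).tangent (minSmoothness ℝ 2)
        (fun g => (⟨g, G.pullbackField Ω φ g⟩ : TangentBundle 𝓘(ℝ, E) S)) g := fun hφ g =>
    (isSmoothVectorField_pullbackField hφ g).of_le (by
      rw [minSmoothness_of_isRCLikeNormedField]
      exact WithTop.coe_le_coe.2 (le_top : (2 : ℕ∞) ≤ ⊤))
  have hext : ∀ {φ ψ : ∀ m : P, TangentSpace 𝓘(ℝ, F) m →L[ℝ] ℝ},
      (∀ g, G.pullbackField Ω φ g = G.pullbackField Ω ψ g) → ∀ m, φ m = ψ m :=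
    fun h m => congrFun (eq_of_pullbackField_eq h) m
  have hadd : ∀ (φ ψ : ∀ m : P, TangentSpace 𝓘(ℝ, F) m →L[ℝ] ℝ) (g : S),
      G.pullbackField Ω (fun m => φ m + ψ m) g = G.pullbackField Ω φ g + G.pullbackField Ω ψ g :=
    fun φ ψ g => congrFun (pullbackField_add φ ψ) g
  have hsmul : ∀ (f : P → ℝ) (φ : ∀ m : P, TangentSpace 𝓘(ℝ, F) m →L[ℝ] ℝ) (g : S),
      G.pullbackField Ω (fun m => f m • φ m) g = f (G.tgt g) • G.pullbackField Ω φ g :=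
    fun f φ g => congrFun (pullbackField_smul f φ) g
  have hsadd : ∀ {φ ψ : ∀ m : P, TangentSpace 𝓘(ℝ, F) m →L[ℝ] ℝ}, IsSmoothOneForm 𝓘(ℝ, F) φ →
      IsSmoothOneForm 𝓘(ℝ, F) ψ → IsSmoothOneForm 𝓘(ℝ, F) (fun m => φ m + ψ m) :=
    fun hφ hψ => hvb.add _ _ hφ hψ
  have hssmul : ∀ (f : C^∞⟮𝓘(ℝ, F), P; ℝ⟯) {φ : ∀ m : P, TangentSpace 𝓘(ℝ, F) m →L[ℝ] ℝ},
      IsSmoothOneForm 𝓘(ℝ, F) φ → IsSmoothOneForm 𝓘(ℝ, F) (fun m => f m • φ m) :=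
    fun f φ hφ => hvb.smul f _ hφ
  -- The bracket enters only through `hBs` and `hB`.
  obtain ⟨br, hbr⟩ : ∃ br : (∀ m : P, TangentSpace 𝓘(ℝ, F) m →L[ℝ] ℝ) →
      (∀ m : P, TangentSpace 𝓘(ℝ, F) m →L[ℝ] ℝ) → ∀ m : P, TangentSpace 𝓘(ℝ, F) m →L[ℝ] ℝ,
      ϖ.cotangentAlgebroid.bracket = br := ⟨_, rfl⟩
  have hBs : ∀ {φ ψ : ∀ m : P, TangentSpace 𝓘(ℝ, F) m →L[ℝ] ℝ}, IsSmoothOneForm 𝓘(ℝ, F) φ →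
      IsSmoothOneForm 𝓘(ℝ, F) ψ → IsSmoothOneForm 𝓘(ℝ, F) (br φ ψ) := fun hφ hψ =>
    hbr ▸ (cotangentAlgebroid_bracket hG h hφ hψ).1
  have hB : ∀ {φ ψ : ∀ m : P, TangentSpace 𝓘(ℝ, F) m →L[ℝ] ℝ}, IsSmoothOneForm 𝓘(ℝ, F) φ →
      IsSmoothOneForm 𝓘(ℝ, F) ψ → G.pullbackField Ω (br φ ψ) =
      VectorField.mlieBracket 𝓘(ℝ, E) (G.pullbackField Ω φ) (G.pullbackField Ω ψ) := fun hφ hψ =>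
    hbr ▸ (cotangentAlgebroid_bracket hG h hφ hψ).2
  have ha := anchor_eq_cotangentAnchor hG h
  have hanchor : ∀ X : ∀ m : P, TangentSpace 𝓘(ℝ, F) m →L[ℝ] ℝ,
      (fun m => ϖ.anchor m (X m)) = fun m => cotangentAnchor hG m (X m) :=
    fun X => funext fun m => ha m (X m)
  have hbadd : ∀ X Y Z : ∀ m : P, TangentSpace 𝓘(ℝ, F) m →L[ℝ] ℝ, IsSmoothOneForm 𝓘(ℝ, F) X →
      IsSmoothOneForm 𝓘(ℝ, F) Y → IsSmoothOneForm 𝓘(ℝ, F) Z → ∀ m,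
      br X (fun q => Y q + Z q) m = br X Y m + br X Z m := fun X Y Z hX hY hZ => by
    refine hext (φ := br X (fun q => Y q + Z q)) (ψ := fun m => br X Y m + br X Z m) fun g => ?_
    rw [hadd, hB hX hY, hB hX hZ, hB hX (hsadd hY hZ), pullbackField_add]
    exact VectorField.mlieBracket_add_right (hV hY g) (hV hZ g)
  have hbsmul : ∀ (c : ℝ) (X Y : ∀ m : P, TangentSpace 𝓘(ℝ, F) m →L[ℝ] ℝ),
      IsSmoothOneForm 𝓘(ℝ, F) X → IsSmoothOneForm 𝓘(ℝ, F) Y → ∀ m,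
      br X (fun q => c • Y q) m = c • br X Y m := fun c X Y hX hY => by
    refine hext (φ := br X (fun q => c • Y q)) (ψ := fun m => c • br X Y m) fun g => ?_
    have hcY : IsSmoothOneForm 𝓘(ℝ, F) (fun q => c • Y q) := hssmul (ContMDiffMap.const c) hY
    rw [hsmul (fun _ => c), hB hX hY, hB hX hcY, pullbackField_smul (fun _ => c)]
    exact VectorField.mlieBracket_const_smul_right (hV hY g)
  have hbskew : ∀ X Y : ∀ m : P, TangentSpace 𝓘(ℝ, F) m →L[ℝ] ℝ, IsSmoothOneForm 𝓘(ℝ, F) X →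
      IsSmoothOneForm 𝓘(ℝ, F) Y → ∀ m, br X Y m = -br Y X m := fun X Y hX hY m => by
    have h4 : br X Y m = (-1 : ℝ) • br Y X m := by
      refine hext (φ := br X Y) (ψ := fun m => (-1 : ℝ) • br Y X m) (fun g => ?_) m
      rw [hsmul (fun _ => -1), hB hX hY, hB hY hX, neg_one_smul, VectorField.mlieBracket_swap_apply]
    exact h4.trans (neg_one_smul ℝ (br Y X m : F →L[ℝ] ℝ))
  have hbjac : ∀ X Y Z : ∀ m : P, TangentSpace 𝓘(ℝ, F) m →L[ℝ] ℝ, IsSmoothOneForm 𝓘(ℝ, F) X →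
      IsSmoothOneForm 𝓘(ℝ, F) Y → IsSmoothOneForm 𝓘(ℝ, F) Z → ∀ m,
      br X (br Y Z) m + br Y (br Z X) m + br Z (br X Y) m = 0 := fun X Y Z hX hY hZ m => by
    have h4 : br X (br Y Z) m + br Y (br Z X) m + br Z (br X Y) m = (0 : ℝ) • X m := by
      refine hext (φ := fun m => br X (br Y Z) m + br Y (br Z X) m + br Z (br X Y) m)
        (ψ := fun m => (0 : ℝ) • X m) (fun g => ?_) m
      rw [hsmul (fun _ => 0), zero_smul, hadd (fun m => br X (br Y Z) m + br Y (br Z X) m),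
        hadd (br X (br Y Z)), hB hX (hBs hY hZ), hB hY (hBs hZ hX), hB hZ (hBs hX hY), hB hY hZ,
        hB hZ hX, hB hX hY, VectorField.leibniz_identity_mlieBracket_apply (hV2 hX g) (hV2 hY g)
          (hV2 hZ g), VectorField.mlieBracket_swap_apply (V := G.pullbackField Ω Z)
          (W := VectorField.mlieBracket 𝓘(ℝ, E) (G.pullbackField Ω X) (G.pullbackField Ω Y)),
        VectorField.mlieBracket_swap (V := G.pullbackField Ω Z) (W := G.pullbackField Ω X)]
      have h5 := VectorField.mlieBracket_const_smul_right (c := (-1 : ℝ)) (x := g)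
        (V := G.pullbackField Ω Y)
        (hB hX hZ ▸ hV (hBs hX hZ) g)
      rw [neg_one_smul, neg_one_smul] at h5
      rw [h5]
      abel
    exact h4.trans (zero_smul ℝ (X m : F →L[ℝ] ℝ))
  have hbleib : ∀ (f : C^∞⟮𝓘(ℝ, F), P; ℝ⟯) (X Y : ∀ m : P, TangentSpace 𝓘(ℝ, F) m →L[ℝ] ℝ),
      IsSmoothOneForm 𝓘(ℝ, F) X → IsSmoothOneForm 𝓘(ℝ, F) Y → ∀ m, br X (fun q => f q • Y q) m =
        f m • br X Y m + dfun 𝓘(ℝ, F) f m (ϖ.anchor m (X m)) • Y m := fun f X Y hX hY => by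
    refine hext (φ := br X (fun q => f q • Y q))
      (ψ := fun m => f m • br X Y m + dfun 𝓘(ℝ, F) f m (ϖ.anchor m (X m)) • Y m) fun g => ?_
    rw [hadd, hsmul, hsmul (fun m => dfun 𝓘(ℝ, F) f m (ϖ.anchor m (X m))), hB hX hY,
      hB hX (hssmul f hY), pullbackField_smul, ha, ← mfderiv_tgt_pullbackField, add_comm]
    have hf : MDifferentiableAt 𝓘(ℝ, E) 𝓘(ℝ, ℝ) (f ∘ G.tgt) g :=
      (f.contMDiff.comp G.contMDiff_tgt).mdifferentiable (by simp) g
    have h4 : dfun 𝓘(ℝ, E) (f ∘ G.tgt) g (G.pullbackField Ω X g) = dfun 𝓘(ℝ, F) f (G.tgt g)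
        (mfderiv 𝓘(ℝ, E) 𝓘(ℝ, F) G.tgt g (G.pullbackField Ω X g)) :=
      DFunLike.congr_fun (dfun_comp_tgt f.contMDiff g) _
    rw [← h4]
    exact VectorField.mlieBracket_smul_right hf (hV hY g)
  have hbanchor : ∀ X Y : ∀ m : P, TangentSpace 𝓘(ℝ, F) m →L[ℝ] ℝ, IsSmoothOneForm 𝓘(ℝ, F) X →
      IsSmoothOneForm 𝓘(ℝ, F) Y → ∀ m, ϖ.anchor m (br X Y m) = VectorField.mlieBracket 𝓘(ℝ, F)
        (fun q => ϖ.anchor q (X q)) (fun q => ϖ.anchor q (Y q)) m := fun X Y hX hY m => by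
    obtain ⟨g, rfl⟩ := G.tgt_surjective m
    rw [anchor_eq_cotangentAnchor hG h, hanchor, hanchor, ← mfderiv_tgt_pullbackField, hB hX hY,
      mlieBracket_pullbackField_related hG hX hY]
  subst hbr
  exact ⟨hvb,
    fun m x y => (ha m _).trans ((map_add (cotangentAnchor hG m) x y).trans
      (congrArg₂ _ (ha m x).symm (ha m y).symm)),
    fun m c x => (ha m _).trans ((map_smul (cotangentAnchor hG m) c x).trans
      (congrArg _ (ha m x).symm)),
    fun X hX => (congrArg (IsSmoothVectorField 𝓘(ℝ, F)) (hanchor X)).mpr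
      (isSmoothVectorField_cotangentAnchor hG hX),
    fun X Y hX hY => hBs hX hY, hbadd, hbsmul, hbskew, hbjac, hbleib, hbanchor⟩

/-- The isomorphism intertwines the brackets: both are transported from the commutator of vector
fields on `S`, as the right-invariant field of `X` is `V_φ` for `φ = r(X)`. -/
theorem algebroidMap_bracket (hG : G.IsSymplectic Ω) (h : ϖ.IsPoissonMap Ω G.tgt)
    {X Y : ∀ m : P, G.algebroidFiber m} (hX : G.IsSmoothSection X) (hY : G.IsSmoothSection Y)
    (m : P) : G.algebroidMap Ω m (G.algebroid.bracket X Y m) =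
      ϖ.cotangentAlgebroid.bracket (fun q => G.algebroidMap Ω q (X q))
        (fun q => G.algebroidMap Ω q (Y q)) m := by
  obtain ⟨θ, hθ⟩ : ∃ θ : ∀ m : P, TangentSpace 𝓘(ℝ, F) m →L[ℝ] ℝ,
      ϖ.cotangentAlgebroid.bracket (fun q => G.algebroidMap Ω q (X q))
        (fun q => G.algebroidMap Ω q (Y q)) = θ := ⟨_, rfl⟩
  have hbr : G.pullbackField Ω θ = _ := hθ ▸ (cotangentAlgebroid_bracket hG h
    (isSmoothOneForm_algebroidMap hX) (isSmoothOneForm_algebroidMap hY)).2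
  rw [← rightInvariant_eq_pullbackField hG X, ← rightInvariant_eq_pullbackField hG Y] at hbr
  have hex : ∃ Z : (∀ m, G.algebroidFiber m), ∀ g, G.rightInvariant Z g
      = VectorField.mlieBracket 𝓘(ℝ, E) (G.rightInvariant X) (G.rightInvariant Y) g := by
    refine ⟨fun m => (algebroidEquiv hG m).symm (θ m), fun g => ?_⟩
    rw [← hbr, rightInvariant_algebroidEquiv_symm hG]
  have h1 : G.algebroid.bracket X Y = hex.choose := dif_pos hex
  have h2 : ∀ g, G.pullbackField Ω (fun m => G.algebroidMap Ω m (hex.choose m)) g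
      = G.pullbackField Ω θ g := fun g => by
    rw [hbr, ← rightInvariant_eq_pullbackField hG hex.choose]
    exact hex.choose_spec g
  rw [hθ, h1]
  exact congrFun (eq_of_pullbackField_eq h2) m

theorem isIso_algebroidMap (hG : G.IsSymplectic Ω) (h : ϖ.IsPoissonMap Ω G.tgt) :
    LieAlgebroidData.IsIso G.algebroid ϖ.cotangentAlgebroid (G.algebroidMap Ω) where
  bijective := algebroidMap_bijective hG
  smooth_iff X := by
    refine ⟨fun hX => isSmoothOneForm_algebroidMap hX, fun hX => ?_⟩
    have h1 := isSmoothSection_algebroidEquiv_symm hG hX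
    have h2 : (fun m => (algebroidEquiv hG m).symm (G.algebroidMap Ω m (X m))) = X :=
      funext fun m => (algebroidEquiv hG m).symm_apply_apply (X m)
    exact (congrArg G.IsSmoothSection h2).mp h1
  anchor m X := (anchor_eq_cotangentAnchor hG h m _).trans (cotangentAnchor_algebroidMap hG m X)
  bracket X Y hX hY m := algebroidMap_bracket hG h hX hY m

end LieGroupoid

theorem theorem2p2 {E F S P : Type*}
    [NormedAddCommGroup E] [NormedSpace ℝ E] [FiniteDimensional ℝ E]
    [NormedAddCommGroup F] [NormedSpace ℝ F] [FiniteDimensional ℝ F]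
    [TopologicalSpace S] [T2Space S] [ChartedSpace E S] [IsManifold 𝓘(ℝ, E) ∞ S]
    [TopologicalSpace P] [T2Space P] [ChartedSpace F P] [IsManifold 𝓘(ℝ, F) ∞ P]
    (G : LieGroupoid E F S P) (Ω : SymplecticForm 𝓘(ℝ, E) S) (hG : G.IsSymplectic Ω) :
    -- the unit submanifold is Lagrangian
    IsLagrangian 𝓘(ℝ, E) (fun g v w => Ω.form g v w) (Set.range G.one) ∧
    -- inversion is an antisymplectomorphism
    IsAntisymplectomorphism Ω G.inv ∧
    -- there is a unique Poisson structure on the base for which the target is a Poisson map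
    (∃! ϖ : PoissonStructure 𝓘(ℝ, F) P, ϖ.IsPoissonMap Ω G.tgt) ∧
    -- for this Poisson structure, the restriction of `Ω♭` is an isomorphism of Lie algebroids
    -- from the Lie algebroid of the groupoid to the cotangent Lie algebroid of the base
    (∀ ϖ : PoissonStructure 𝓘(ℝ, F) P, ϖ.IsPoissonMap Ω G.tgt →
      G.algebroid.IsLieAlgebroid ∧ ϖ.cotangentAlgebroid.IsLieAlgebroid ∧
      (∀ (m : P) (X : G.algebroidFiber m),
        Ω.flat (G.one m) X = (G.algebroidMap Ω m X).comp (G.tgtDeriv m)) ∧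
      LieAlgebroidData.IsIso G.algebroid ϖ.cotangentAlgebroid (G.algebroidMap Ω)) ∧
    -- `Ω♭` is a smooth morphism from the tangent groupoid to the cotangent groupoid
    (G.tangentGroupoid.IsGroupoid ∧ G.cotangentGroupoid.IsGroupoid ∧
      G.tangentGroupoid.IsMorphism G.cotangentGroupoid (G.flatMap Ω) (G.baseMap Ω) ∧
      ContMDiff 𝓘(ℝ, E).tangent (𝓘(ℝ, E).prod 𝓘(ℝ, E →L[ℝ] ℝ)) ∞ (G.flatMap Ω) ∧
      G.IsSmoothToDual (G.baseMap Ω)) :=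
  ⟨LieGroupoid.isLagrangian_range_one hG, LieGroupoid.isAntisymplectomorphism_inv hG,
    LieGroupoid.existsUnique_isPoissonMap hG,
    fun _ h =>
      have hT := LieGroupoid.cotangentAlgebroid_isLieAlgebroid hG h
      have hr := LieGroupoid.isIso_algebroidMap hG h
      ⟨hr.isLieAlgebroid hT, hT, fun m X => LieGroupoid.flat_eq_algebroidMap_comp hG m X, hr⟩,
    G.tangentGroupoid_isGroupoid, LieGroupoid.cotangentGroupoid_isGroupoid hG,
    LieGroupoid.flatMap_isMorphism hG, LieGroupoid.contMDiff_flatMap,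
    LieGroupoid.isSmoothToDual_baseMap⟩
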